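/- Let $\mathbb H=\{(x,y): y>0\}$ be the Poincaré half-plane with metric $ds^2=(dx^2+dy^2)/y^2$ and origin $(0,1)$. Let $B^{hp}_2$ be the planar hyperbolic Brownian motion started at the origin, that is, the diffusion on $\mathbb H$ with generator $\mathcal H_2=\frac{y^2}{2}\left(\frac{\partial^2}{\partial x^2}+\frac{\partial^2}{\partial y^2}\right)$ (continuous paths in $\mathbb H$, solving the martingale problem for $\mathcal H_2$ on $C_c^\infty(\mathbb H)$). Let $B$ be a standard real Brownian motion started at $0$ and independent of $B^{hp}_2$, let $T_t=\inf\{s: B(s)=t\}$, $t>0$, and let $J_2(t)$ be the hyperbolic distance of $B^{hp}_2(T_t)$ from the origin. Let $K_\nu(x)=\int_0^\infty e^{-x\cosh u}\cosh(\nu u)\,du$ be the modified Bessel function of the second kind, and for $\eta,t,s>0$ put $$p_{J_2}(\eta,t)=\frac{t\sinh\eta}{\pi\sqrt{2^3}}\int_\eta^\infty\frac{\varphi}{\sqrt{\cosh\varphi-\cosh\eta}}\,\frac{1}{\varphi^2+t^2}\,K_2\!\left(\tfrac12\sqrt{\varphi^2+t^2}\right)d\varphi ,$$ $$p_2(\eta,s)=\frac{\sinh\eta\,e^{-s/8}}{\sqrt{\pi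 s^3}}\int_\eta^\infty\frac{\varphi\,e^{-\varphi^2/(2s)}}{\sqrt{\cosh\varphi-\cosh\eta}}\,d\varphi ,\qquad g(s,t)=\frac{t\,e^{-t^2/(2s)}}{\sqrt{2\pi s^3}} .$$ **Theorem.** 1. For every $t>0$ the law of $J_2(t)$ is absolutely continuous on $(0,\infty)$ with density $\eta\mapsto p_{J_2}(\eta,t)$. In particular $p_{J_2}(\cdot,t)$ is nonnegative and integrable on $(0,\infty)$ with integral $1$. 2. For all $\eta,t>0$ the integral defining $p_{J_2}(\eta,t)$ converges absolutely, as does $\int_0^\infty p_2(\eta,s)\,g(s,t)\,ds$, and $p_{J_2}(\eta,t)=\int_0^\infty p_2(\eta,s)\,g(s,t)\,ds$. 3. $p_{J_2}$ is twice continuously differentiable on $(0,\infty)$ in each of its two variables, and for all $\eta,t>0$ $$-\frac{\partial^2}{\partial t^2}p_{J_2}(\eta,t)=\frac{\partial^2}{\partial\eta^2}p_{J_2}(\eta,t)-\frac{\partial}{\partial\eta}\left(\frac{1}{\tanh\eta}\,p_{J_2}(\eta,t)\right).$$ 4. The initial condition $p_{J_2}(\eta,0)=\delta(\eta)$ holds: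 for every bounded continuous $f:\mathbb R\to\mathbb R$, $\ \lim_{t\to0^+}\int_0^\infty f(\eta)\,p_{J_2}(\eta,t)\,d\eta=f(0)$. -/

import Mathlib

open MeasureTheory ProbabilityTheory Filter Topology Set
open scoped NNReal ENNReal UpperHalfPlane BoundedContinuousFunction

noncomputable section

/-- The operator `𝓗 f = (y² / 2) (∂²f/∂x² + ∂²f/∂y²)`, half of the Laplace-Beltrami operator of
the metric `(dx² + dy²) / y²`, on functions of `z = x + i y`. -/
def hypGenerator (f : ℂ → ℝ) (z : ℂ) : ℝ :=
  z.im ^ 2 / 2 * Laplacian.laplacian f z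

/-- `X` is a planar hyperbolic Brownian motion started at the origin `i = (0, 1)` of the Poincaré
half-plane: the diffusion with generator `𝓗`, i.e. a process with continuous paths in `ℍ` that
solves the martingale problem for `𝓗` on smooth functions with compact support in `ℍ`. -/
structure IsHypBrownian {Ω : Type*} [mΩ : MeasurableSpace Ω]
    (X : ℝ≥0 → Ω → ℍ) (P : Measure Ω) : Prop where
  start : ∀ᵐ ω ∂P, X 0 ω = UpperHalfPlane.I
  continuous_paths : ∀ ω, Continuous fun s => X s ω
  martingale_problem : ∃ 𝓕 : Filtration ℝ≥0 mΩ, Adapted 𝓕 X ∧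
    ∀ f : ℂ → ℝ, ContDiff ℝ (⊤ : ℕ∞) f → HasCompactSupport f → tsupport f ⊆ {z : ℂ | 0 < z.im} →
      Martingale (fun (t : ℝ≥0) ω => f (X t ω : ℂ) -
        ∫ s in (0 : ℝ)..(t : ℝ), hypGenerator f (X s.toNNReal ω : ℂ)) 𝓕 P

/-- The first-passage time `T_t = inf {s : B(s) = t}` (`0` if the level is never reached, which
has probability zero for a Brownian motion). -/
def firstPassage {Ω : Type*} (B : ℝ≥0 → Ω → ℝ) (t : ℝ) (ω : Ω) : ℝ≥0 :=
  sInf {s : ℝ≥0 | B s ω = t}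

/-- The modified Bessel function of the second kind `K_ν(x)`, `x > 0`. -/
def besselK (ν x : ℝ) : ℝ :=
  ∫ u in Ioi (0 : ℝ), Real.exp (-x * Real.cosh u) * Real.cosh (ν * u)

/-- The function `p₂(η, s)`, `η, s > 0`. -/
def hypRadialDensity (η s : ℝ) : ℝ :=
  Real.sinh η * Real.exp (-s / 8) / √(Real.pi * s ^ 3) *
    ∫ φ in Ioi η, φ * Real.exp (-φ ^ 2 / (2 * s)) / √(Real.cosh φ - Real.cosh η)

/-- The function `g(s, t) = t e^{-t²/(2s)} / √(2 π s³)`, `s, t > 0`. -/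
def firstPassageDensity (s t : ℝ) : ℝ :=
  t * Real.exp (-t ^ 2 / (2 * s)) / √(2 * Real.pi * s ^ 3)

/-- The integrand, in `φ > η`, of the explicit formula for `p_{J₂}(η, t)`. -/
def pJ2Integrand (η t φ : ℝ) : ℝ :=
  φ / √(Real.cosh φ - Real.cosh η) * (1 / (φ ^ 2 + t ^ 2)) *
    besselK 2 (1 / 2 * √(φ ^ 2 + t ^ 2))

/-- The explicit function `p_{J₂}(η, t)`, `η, t > 0`. -/
def pJ2 (η t : ℝ) : ℝ :=
  t * Real.sinh η / (√(2 ^ 3) * Real.pi) * ∫ φ in Ioi η, pJ2Integrand η t φ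

end

/-!
The density `p_{J₂}` is studied through the integrals `I_k(a) = ∫ s^(-k) e^{-s/8 - a/(2s)} ds` over
`s > 0` (`gigIntegral`), which are modified Bessel functions in the variable `√a / 2`; in particular
`I₃(a) = K₂(√a / 2) / (2 a)`. They satisfy `I_k' = -I_{k+1} / 2` and a three-term recurrence.

*The governing equation.* The substitution `cosh φ = cosh η + w²` removes the singularity at
`φ = η` and exhibits `p_{J₂}(η, t)` as `(√2 / π) sinh η` times the value at `x = cosh η` of the Abel
transform `Q(x, t) = ∫ H(x + w², t) dw` over `w > 0` of the function `H = t I₃(φ² + t²) φ / sinh φ`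
of `X = cosh φ` (`pJ2_eq_abelTransform`). The Bessel recurrence gives
`-∂²H/∂t² = (X² - 1) ∂²H/∂X² + 3 X ∂H/∂X + 3 H / 4` (`abelSource_pde`), and by an integration by
parts in `w` the Abel transform carries it to `-∂²Q/∂t² = ∂/∂x ((x² - 1) ∂Q/∂x)`
(`abelTransform_pde`). In the variable `η` this is the equation of `p_{J₂}` (`pJ2_pde`). All
differentiations under the integral rest on the decay of `H` and its derivatives like powers of
`1 / X` (`exists_bound_abelSource`).

*Subordination.* By Tonelli, integrating the integrand of `p₂(η, s)` against `g(s, t) ds` produces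
the integral `I₃(φ² + t²)`, so the mixture of the `p₂(·, s)` is `p_{J₂}(·, t)` (`pJ2_eq_integral`).
The tail of `p₂(·, s)` beyond `η` is an explicit integral `radialTail η s`, equal to `1` at `η = 0`
because there it is the mass of a Gaussian. Hence `p_{J₂}(·, t)` has mass one (`integral_pJ2`) and
its tails are mixtures of the `radialTail η s` (`lintegral_pJ2`). Under `g(·, t)` the time `s` is
distributed as `t² / N²` with `N` standard normal, so it tends to `0` with `t`, and the initial
condition follows (`tendsto_integral_mul_pJ2`).

*The first-passage time.* The reflection principle is proved on finite grids, from the independence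
and the symmetry of the increment after the first grid time above the level, and passed to the
limit along continuous paths (`measure_exists_gt_eq_two_mul`). It identifies the distribution
function of `T_t` (`map_firstPassage`). Moreover `T_t` agrees almost surely with a measurable
functional of the values of `B` at rational times (`ratFirstPassage`), hence is independent of the
hyperbolic motion.

*The law of the radial part.* No heat kernel or uniqueness theorem for the martingale problem is
needed. Each boundary point of `ℍ` gives a Busemann function `b`, and the generator maps
`F ∘ b` to `((F'' - F') / 2) ∘ b`. Such functions are not compactly supported; cutting them off at
hyperbolic distance of order `n` costs an error `O(1 / n)`
(`abs_hypGenerator_testFunction_sub_le`), since `log cosh dist(·, i)` has bounded gradient and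
Laplacian. So the martingale problem holds for them in the mean, the characteristic function of
`b(X_s)` solves a linear differential equation in `s`, and `b(X_s)` is Gaussian with mean `-s / 2`
and variance `s` (`map_busemann`). Now average over the boundary circle: for a suitable kernel
(`horocycleKernel`) the average of the kernel at `-b(z)` over all `b` is the indicator
of `η < dist z i` (`lintegral_horocycleKernel_log`), an explicit inversion of the horocyclic Radon
transform on radial functions. Taking expectations, `P (η < dist (X_s) i)` is the integral of the
kernel against one Gaussian, which is `radialTail η s` (`measure_lt_dist_eq_radialTail`).

Conditioning on `T_t` then shows that the tails of `dist (X_{T_t}) i` are the tails of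
`p_{J₂}(·, t)` (`hasLaw_dist_stopped`).
-/

namespace HypBM

/-! ### The integrals `∫ s^(-k) exp (-s / 8 - a / (2 s)) ds` -/

/-- The integrand `s^{-k} e^{-s/8 - a/(2s)}`. -/
noncomputable def gigKernel (k : ℕ) (a s : ℝ) : ℝ :=
  Real.exp (-s / 8 - a / (2 * s)) / s ^ k

/-- The integral `∫₀^∞ s^{-k} e^{-s/8 - a/(2s)} ds`, a rescaled Bessel function of order `k - 1`
in the variable `√a / 2`. -/
noncomputable def gigIntegral (k : ℕ) (a : ℝ) : ℝ :=
  ∫ s in Ioi (0 : ℝ), gigKernel k a s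

lemma gigKernel_pos (k : ℕ) (a : ℝ) {s : ℝ} (hs : 0 < s) : 0 < gigKernel k a s := by
  unfold gigKernel; positivity

lemma gigKernel_anti (k : ℕ) {a b s : ℝ} (hab : a ≤ b) (hs : 0 < s) :
    gigKernel k b s ≤ gigKernel k a s := by
  unfold gigKernel; gcongr

lemma gigKernel_le {k : ℕ} {a s : ℝ} (ha : 0 < a) (hs : 0 < s) :
    gigKernel k a s ≤ k.factorial * (2 / a) ^ k * Real.exp (-(1 / 8) * s) := by
  have h := Real.pow_div_factorial_le_exp (a / (2 * s)) (by positivity) k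
  have h1 : (a / (2 * s)) ^ k = (a / 2) ^ k / s ^ k := by rw [← div_pow]; congr 1; field_simp
  have h2 : gigKernel k a s
      = (1 / s ^ k) * (Real.exp (a / (2 * s)))⁻¹ * Real.exp (-(1 / 8) * s) := by
    unfold gigKernel
    rw [← Real.exp_neg, mul_assoc, ← Real.exp_add, div_eq_mul_inv, mul_comm, one_div]
    ring_nf
  rw [h2]
  refine mul_le_mul_of_nonneg_right ?_ (Real.exp_pos _).le
  rw [← div_eq_mul_inv, div_le_iff₀ (by positivity)]
  have h3 : 1 / s ^ k = k.factorial * (2 / a) ^ k * ((a / (2 * s)) ^ k / k.factorial) := by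
    rw [h1]
    have : ((2 : ℝ) / a) ^ k * (a / 2) ^ k = 1 := by
      rw [← mul_pow]; field_simp; simp
    field_simp
    linear_combination (-1 : ℝ) * this
  rw [h3]
  gcongr

lemma measurable_gigKernel (k : ℕ) (a : ℝ) : Measurable (gigKernel k a) := by
  unfold gigKernel; fun_prop

lemma integrableOn_gigKernel (k : ℕ) {a : ℝ} (ha : 0 < a) :
    IntegrableOn (gigKernel k a) (Ioi 0) := by
  refine Integrable.mono' ((exp_neg_integrableOn_Ioi 0 (b := 1 / 8) (by norm_num)).const_mul
    (k.factorial * (2 / a) ^ k)) (measurable_gigKernel k a).aestronglyMeasurable ?_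
  filter_upwards [ae_restrict_mem measurableSet_Ioi] with s hs
  rw [Real.norm_of_nonneg (gigKernel_pos k a hs).le]
  exact gigKernel_le ha hs

lemma gigIntegral_nonneg (k : ℕ) (a : ℝ) : 0 ≤ gigIntegral k a :=
  setIntegral_nonneg measurableSet_Ioi fun _ hs => (gigKernel_pos k a hs).le

lemma gigIntegral_anti (k : ℕ) {a b : ℝ} (ha : 0 < a) (hab : a ≤ b) :
    gigIntegral k b ≤ gigIntegral k a :=
  setIntegral_mono_on (integrableOn_gigKernel k (ha.trans_le hab)) (integrableOn_gigKernel k ha)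
    measurableSet_Ioi fun _ hs => gigKernel_anti k hab hs

lemma hasDerivAt_gigIntegral (k : ℕ) {a : ℝ} (ha : 0 < a) :
    HasDerivAt (gigIntegral k) (-(1 / 2) * gigIntegral (k + 1) a) a := by
  have key := (hasDerivAt_integral_of_dominated_loc_of_deriv_le
    (μ := volume.restrict (Ioi (0 : ℝ))) (F := gigKernel k)
    (F' := fun b s => -(1 / 2) * gigKernel (k + 1) b s) (x₀ := a) (s := Ioi (a / 2))
    (bound := fun s => 1 / 2 * gigKernel (k + 1) (a / 2) s)
    (Ioi_mem_nhds (by linarith))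
    (Eventually.of_forall fun b => (measurable_gigKernel k b).aestronglyMeasurable)
    (integrableOn_gigKernel k ha)
    ((measurable_gigKernel (k + 1) a).const_mul _).aestronglyMeasurable ?_
    ((integrableOn_gigKernel (k + 1) (half_pos ha)).const_mul _) ?_).2
  · rw [integral_const_mul] at key
    exact key
  · filter_upwards [ae_restrict_mem measurableSet_Ioi] with s hs b hb
    rw [norm_mul, Real.norm_of_nonneg (gigKernel_pos (k + 1) b hs).le]
    norm_num
    have := gigKernel_anti (k + 1) (le_of_lt hb) hs
    linarith
  · filter_upwards [ae_restrict_mem measurableSet_Ioi] with s hs b _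
    have hs' : (0 : ℝ) < s := hs
    have h1 : HasDerivAt (fun b : ℝ => -s / 8 - b / (2 * s)) (-(1 / (2 * s))) b := by
      simpa using ((hasDerivAt_id b).div_const (2 * s)).const_sub (-s / 8)
    have h2 := (h1.exp).div_const (s ^ k)
    unfold gigKernel
    refine h2.congr_deriv ?_
    rw [pow_succ]
    field_simp

/-- The three-term recurrence of the Bessel functions, by integration by parts. -/
lemma gigIntegral_recurrence {k : ℕ} (hk : k ≠ 0) {a : ℝ} (ha : 0 < a) :
    k * gigIntegral (k + 1) a + gigIntegral k a / 8 = a / 2 * gigIntegral (k + 2) a := by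
  have hint0 := integrableOn_gigKernel k ha
  have hint1 := integrableOn_gigKernel (k + 1) ha
  have hint2 := integrableOn_gigKernel (k + 2) ha
  have hderiv : ∀ s ∈ Ioi (0 : ℝ), HasDerivAt (gigKernel k a)
      (a / 2 * gigKernel (k + 2) a s - k * gigKernel (k + 1) a s - 1 / 8 * gigKernel k a s) s := by
    intro s hs
    have hs' : (0 : ℝ) < s := hs
    have h1 : HasDerivAt (fun s : ℝ => -s / 8 - a / (2 * s)) (-1 / 8 + a / (2 * s ^ 2)) s := by
      have h := ((hasDerivAt_id s).neg.div_const 8).sub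
        (((hasDerivAt_id s).const_mul 2).inv (by simp; positivity) |>.const_mul a)
      refine (h.congr_deriv ?_).congr_of_eventuallyEq (Eventually.of_forall fun x => ?_)
      · simp; field_simp; ring
      · simp [div_eq_mul_inv]
    have h2 := h1.exp.div (hasDerivAt_pow k s) (by positivity)
    refine h2.congr_deriv ?_
    unfold gigKernel
    obtain ⟨m, rfl⟩ := Nat.exists_eq_succ_of_ne_zero hk
    simp only [Nat.succ_eq_add_one, Nat.add_sub_cancel, pow_succ]
    field_simp
    ring
  have hcont : ContinuousWithinAt (gigKernel k a) (Ici 0) 0 := by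
    have h0 : gigKernel k a 0 = 0 := by simp [gigKernel, hk]
    rw [ContinuousWithinAt, h0]
    have hb : Tendsto (fun s : ℝ => ((k + 1).factorial * (2 / a) ^ (k + 1)) * s) (𝓝[Ici 0] 0)
        (𝓝 0) := by
      have : Continuous fun s : ℝ => ((k + 1).factorial * (2 / a) ^ (k + 1) : ℝ) * s := by
        fun_prop
      simpa using (this.tendsto 0).mono_left nhdsWithin_le_nhds
    refine squeeze_zero' ?_ ?_ hb
    · filter_upwards [self_mem_nhdsWithin] with s hs
      rcases (show (0 : ℝ) ≤ s from hs).eq_or_lt with rfl | hs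
      · rw [h0]
      · exact (gigKernel_pos k a hs).le
    · filter_upwards [self_mem_nhdsWithin] with s hs
      rcases (show (0 : ℝ) ≤ s from hs).eq_or_lt with rfl | hs
      · rw [h0]; simp
      · have h1 : gigKernel k a s = gigKernel (k + 1) a s * s := by
          unfold gigKernel; rw [pow_succ]; field_simp
        rw [h1]
        gcongr
        refine (gigKernel_le ha hs).trans (mul_le_of_le_one_right (by positivity) ?_)
        exact Real.exp_le_one_iff.2 (by linarith)
  have hlim : Tendsto (gigKernel k a) atTop (𝓝 0) := by
    have hb : Tendsto (fun s : ℝ => (k.factorial * (2 / a) ^ k) * Real.exp (-(1 / 8) * s)) atTop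
        (𝓝 ((k.factorial * (2 / a) ^ k) * 0)) := by
      refine Tendsto.const_mul _ (Real.tendsto_exp_atBot.comp ?_)
      exact tendsto_id.const_mul_atTop_of_neg (by norm_num)
    rw [mul_zero] at hb
    refine squeeze_zero' ?_ ?_ hb
    · filter_upwards [eventually_gt_atTop 0] with s hs using (gigKernel_pos k a hs).le
    · filter_upwards [eventually_gt_atTop 0] with s hs using gigKernel_le ha hs
  have hc0 : IntegrableOn (fun s => 1 / 8 * gigKernel k a s) (Ioi 0) := hint0.const_mul _
  have hc1 : IntegrableOn (fun s => k * gigKernel (k + 1) a s) (Ioi 0) := hint1.const_mul _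
  have hc2 : IntegrableOn (fun s => a / 2 * gigKernel (k + 2) a s) (Ioi 0) := hint2.const_mul _
  have hc21 : IntegrableOn
      (fun s => a / 2 * gigKernel (k + 2) a s - k * gigKernel (k + 1) a s) (Ioi 0) := hc2.sub hc1
  have h := integral_Ioi_of_hasDerivAt_of_tendsto hcont hderiv (hc21.sub hc0) hlim
  rw [integral_sub hc21 hc0, integral_sub hc2 hc1, integral_const_mul, integral_const_mul,
    integral_const_mul] at h
  have h0 : gigKernel k a 0 = 0 := by simp [gigKernel, hk]
  rw [h0] at h
  unfold gigIntegral
  linarith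

/-- The substitution `s = 2 √a e^u`. -/
lemma gigIntegral_three_eq_besselK {a : ℝ} (ha : 0 < a) :
    2 * gigIntegral 3 a = 1 / a * besselK 2 (1 / 2 * √a) := by
  set c : ℝ := 2 * √a with hc
  have hsq : 0 < √a := Real.sqrt_pos.2 ha
  have hc0 : 0 < c := by positivity
  have hc2 : c ^ 2 = 4 * a := by rw [hc, mul_pow, Real.sq_sqrt ha.le]; norm_num
  set f : ℝ → ℝ := fun u => Real.exp (-(1 / 2 * √a) * Real.cosh u) * Real.exp (-2 * u) with hf
  have himg : (fun u : ℝ => c * Real.exp u) '' univ = Ioi 0 := by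
    ext y; constructor
    · rintro ⟨u, -, rfl⟩; exact mul_pos hc0 (Real.exp_pos u)
    · intro hy
      have hy' : (0 : ℝ) < y := hy
      refine ⟨Real.log (y / c), mem_univ _, ?_⟩
      simp only
      rw [Real.exp_log (by positivity)]; field_simp
  have hd : ∀ u ∈ (univ : Set ℝ), HasDerivWithinAt (fun u : ℝ => c * Real.exp u)
      (c * Real.exp u) univ u := fun u _ =>
    ((Real.hasDerivAt_exp u).const_mul c).hasDerivWithinAt
  have hinj : InjOn (fun u : ℝ => c * Real.exp u) univ := by
    intro u _ v _ h
    exact Real.exp_injective (mul_left_cancel₀ hc0.ne' h)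
  have hpt : ∀ u : ℝ, |c * Real.exp u| • gigKernel 3 a (c * Real.exp u) = (1 / (4 * a)) * f u := by
    intro u
    rw [abs_of_pos (by positivity), smul_eq_mul, ← hc2]
    unfold gigKernel
    have h1 : -(c * Real.exp u) / 8 - a / (2 * (c * Real.exp u))
        = -(1 / 2 * √a) * Real.cosh u := by
      rw [Real.cosh_eq, Real.exp_neg]
      have : a = √a ^ 2 := (Real.sq_sqrt ha.le).symm
      have he := Real.exp_pos u
      rw [hc]
      field_simp
      linear_combination (-8 : ℝ) * this
    have h2 : Real.exp (-2 * u) = 1 / (Real.exp u) ^ 2 := by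
      rw [← Real.exp_nat_mul, one_div, ← Real.exp_neg]; congr 1; push_cast; ring
    rw [h1, hf]
    simp only
    rw [h2]
    have he := Real.exp_pos u
    field_simp
  have hI : gigIntegral 3 a = 1 / (4 * a) * ∫ u, f u := by
    have := integral_image_eq_integral_abs_deriv_smul MeasurableSet.univ hd hinj (gigKernel 3 a)
    rw [himg] at this
    unfold gigIntegral
    rw [this, ← integral_const_mul, setIntegral_univ]
    exact integral_congr_ae (Eventually.of_forall hpt)
  have hfint : Integrable f := by
    have := (integrableOn_image_iff_integrableOn_abs_deriv_smul MeasurableSet.univ hd hinj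
      (gigKernel 3 a)).1 (by rw [himg]; exact integrableOn_gigKernel 3 ha)
    rw [integrableOn_univ] at this
    have h2 := (this.congr (Eventually.of_forall hpt)).const_mul (4 * a)
    refine h2.congr (Eventually.of_forall fun u => ?_)
    simp only
    field_simp
  have hsplit : ∫ u, f u = 2 * besselK 2 (1 / 2 * √a) := by
    rw [← intervalIntegral.integral_Iic_add_Ioi (b := 0) hfint.integrableOn hfint.integrableOn]
    have h1 : ∫ u in Iic (0 : ℝ), f u = ∫ u in Ioi (0 : ℝ), f (-u) := by
      have := integral_comp_neg_Ioi (0 : ℝ) f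
      rw [neg_zero] at this
      exact this.symm
    have hneg : IntegrableOn (fun u => f (-u)) (Ioi 0) := hfint.comp_neg.integrableOn
    rw [h1, ← integral_add hneg hfint.integrableOn]
    unfold besselK
    rw [← integral_const_mul]
    refine integral_congr_ae (Eventually.of_forall fun u => ?_)
    simp only [hf, Real.cosh_neg, Real.cosh_eq (2 * u)]
    ring_nf
  rw [hI, hsplit]
  field_simp
  ring

/-! ### The integrand in the variable `X = cosh φ` -/

/-- `ψ(X) = φ / sinh φ` in the variable `X = cosh φ`. -/
noncomputable def arcoshRatio (X : ℝ) : ℝ := Real.arcosh X / √(X ^ 2 - 1)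

/-- The derivative of `arcoshRatio` on `X > 1`. -/
noncomputable def arcoshRatio₁ (X : ℝ) : ℝ := (1 - X * arcoshRatio X) / (X ^ 2 - 1)

/-- The second derivative of `arcoshRatio` on `X > 1`. -/
noncomputable def arcoshRatio₂ (X : ℝ) : ℝ :=
  (-arcoshRatio X - 3 * X * arcoshRatio₁ X) / (X ^ 2 - 1)

lemma sq_sub_one_pos {X : ℝ} (hX : 1 < X) : 0 < X ^ 2 - 1 := by nlinarith

lemma hasDerivAt_arcoshRatio {X : ℝ} (hX : 1 < X) :
    HasDerivAt arcoshRatio (arcoshRatio₁ X) X := by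
  have h0 := sq_sub_one_pos hX
  have hr : 0 < √(X ^ 2 - 1) := Real.sqrt_pos.2 h0
  have h1 : HasDerivAt (fun X : ℝ => √(X ^ 2 - 1)) (X / √(X ^ 2 - 1)) X := by
    refine (((hasDerivAt_pow 2 X).sub_const 1).sqrt h0.ne').congr_deriv ?_
    field_simp; ring
  refine ((Real.hasDerivAt_arcosh hX).div h1 hr.ne').congr_deriv ?_
  rw [arcoshRatio₁, arcoshRatio]
  have hs : √(X ^ 2 - 1) ^ 2 = X ^ 2 - 1 := Real.sq_sqrt h0.le
  rw [hs]
  field_simp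

lemma hasDerivAt_arcoshRatio₁ {X : ℝ} (hX : 1 < X) :
    HasDerivAt arcoshRatio₁ (arcoshRatio₂ X) X := by
  have h0 := sq_sub_one_pos hX
  have h1 := (((hasDerivAt_id X).mul (hasDerivAt_arcoshRatio hX)).const_sub 1).div
    ((hasDerivAt_pow 2 X).sub_const 1) h0.ne'
  refine h1.congr_deriv ?_
  have h2 : 1 - X * arcoshRatio X = arcoshRatio₁ X * (X ^ 2 - 1) := by
    rw [arcoshRatio₁]; field_simp
  simp only [id, Pi.mul_apply, arcoshRatio₂]
  rw [h2]
  field_simp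
  ring

lemma continuousOn_arcoshRatio₂ : ContinuousOn arcoshRatio₂ (Ioi 1) := by
  have h1 : ContinuousOn arcoshRatio (Ioi 1) := fun X hX =>
    (hasDerivAt_arcoshRatio hX).continuousAt.continuousWithinAt
  have h2 : ContinuousOn arcoshRatio₁ (Ioi 1) := fun X hX =>
    (hasDerivAt_arcoshRatio₁ hX).continuousAt.continuousWithinAt
  unfold arcoshRatio₂
  exact (h1.neg.sub ((continuousOn_const.mul continuousOn_id).mul h2)).div (by fun_prop)
    fun X hX => (sq_sub_one_pos hX).ne'

lemma arcosh_sq_eq {X : ℝ} (hX : 1 < X) :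
    Real.arcosh X ^ 2 = (X ^ 2 - 1) * arcoshRatio X ^ 2 := by
  have h0 := sq_sub_one_pos hX
  rw [arcoshRatio, div_pow, Real.sq_sqrt h0.le]; field_simp

/-- The Bessel factor `I_k(φ² + t²)` in the variable `X = cosh φ`. -/
noncomputable def besselFactor (k : ℕ) (X t : ℝ) : ℝ :=
  gigIntegral k (Real.arcosh X ^ 2 + t ^ 2)

lemma hasDerivAt_besselFactor (k : ℕ) {X t : ℝ} (hX : 1 < X) (ht : 0 < t) :
    HasDerivAt (fun X => besselFactor k X t) (-(besselFactor (k + 1) X t * arcoshRatio X)) X := by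
  have h1 := ((Real.hasDerivAt_arcosh hX).pow 2).add_const (t ^ 2)
  have h2 := (hasDerivAt_gigIntegral k (a := Real.arcosh X ^ 2 + t ^ 2) (by positivity)).comp X h1
  refine h2.congr_deriv ?_
  rw [besselFactor, arcoshRatio]
  push_cast
  ring

lemma hasDerivAt_besselFactor_time (k : ℕ) (X : ℝ) {t : ℝ} (ht : 0 < t) :
    HasDerivAt (besselFactor k X) (-(t * besselFactor (k + 1) X t)) t := by
  have h1 := (hasDerivAt_pow 2 t).const_add (Real.arcosh X ^ 2)
  have h2 := (hasDerivAt_gigIntegral k (a := Real.arcosh X ^ 2 + t ^ 2) (by positivity)).comp t h1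
  refine h2.congr_deriv ?_
  rw [besselFactor]
  push_cast
  ring

/-- The function `H(X, t) = t I₃(φ² + t²) φ / sinh φ`, `X = cosh φ`, whose Abel transform in `X`
is, up to a constant, `p_{J₂}(η, t) / sinh η` at `cosh η`. -/
noncomputable def abelSource (X t : ℝ) : ℝ := t * (besselFactor 3 X t * arcoshRatio X)

/-- `∂H/∂X`. -/
noncomputable def abelSource₁ (X t : ℝ) : ℝ :=
  t * (-(besselFactor 4 X t * arcoshRatio X ^ 2) + besselFactor 3 X t * arcoshRatio₁ X)

/-- `∂²H/∂X²`. -/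
noncomputable def abelSource₂ (X t : ℝ) : ℝ :=
  t * (besselFactor 5 X t * arcoshRatio X ^ 3
    - 3 * besselFactor 4 X t * (arcoshRatio X * arcoshRatio₁ X)
    + besselFactor 3 X t * arcoshRatio₂ X)

/-- `∂H/∂t`. -/
noncomputable def abelSourceTime₁ (X t : ℝ) : ℝ :=
  (besselFactor 3 X t - t ^ 2 * besselFactor 4 X t) * arcoshRatio X

/-- `∂²H/∂t²`. -/
noncomputable def abelSourceTime₂ (X t : ℝ) : ℝ :=
  (t ^ 3 * besselFactor 5 X t - 3 * t * besselFactor 4 X t) * arcoshRatio X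

lemma hasDerivAt_abelSource {X t : ℝ} (hX : 1 < X) (ht : 0 < t) :
    HasDerivAt (fun X => abelSource X t) (abelSource₁ X t) X := by
  refine (((hasDerivAt_besselFactor 3 hX ht).mul (hasDerivAt_arcoshRatio hX)).const_mul
    t).congr_deriv ?_
  rw [abelSource₁]; ring

lemma hasDerivAt_abelSource₁ {X t : ℝ} (hX : 1 < X) (ht : 0 < t) :
    HasDerivAt (fun X => abelSource₁ X t) (abelSource₂ X t) X := by
  refine ((((hasDerivAt_besselFactor 4 hX ht).mul ((hasDerivAt_arcoshRatio hX).pow 2)).neg.add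
    ((hasDerivAt_besselFactor 3 hX ht).mul (hasDerivAt_arcoshRatio₁ hX))).const_mul
    t).congr_deriv ?_
  rw [abelSource₂]; simp only [Pi.pow_apply]; push_cast; ring

lemma hasDerivAt_abelSource_time (X : ℝ) {t : ℝ} (ht : 0 < t) :
    HasDerivAt (abelSource X) (abelSourceTime₁ X t) t := by
  refine ((hasDerivAt_id t).mul ((hasDerivAt_besselFactor_time 3 X ht).mul_const
    (arcoshRatio X))).congr_deriv ?_
  rw [abelSourceTime₁]; simp only [id]; ring

lemma hasDerivAt_abelSourceTime₁ (X : ℝ) {t : ℝ} (ht : 0 < t) :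
    HasDerivAt (abelSourceTime₁ X) (abelSourceTime₂ X t) t := by
  refine (((hasDerivAt_besselFactor_time 3 X ht).sub ((hasDerivAt_pow 2 t).mul
    (hasDerivAt_besselFactor_time 4 X ht))).mul_const (arcoshRatio X)).congr_deriv ?_
  rw [abelSourceTime₂]; push_cast; ring

/-- The equation solved by `H`; it reduces to the Bessel recurrence. -/
lemma abelSource_pde {X t : ℝ} (hX : 1 < X) (ht : 0 < t) :
    -abelSourceTime₂ X t
      = (X ^ 2 - 1) * abelSource₂ X t + 3 * X * abelSource₁ X t + 3 / 4 * abelSource X t := by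
  have h0 := sq_sub_one_pos hX
  have hA := arcosh_sq_eq hX
  have hrec := gigIntegral_recurrence (k := 3) (by norm_num)
    (a := Real.arcosh X ^ 2 + t ^ 2) (by positivity)
  have h1 : (X ^ 2 - 1) * arcoshRatio₁ X = 1 - X * arcoshRatio X := by
    rw [arcoshRatio₁]; field_simp
  have h2 : (X ^ 2 - 1) * arcoshRatio₂ X = -arcoshRatio X - 3 * X * arcoshRatio₁ X := by
    rw [arcoshRatio₂]; field_simp
  simp only [← besselFactor.eq_def] at hrec
  norm_num at hrec
  rw [hA] at hrec
  unfold abelSourceTime₂ abelSource₂ abelSource₁ abelSource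
  linear_combination (2 * t * arcoshRatio X) * hrec
    + (3 * t * besselFactor 4 X t * arcoshRatio X) * h1 - (t * besselFactor 3 X t) * h2

/-- Uniform bounds on `a ≥ T`, where `u` stands for `φ ≤ √a`: the recurrence turns `a I_{k+2}` into
integrals of lower order, which absorbs the powers of `u`. -/
lemma exists_bound_gigIntegral {T : ℝ} (hT : 0 < T) : ∃ M, 0 ≤ M ∧ ∀ u : ℝ, 0 ≤ u → ∀ a,
    T ≤ a → u ^ 2 ≤ a → gigIntegral 3 a ≤ M ∧ u * gigIntegral 3 a ≤ M ∧ gigIntegral 4 a ≤ M ∧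
      u * gigIntegral 4 a ≤ M ∧ u ^ 2 * gigIntegral 4 a ≤ M ∧ gigIntegral 5 a ≤ M ∧
      u * gigIntegral 5 a ≤ M ∧ u ^ 3 * gigIntegral 5 a ≤ M := by
  have n1 := gigIntegral_nonneg 1 T
  have n2 := gigIntegral_nonneg 2 T
  have n3 := gigIntegral_nonneg 3 T
  have n4 := gigIntegral_nonneg 4 T
  have n5 := gigIntegral_nonneg 5 T
  refine ⟨100 * (gigIntegral 1 T + gigIntegral 2 T + gigIntegral 3 T + gigIntegral 4 T
    + gigIntegral 5 T), by positivity, ?_⟩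
  intro u hu a ha hua
  have ha0 : 0 < a := hT.trans_le ha
  have m1 := gigIntegral_anti 1 hT ha
  have m2 := gigIntegral_anti 2 hT ha
  have m3 := gigIntegral_anti 3 hT ha
  have m4 := gigIntegral_anti 4 hT ha
  have m5 := gigIntegral_anti 5 hT ha
  have p1 := gigIntegral_nonneg 1 a
  have p2 := gigIntegral_nonneg 2 a
  have p3 := gigIntegral_nonneg 3 a
  have p4 := gigIntegral_nonneg 4 a
  have p5 := gigIntegral_nonneg 5 a
  have r1 := gigIntegral_recurrence (k := 1) (by norm_num) ha0
  have r2 := gigIntegral_recurrence (k := 2) (by norm_num) ha0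
  have r3 := gigIntegral_recurrence (k := 3) (by norm_num) ha0
  norm_num at r1 r2 r3
  have hu1 : u ≤ 1 + a := by nlinarith [sq_nonneg (u - 1)]
  have hu3 : u ^ 3 ≤ 1 + a ^ 2 := by
    have : u ^ 2 * u ^ 2 ≤ a * a := by gcongr
    nlinarith [sq_nonneg (u ^ 2 - u), sq_nonneg u, sq_nonneg (u - 1), mul_nonneg hu hu]
  have b3 : u * gigIntegral 3 a ≤ (1 + a) * gigIntegral 3 a := by gcongr
  have b4 : u * gigIntegral 4 a ≤ (1 + a) * gigIntegral 4 a := by gcongr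
  have b5 : u * gigIntegral 5 a ≤ (1 + a) * gigIntegral 5 a := by gcongr
  have c4 : u ^ 2 * gigIntegral 4 a ≤ a * gigIntegral 4 a := by gcongr
  have c5 : u ^ 3 * gigIntegral 5 a ≤ (1 + a ^ 2) * gigIntegral 5 a := by gcongr
  have r3' : a ^ 2 * gigIntegral 5 a = 6 * (a * gigIntegral 4 a) + (a * gigIntegral 3 a) / 4 := by
    linear_combination (-2 * a) * r3
  refine ⟨?_, ?_, ?_, ?_, ?_, ?_, ?_, ?_⟩ <;> linarith

set_option maxHeartbeats 1000000 in
/-- Decay of `H` and of its derivatives, locally uniformly in `t`. -/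
lemma exists_bound_abelSource {x₀ T₀ T₁ : ℝ} (hx₀ : 1 < x₀) (hT₀ : 0 < T₀) (hT₁ : 0 < T₁) :
    ∃ C, 0 ≤ C ∧ ∀ X, x₀ ≤ X → ∀ t, T₀ ≤ t → t ≤ T₁ →
      |abelSource X t| ≤ C / X ∧ |abelSource₁ X t| ≤ C / X ^ 2 ∧ |abelSource₂ X t| ≤ C / X ^ 3 ∧
      |abelSourceTime₁ X t| ≤ C / X ∧ |abelSourceTime₂ X t| ≤ C / X := by
  obtain ⟨M, hM0, hM⟩ := exists_bound_gigIntegral (T := T₀ ^ 2) (by positivity)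
  have hq := sq_sub_one_pos hx₀
  have hx0' : 0 < x₀ := by linarith
  set K : ℝ := x₀ / √(x₀ ^ 2 - 1) with hK
  have hr0 : 0 < √(x₀ ^ 2 - 1) := Real.sqrt_pos.2 hq
  have hK0 : 0 < K := by positivity
  set L : ℝ := (1 + T₁) ^ 3 * (20 * (1 + K) ^ 2 * M) with hL
  have hL0 : 0 ≤ L := by positivity
  refine ⟨L * (1 + K) ^ 3, by positivity, ?_⟩
  intro X hX t ht0 ht1
  have hX1 : 1 < X := hx₀.trans_le hX
  have hX0 : 0 < X := by linarith
  have ht : 0 < t := hT₀.trans_le ht0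
  have hq' := sq_sub_one_pos hX1
  set r : ℝ := √(X ^ 2 - 1) with hr
  have hrpos : 0 < r := Real.sqrt_pos.2 hq'
  have hr2 : r ^ 2 = X ^ 2 - 1 := Real.sq_sqrt hq'.le
  set u : ℝ := Real.arcosh X with hu
  have hu0 : 0 ≤ u := Real.arcosh_nonneg hX1.le
  set y : ℝ := X / r with hy
  have hy0 : 0 ≤ y := by positivity
  have hyK : y ≤ K := by
    rw [hy, hK, div_le_div_iff₀ hrpos hr0, hr, ← Real.sqrt_sq hX0.le, ← Real.sqrt_sq hx0'.le,
      ← Real.sqrt_mul (sq_nonneg _), ← Real.sqrt_mul (sq_nonneg _)]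
    refine Real.sqrt_le_sqrt ?_
    simp only [Real.sqrt_sq hX0.le, Real.sqrt_sq hx0'.le]
    nlinarith
  have hXr : X = y * r := by rw [hy]; field_simp
  obtain ⟨b3, b3u, b4, b4u, b4u2, b5, b5u, b5u3⟩ :=
    hM u hu0 (u ^ 2 + t ^ 2) (by nlinarith) (by nlinarith)
  have e3 : gigIntegral 3 (u ^ 2 + t ^ 2) = besselFactor 3 X t := rfl
  have e4 : gigIntegral 4 (u ^ 2 + t ^ 2) = besselFactor 4 X t := rfl
  have e5 : gigIntegral 5 (u ^ 2 + t ^ 2) = besselFactor 5 X t := rfl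
  have p3 : 0 ≤ besselFactor 3 X t := gigIntegral_nonneg _ _
  have p4 : 0 ≤ besselFactor 4 X t := gigIntegral_nonneg _ _
  have p5 : 0 ≤ besselFactor 5 X t := gigIntegral_nonneg _ _
  rw [e3] at b3 b3u
  rw [e4] at b4 b4u b4u2
  rw [e5] at b5 b5u b5u3
  have hψ : arcoshRatio X = u / r := rfl
  have hψ1 : arcoshRatio₁ X = (1 - y * u) / r ^ 2 := by
    rw [arcoshRatio₁, hψ, hr2, hy]; field_simp
  have hψ2 : arcoshRatio₂ X = (-u - 3 * y * (1 - y * u)) / r ^ 3 := by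
    rw [arcoshRatio₂, hψ1, hψ, ← hr2, hXr]; field_simp
  have hi3u := mul_nonneg hu0 p3
  have hi4u := mul_nonneg hu0 p4
  have hi4u2 := mul_nonneg (sq_nonneg u) p4
  have hi5u := mul_nonneg hu0 p5
  have hi5u3 := mul_nonneg (pow_nonneg hu0 3) p5
  have y3 : y * besselFactor 3 X t ≤ K * M := by gcongr
  have y3u : y * (u * besselFactor 3 X t) ≤ K * M := by gcongr
  have yy3u : y ^ 2 * (u * besselFactor 3 X t) ≤ K ^ 2 * M := by gcongr
  have y4u2 : y * (u ^ 2 * besselFactor 4 X t) ≤ K * M := by gcongr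
  have y3' := mul_nonneg hy0 p3
  have y3u' := mul_nonneg hy0 hi3u
  have yy3u' := mul_nonneg (sq_nonneg y) hi3u
  have y4u2' := mul_nonneg hy0 hi4u2
  have hKM := mul_nonneg hK0.le hM0
  have hKKM := mul_nonneg (sq_nonneg K) hM0
  set D : ℝ := 20 * (1 + K) ^ 2 * M with hD
  have hDe : D = 20 * M + 40 * (K * M) + 20 * (K ^ 2 * M) := by rw [hD]; ring
  have hD0 : 0 ≤ D := by positivity
  -- a bound on a numerator over `r ^ j` gives decay `X ^ (-j)`, since `X ≤ K r`
  have decay : ∀ (Z : ℝ) (j : ℕ), j ≤ 3 → |Z| ≤ L → |Z / r ^ j| ≤ L * (1 + K) ^ 3 / X ^ j := by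
    intro Z j hj hZ
    rw [abs_div, abs_of_pos (pow_pos hrpos j), div_le_div_iff₀ (by positivity) (by positivity)]
    have h1 : X ^ j ≤ (1 + K) ^ 3 * r ^ j := by
      rw [hXr, mul_pow]
      gcongr
      calc y ^ j ≤ (1 + K) ^ j := by gcongr; linarith
        _ ≤ (1 + K) ^ 3 := by gcongr; linarith
    calc |Z| * X ^ j ≤ L * ((1 + K) ^ 3 * r ^ j) := by gcongr
      _ = L * (1 + K) ^ 3 * r ^ j := by ring
  have timeFactor : ∀ Z, |Z| ≤ D → |t * Z| ≤ L := by
    intro Z hZ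
    rw [abs_mul, abs_of_pos ht, hL]
    have : t ≤ (1 + T₁) ^ 3 := (by linarith only [ht1] : t ≤ 1 + T₁).trans
      (le_self_pow₀ (by linarith only [hT₁]) (by norm_num))
    gcongr
  refine ⟨?_, ?_, ?_, ?_, ?_⟩
  · have h := decay (t * (u * besselFactor 3 X t)) 1 (by norm_num)
      (timeFactor _ (abs_le.2 ⟨by linarith only [hDe, hM0, hKM, hKKM, hi3u],
        by linarith only [hDe, hM0, hKM, hKKM, b3u]⟩))
    rw [pow_one, pow_one] at h
    convert h using 2
    rw [abelSource, hψ]; ring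
  · have h := decay (t * (-(u ^ 2 * besselFactor 4 X t) + besselFactor 3 X t
      - y * (u * besselFactor 3 X t))) 2 (by norm_num)
      (timeFactor _ (abs_le.2 ⟨by linarith only [hDe, hM0, hKM, hKKM, p3, b4u2, y3u],
        by linarith only [hDe, hM0, hKM, hKKM, b3, hi4u2, y3u']⟩))
    convert h using 2
    rw [abelSource₁, hψ, hψ1]; field_simp; ring
  · have h := decay (t * (u ^ 3 * besselFactor 5 X t - 3 * (u * besselFactor 4 X t)
      + 3 * (y * (u ^ 2 * besselFactor 4 X t)) - u * besselFactor 3 X t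
      - 3 * (y * besselFactor 3 X t) + 3 * (y ^ 2 * (u * besselFactor 3 X t)))) 3 (by norm_num)
      (timeFactor _ (abs_le.2
        ⟨by linarith only [hDe, hM0, hKM, hKKM, hi5u3, b4u, y4u2', b3u, y3, yy3u'],
          by linarith only [hDe, hM0, hKM, hKKM, b5u3, hi4u, y4u2, hi3u, y3', yy3u]⟩))
    convert h using 2
    rw [abelSource₂, hψ, hψ1, hψ2]; field_simp; ring
  · have h2 : t ^ 2 * (u * besselFactor 4 X t) ≤ T₁ ^ 2 * M := by gcongr
    have h2' := mul_nonneg (sq_nonneg t) hi4u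
    have hLT : M + T₁ ^ 2 * M ≤ L := by
      have h3 : M + T₁ ^ 2 * M ≤ (1 + T₁) ^ 3 * M := by
        have : 1 + T₁ ^ 2 ≤ (1 + T₁) ^ 3 := by nlinarith only [pow_pos hT₁ 3, pow_pos hT₁ 2, hT₁]
        nlinarith only [this, hM0]
      have h4 : (1 + T₁) ^ 3 * M ≤ L := by
        rw [hL]
        have : M ≤ D := by linarith only [hDe, hKM, hKKM, hM0]
        gcongr
      exact h3.trans h4
    have hTM := mul_nonneg (sq_nonneg T₁) hM0
    have h := decay (u * besselFactor 3 X t - t ^ 2 * (u * besselFactor 4 X t)) 1 (by norm_num)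
      (abs_le.2 ⟨by linarith only [hLT, hM0, hi3u, h2],
        by linarith only [hLT, hTM, b3u, h2']⟩)
    rw [pow_one, pow_one] at h
    convert h using 2
    rw [abelSourceTime₁, hψ]; ring
  · have h2 : t ^ 3 * (u * besselFactor 5 X t) ≤ T₁ ^ 3 * M := by gcongr
    have h2' := mul_nonneg (pow_nonneg ht.le 3) hi5u
    have h5 : t * (u * besselFactor 4 X t) ≤ T₁ * M := by gcongr
    have h5' := mul_nonneg ht.le hi4u
    have hLT : T₁ ^ 3 * M + 3 * (T₁ * M) ≤ L := by
      have h3 : T₁ ^ 3 * M + 3 * (T₁ * M) ≤ (1 + T₁) ^ 3 * M := by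
        have : T₁ ^ 3 + 3 * T₁ ≤ (1 + T₁) ^ 3 := by
          nlinarith only [pow_pos hT₁ 3, pow_pos hT₁ 2, hT₁]
        nlinarith only [this, hM0]
      have h4 : (1 + T₁) ^ 3 * M ≤ L := by
        rw [hL]
        have : M ≤ D := by linarith only [hDe, hKM, hKKM, hM0]
        gcongr
      exact h3.trans h4
    have hTM := mul_nonneg (pow_nonneg hT₁.le 3) hM0
    have hTM' := mul_nonneg hT₁.le hM0
    have h := decay (t ^ 3 * (u * besselFactor 5 X t) - 3 * (t * (u * besselFactor 4 X t))) 1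
      (by norm_num) (abs_le.2 ⟨by linarith only [hLT, hTM, hTM', h5, h2'],
        by linarith only [hLT, hTM, hTM', h2, h5']⟩)
    rw [pow_one, pow_one] at h
    convert h using 2
    rw [abelSourceTime₂, hψ]; ring

/-! ### The Abel transform and the governing equation in the variable `x = cosh η` -/

/-- Differentiation of `∫₀^∞ G(y, w) dw` when the derivative in `y` is `O(1 / (1 + w²))`. -/
lemma hasDerivAt_integral_Ioi {G G' : ℝ → ℝ → ℝ} {y₀ C : ℝ} {U : Set ℝ} (hU : U ∈ 𝓝 y₀)
    (hc : ∀ y ∈ U, ContinuousOn (G y) (Ioi 0)) (hc' : ∀ y ∈ U, ContinuousOn (G' y) (Ioi 0))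
    (hb : ∀ y ∈ U, ∀ w ∈ Ioi (0 : ℝ), |G y w| ≤ C * (1 + w ^ 2)⁻¹)
    (hb' : ∀ y ∈ U, ∀ w ∈ Ioi (0 : ℝ), |G' y w| ≤ C * (1 + w ^ 2)⁻¹)
    (hd : ∀ y ∈ U, ∀ w ∈ Ioi (0 : ℝ), HasDerivAt (fun y => G y w) (G' y w) y) :
    HasDerivAt (fun y => ∫ w in Ioi (0 : ℝ), G y w) (∫ w in Ioi (0 : ℝ), G' y₀ w) y₀ := by
  have hC : IntegrableOn (fun w : ℝ => C * (1 + w ^ 2)⁻¹) (Ioi 0) :=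
    (integrable_inv_one_add_sq.const_mul C).integrableOn
  refine (hasDerivAt_integral_of_dominated_loc_of_deriv_le (bound := fun w => C * (1 + w ^ 2)⁻¹)
    hU ?_ ?_ ?_ ?_ hC ?_).2
  · filter_upwards [hU] with y hy using (hc y hy).aestronglyMeasurable measurableSet_Ioi
  · refine hC.mono' ((hc _ (mem_of_mem_nhds hU)).aestronglyMeasurable measurableSet_Ioi) ?_
    filter_upwards [ae_restrict_mem measurableSet_Ioi] with w hw
      using hb _ (mem_of_mem_nhds hU) w hw
  · exact (hc' _ (mem_of_mem_nhds hU)).aestronglyMeasurable measurableSet_Ioi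
  · filter_upwards [ae_restrict_mem measurableSet_Ioi] with w hw y hy using hb' y hy w hw
  · filter_upwards [ae_restrict_mem measurableSet_Ioi] with w hw y hy using hd y hy w hw

lemma continuousAt_integral_Ioi {G : ℝ → ℝ → ℝ} {y₀ C : ℝ} {U : Set ℝ} (hU : U ∈ 𝓝 y₀)
    (hc : ∀ y ∈ U, ContinuousOn (G y) (Ioi 0))
    (hb : ∀ y ∈ U, ∀ w ∈ Ioi (0 : ℝ), |G y w| ≤ C * (1 + w ^ 2)⁻¹)
    (hd : ∀ w ∈ Ioi (0 : ℝ), ContinuousAt (fun y => G y w) y₀) :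
    ContinuousAt (fun y => ∫ w in Ioi (0 : ℝ), G y w) y₀ := by
  have hC : IntegrableOn (fun w : ℝ => C * (1 + w ^ 2)⁻¹) (Ioi 0) :=
    (integrable_inv_one_add_sq.const_mul C).integrableOn
  refine continuousAt_of_dominated (bound := fun w => C * (1 + w ^ 2)⁻¹) ?_ ?_ hC ?_
  · filter_upwards [hU] with y hy using (hc y hy).aestronglyMeasurable measurableSet_Ioi
  · filter_upwards [hU] with y hy
    filter_upwards [ae_restrict_mem measurableSet_Ioi] with w hw using hb y hy w hw
  · filter_upwards [ae_restrict_mem measurableSet_Ioi] with w hw using hd w hw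

lemma integrableOn_of_le_inv_one_add_sq {g : ℝ → ℝ} {C : ℝ} (hc : ContinuousOn g (Ioi 0))
    (hb : ∀ w ∈ Ioi (0 : ℝ), |g w| ≤ C * (1 + w ^ 2)⁻¹) : IntegrableOn g (Ioi 0) := by
  have hC : IntegrableOn (fun w : ℝ => C * (1 + w ^ 2)⁻¹) (Ioi 0) :=
    (integrable_inv_one_add_sq.const_mul C).integrableOn
  refine hC.mono' (hc.aestronglyMeasurable measurableSet_Ioi) ?_
  filter_upwards [ae_restrict_mem measurableSet_Ioi] with w hw using hb w hw

lemma contDiffOn_two_of_hasDerivAt {f f₁ f₂ : ℝ → ℝ} {s : Set ℝ} (hs : IsOpen s)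
    (h₁ : ∀ x ∈ s, HasDerivAt f (f₁ x) x) (h₂ : ∀ x ∈ s, HasDerivAt f₁ (f₂ x) x)
    (h₃ : ContinuousOn f₂ s) : ContDiffOn ℝ 2 f s := by
  have e : (2 : WithTop ℕ∞) = 1 + 1 := by norm_num
  have e' : (1 : WithTop ℕ∞) = 0 + 1 := by norm_num
  rw [e, contDiffOn_succ_iff_deriv_of_isOpen hs]
  refine ⟨fun x hx => (h₁ x hx).differentiableAt.differentiableWithinAt, by simp, ?_⟩
  have hf₁ : ContDiffOn ℝ 1 f₁ s := by
    rw [e', contDiffOn_succ_iff_deriv_of_isOpen hs]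
    refine ⟨fun x hx => (h₂ x hx).differentiableAt.differentiableWithinAt, by simp, ?_⟩
    rw [contDiffOn_zero]
    exact h₃.congr fun x hx => (h₂ x hx).deriv
  exact hf₁.congr fun x hx => (h₁ x hx).deriv

lemma iteratedDeriv_two_eq_of_hasDerivAt {f f₁ : ℝ → ℝ} {d : ℝ} {s : Set ℝ} (hs : IsOpen s)
    (h₁ : ∀ x ∈ s, HasDerivAt f (f₁ x) x) {x : ℝ} (hx : x ∈ s) (h₂ : HasDerivAt f₁ d x) :
    iteratedDeriv 2 f x = d := by
  rw [iteratedDeriv_succ, iteratedDeriv_one]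
  refine (h₂.congr_of_eventuallyEq ?_).deriv
  filter_upwards [hs.mem_nhds hx] with y hy using (h₁ y hy).deriv

/-- The Abel transform `Q(x, t) = ∫₀^∞ H(x + w², t) dw`. -/
noncomputable def abelTransform (H : ℝ → ℝ → ℝ) (x t : ℝ) : ℝ :=
  ∫ w in Ioi (0 : ℝ), H (x + w ^ 2) t

lemma one_lt_add_sq {x : ℝ} (hx : 1 < x) (w : ℝ) : 1 < x + w ^ 2 := by nlinarith [sq_nonneg w]

lemma continuousOn_comp_add_sq {F : ℝ → ℝ} (hF : ContinuousOn F (Ioi 1)) {x : ℝ} (hx : 1 < x) :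
    ContinuousOn (fun w : ℝ => F (x + w ^ 2)) (Ioi 0) :=
  hF.comp (by fun_prop) fun w _ => one_lt_add_sq hx w

/-- A function of `X = x + w²` which decays like `X^{-j}`, `j ≥ 1`, is `O(1 / (1 + w²))`. -/
lemma decay_le {C x w Z : ℝ} {j : ℕ} (hj : j ≠ 0) (hC : 0 ≤ C) (hx : 1 < x)
    (hZ : |Z| ≤ C / (x + w ^ 2) ^ j) : |Z| ≤ C * (1 + w ^ 2)⁻¹ := by
  refine hZ.trans ?_
  rw [div_eq_mul_inv]
  have h1 := one_lt_add_sq hx w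
  have h2 : 1 + w ^ 2 ≤ (x + w ^ 2) ^ j :=
    (by linarith : 1 + w ^ 2 ≤ x + w ^ 2).trans (le_self_pow₀ h1.le hj)
  gcongr

lemma continuousOn_abelSource {t : ℝ} (ht : 0 < t) :
    ContinuousOn (fun X => abelSource X t) (Ioi 1) := fun _ hX =>
  (hasDerivAt_abelSource hX ht).continuousAt.continuousWithinAt

lemma continuousOn_abelSource₁ {t : ℝ} (ht : 0 < t) :
    ContinuousOn (fun X => abelSource₁ X t) (Ioi 1) := fun _ hX =>
  (hasDerivAt_abelSource₁ hX ht).continuousAt.continuousWithinAt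

lemma continuousOn_besselFactor (k : ℕ) {t : ℝ} (ht : 0 < t) :
    ContinuousOn (fun X => besselFactor k X t) (Ioi 1) := fun _ hX =>
  (hasDerivAt_besselFactor k hX ht).continuousAt.continuousWithinAt

lemma continuousOn_arcoshRatio : ContinuousOn arcoshRatio (Ioi 1) := fun _ hX =>
  (hasDerivAt_arcoshRatio hX).continuousAt.continuousWithinAt

lemma continuousOn_arcoshRatio₁ : ContinuousOn arcoshRatio₁ (Ioi 1) := fun _ hX =>
  (hasDerivAt_arcoshRatio₁ hX).continuousAt.continuousWithinAt

lemma continuousOn_abelSource₂ {t : ℝ} (ht : 0 < t) :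
    ContinuousOn (fun X => abelSource₂ X t) (Ioi 1) := by
  have h3 := continuousOn_besselFactor 3 ht
  have h4 := continuousOn_besselFactor 4 ht
  have h5 := continuousOn_besselFactor 5 ht
  have p0 := continuousOn_arcoshRatio
  have p1 := continuousOn_arcoshRatio₁
  have p2 := continuousOn_arcoshRatio₂
  unfold abelSource₂
  exact continuousOn_const.mul (((h5.mul (p0.pow 3)).sub
    ((continuousOn_const.mul h4).mul (p0.mul p1))).add (h3.mul p2))

lemma continuousOn_abelSourceTime₁ {t : ℝ} (ht : 0 < t) :
    ContinuousOn (fun X => abelSourceTime₁ X t) (Ioi 1) :=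
  ((continuousOn_besselFactor 3 ht).sub
    (continuousOn_const.mul (continuousOn_besselFactor 4 ht))).mul continuousOn_arcoshRatio

lemma continuousOn_abelSourceTime₂ {t : ℝ} (ht : 0 < t) :
    ContinuousOn (fun X => abelSourceTime₂ X t) (Ioi 1) :=
  ((continuousOn_const.mul (continuousOn_besselFactor 5 ht)).sub
    (continuousOn_const.mul (continuousOn_besselFactor 4 ht))).mul continuousOn_arcoshRatio

lemma hasDerivAt_comp_add_sq {F : ℝ → ℝ} {F' w x : ℝ} (h : HasDerivAt F F' (x + w ^ 2)) :
    HasDerivAt (fun x => F (x + w ^ 2)) F' x :=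
  h.comp_add_const x (w ^ 2)

lemma hasDerivAt_abelTransform {x t : ℝ} (hx : 1 < x) (ht : 0 < t) :
    HasDerivAt (fun x => abelTransform abelSource x t) (abelTransform abelSource₁ x t) x := by
  obtain ⟨x₀, h1, h2⟩ := exists_between hx
  obtain ⟨C, hC0, hC⟩ := exists_bound_abelSource h1 ht ht
  refine hasDerivAt_integral_Ioi (U := Ioi x₀) (C := C) (Ioi_mem_nhds h2)
    (fun y hy => continuousOn_comp_add_sq (continuousOn_abelSource ht) (h1.trans hy))
    (fun y hy => continuousOn_comp_add_sq (continuousOn_abelSource₁ ht) (h1.trans hy))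
    (fun y hy w _ => decay_le one_ne_zero hC0 (h1.trans hy) ?_)
    (fun y hy w _ => decay_le two_ne_zero hC0 (h1.trans hy) ?_)
    (fun y hy w _ => hasDerivAt_comp_add_sq
      (hasDerivAt_abelSource (one_lt_add_sq (h1.trans hy) w) ht))
  · have := hC (y + w ^ 2) (by nlinarith [sq_nonneg w, mem_Ioi.1 hy]) t le_rfl le_rfl
    simpa using this.1
  · exact (hC (y + w ^ 2) (by nlinarith [sq_nonneg w, mem_Ioi.1 hy]) t le_rfl le_rfl).2.1

lemma hasDerivAt_abelTransform₁ {x t : ℝ} (hx : 1 < x) (ht : 0 < t) :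
    HasDerivAt (fun x => abelTransform abelSource₁ x t) (abelTransform abelSource₂ x t) x := by
  obtain ⟨x₀, h1, h2⟩ := exists_between hx
  obtain ⟨C, hC0, hC⟩ := exists_bound_abelSource h1 ht ht
  refine hasDerivAt_integral_Ioi (U := Ioi x₀) (C := C) (Ioi_mem_nhds h2)
    (fun y hy => continuousOn_comp_add_sq (continuousOn_abelSource₁ ht) (h1.trans hy))
    (fun y hy => continuousOn_comp_add_sq (continuousOn_abelSource₂ ht) (h1.trans hy))
    (fun y hy w _ => decay_le two_ne_zero hC0 (h1.trans hy) ?_)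
    (fun y hy w _ => decay_le three_ne_zero hC0 (h1.trans hy) ?_)
    (fun y hy w _ => hasDerivAt_comp_add_sq
      (hasDerivAt_abelSource₁ (one_lt_add_sq (h1.trans hy) w) ht))
  · exact (hC (y + w ^ 2) (by nlinarith [sq_nonneg w, mem_Ioi.1 hy]) t le_rfl le_rfl).2.1
  · exact (hC (y + w ^ 2) (by nlinarith [sq_nonneg w, mem_Ioi.1 hy]) t le_rfl le_rfl).2.2.1

lemma continuousAt_abelTransform₂ {x t : ℝ} (hx : 1 < x) (ht : 0 < t) :
    ContinuousAt (fun x => abelTransform abelSource₂ x t) x := by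
  obtain ⟨x₀, h1, h2⟩ := exists_between hx
  obtain ⟨C, hC0, hC⟩ := exists_bound_abelSource h1 ht ht
  refine continuousAt_integral_Ioi (U := Ioi x₀) (C := C) (Ioi_mem_nhds h2)
    (fun y hy => continuousOn_comp_add_sq (continuousOn_abelSource₂ ht) (h1.trans hy))
    (fun y hy w _ => decay_le three_ne_zero hC0 (h1.trans hy) ?_) (fun w _ => ?_)
  · exact (hC (y + w ^ 2) (by nlinarith [sq_nonneg w, mem_Ioi.1 hy]) t le_rfl le_rfl).2.2.1
  · exact ContinuousAt.comp (f := fun x => x + w ^ 2) (g := fun X => abelSource₂ X t)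
      ((continuousOn_abelSource₂ ht).continuousAt (Ioi_mem_nhds (one_lt_add_sq hx w)))
      (by fun_prop)

lemma hasDerivAt_abelTransform_time {x t : ℝ} (hx : 1 < x) (ht : 0 < t) :
    HasDerivAt (abelTransform abelSource x) (abelTransform abelSourceTime₁ x t) t := by
  obtain ⟨C, hC0, hC⟩ := exists_bound_abelSource hx (half_pos ht) (by linarith : 0 < t + 1)
  have hU : Ioo (t / 2) (t + 1) ∈ 𝓝 t := Ioo_mem_nhds (by linarith) (by linarith)
  have hpos : ∀ y ∈ Ioo (t / 2) (t + 1), 0 < y := fun y hy => (half_pos ht).trans hy.1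
  refine hasDerivAt_integral_Ioi (C := C) hU
    (fun y hy => continuousOn_comp_add_sq (continuousOn_abelSource (hpos y hy)) hx)
    (fun y hy => continuousOn_comp_add_sq (continuousOn_abelSourceTime₁ (hpos y hy)) hx)
    (fun y hy w _ => decay_le one_ne_zero hC0 hx ?_)
    (fun y hy w _ => decay_le one_ne_zero hC0 hx ?_)
    (fun y hy w _ => hasDerivAt_abelSource_time _ (hpos y hy))
  · simpa using (hC (x + w ^ 2) (by nlinarith [sq_nonneg w]) y hy.1.le hy.2.le).1
  · simpa using (hC (x + w ^ 2) (by nlinarith [sq_nonneg w]) y hy.1.le hy.2.le).2.2.2.1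

lemma hasDerivAt_abelTransform_time₁ {x t : ℝ} (hx : 1 < x) (ht : 0 < t) :
    HasDerivAt (abelTransform abelSourceTime₁ x) (abelTransform abelSourceTime₂ x t) t := by
  obtain ⟨C, hC0, hC⟩ := exists_bound_abelSource hx (half_pos ht) (by linarith : 0 < t + 1)
  have hU : Ioo (t / 2) (t + 1) ∈ 𝓝 t := Ioo_mem_nhds (by linarith) (by linarith)
  have hpos : ∀ y ∈ Ioo (t / 2) (t + 1), 0 < y := fun y hy => (half_pos ht).trans hy.1
  refine hasDerivAt_integral_Ioi (C := C) hU
    (fun y hy => continuousOn_comp_add_sq (continuousOn_abelSourceTime₁ (hpos y hy)) hx)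
    (fun y hy => continuousOn_comp_add_sq (continuousOn_abelSourceTime₂ (hpos y hy)) hx)
    (fun y hy w _ => decay_le one_ne_zero hC0 hx ?_)
    (fun y hy w _ => decay_le one_ne_zero hC0 hx ?_)
    (fun y hy w _ => hasDerivAt_abelSourceTime₁ _ (hpos y hy))
  · simpa using (hC (x + w ^ 2) (by nlinarith [sq_nonneg w]) y hy.1.le hy.2.le).2.2.2.1
  · simpa using (hC (x + w ^ 2) (by nlinarith [sq_nonneg w]) y hy.1.le hy.2.le).2.2.2.2

lemma continuousAt_abelTransform_time₂ {x t : ℝ} (hx : 1 < x) (ht : 0 < t) :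
    ContinuousAt (abelTransform abelSourceTime₂ x) t := by
  obtain ⟨C, hC0, hC⟩ := exists_bound_abelSource hx (half_pos ht) (by linarith : 0 < t + 1)
  have hU : Ioo (t / 2) (t + 1) ∈ 𝓝 t := Ioo_mem_nhds (by linarith) (by linarith)
  have hpos : ∀ y ∈ Ioo (t / 2) (t + 1), 0 < y := fun y hy => (half_pos ht).trans hy.1
  refine continuousAt_integral_Ioi (C := C) hU
    (fun y hy => continuousOn_comp_add_sq (continuousOn_abelSourceTime₂ (hpos y hy)) hx)
    (fun y hy w _ => decay_le one_ne_zero hC0 hx ?_) (fun w _ => ?_)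
  · simpa using (hC (x + w ^ 2) (by nlinarith [sq_nonneg w]) y hy.1.le hy.2.le).2.2.2.2
  · have h5 := (hasDerivAt_besselFactor_time 5 (x + w ^ 2) ht).continuousAt
    have h4 := (hasDerivAt_besselFactor_time 4 (x + w ^ 2) ht).continuousAt
    unfold abelSourceTime₂
    fun_prop

/-- The Abel transform carries the equation of `H` to the radial Laplace equation. The two sides
differ by the integral of the derivative of `w (2x + w²) H'(x + w²) / 2 + 3 w H(x + w²) / 4`,
which vanishes at `0` and at infinity. -/
lemma abelTransform_pde {x t : ℝ} (hx : 1 < x) (ht : 0 < t) :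
    -abelTransform abelSourceTime₂ x t
      = (x ^ 2 - 1) * abelTransform abelSource₂ x t + 2 * x * abelTransform abelSource₁ x t := by
  obtain ⟨C, hC0, hC⟩ := exists_bound_abelSource hx ht ht
  have hX0 : ∀ w : ℝ, 0 < x + w ^ 2 := fun w => by linarith [one_lt_add_sq hx w]
  have hXge : ∀ w : ℝ, x ≤ x + w ^ 2 := fun w => by nlinarith [sq_nonneg w]
  have cH := continuousOn_comp_add_sq (continuousOn_abelSource ht) hx
  have cH1 := continuousOn_comp_add_sq (continuousOn_abelSource₁ ht) hx
  have cH2 := continuousOn_comp_add_sq (continuousOn_abelSource₂ ht) hx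
  have cT := continuousOn_comp_add_sq (continuousOn_abelSourceTime₂ ht) hx
  have b0 : ∀ w : ℝ, |abelSource (x + w ^ 2) t| ≤ C / (x + w ^ 2) := fun w =>
    (hC _ (hXge w) t le_rfl le_rfl).1
  have b1 : ∀ w : ℝ, |abelSource₁ (x + w ^ 2) t| ≤ C / (x + w ^ 2) ^ 2 := fun w =>
    (hC _ (hXge w) t le_rfl le_rfl).2.1
  have b2 : ∀ w : ℝ, |abelSource₂ (x + w ^ 2) t| ≤ C / (x + w ^ 2) ^ 3 := fun w =>
    (hC _ (hXge w) t le_rfl le_rfl).2.2.1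
  have bT : ∀ w : ℝ, |abelSourceTime₂ (x + w ^ 2) t| ≤ C / (x + w ^ 2) := fun w =>
    (hC _ (hXge w) t le_rfl le_rfl).2.2.2.2
  have iH1 : IntegrableOn (fun w => abelSource₁ (x + w ^ 2) t) (Ioi 0) :=
    integrableOn_of_le_inv_one_add_sq cH1 fun w _ => decay_le two_ne_zero hC0 hx (b1 w)
  have iH2 : IntegrableOn (fun w => abelSource₂ (x + w ^ 2) t) (Ioi 0) :=
    integrableOn_of_le_inv_one_add_sq cH2 fun w _ => decay_le three_ne_zero hC0 hx (b2 w)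
  have iT : IntegrableOn (fun w => abelSourceTime₂ (x + w ^ 2) t) (Ioi 0) :=
    integrableOn_of_le_inv_one_add_sq cT fun w _ =>
      decay_le one_ne_zero hC0 hx (by simpa using bT w)
  set S : ℝ → ℝ := fun w => 1 / 2 * (w * (2 * x + w ^ 2)) * abelSource₁ (x + w ^ 2) t
    + 3 / 4 * w * abelSource (x + w ^ 2) t with hS
  have hinner : ∀ w : ℝ, HasDerivAt (fun w : ℝ => x + w ^ 2) (2 * w) w := fun w => by
    simpa using (hasDerivAt_pow 2 w).const_add x
  have hdS : ∀ w ∈ Ici (0 : ℝ), HasDerivAt S (-abelSourceTime₂ (x + w ^ 2) t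
      - ((x ^ 2 - 1) * abelSource₂ (x + w ^ 2) t + 2 * x * abelSource₁ (x + w ^ 2) t)) w := by
    intro w _
    have h0 := (hasDerivAt_abelSource (one_lt_add_sq hx w) ht).comp w (hinner w)
    have h1 := (hasDerivAt_abelSource₁ (one_lt_add_sq hx w) ht).comp w (hinner w)
    have hp : HasDerivAt (fun w : ℝ => 1 / 2 * (w * (2 * x + w ^ 2)))
        (1 / 2 * (2 * x + 3 * w ^ 2)) w := by
      refine (((hasDerivAt_id w).mul ((hasDerivAt_pow 2 w).const_add (2 * x))).const_mul
        (1 / 2)).congr_deriv ?_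
      simp only [id]; push_cast; ring
    have hl : HasDerivAt (fun w : ℝ => 3 / 4 * w) (3 / 4) w := by
      simpa using (hasDerivAt_id w).const_mul (3 / 4 : ℝ)
    refine ((hp.mul h1).add (hl.mul h0)).congr_deriv ?_
    rw [abelSource_pde (one_lt_add_sq hx w) ht]
    simp only [Function.comp]
    ring
  have hiS : IntegrableOn (fun w => -abelSourceTime₂ (x + w ^ 2) t
      - ((x ^ 2 - 1) * abelSource₂ (x + w ^ 2) t + 2 * x * abelSource₁ (x + w ^ 2) t)) (Ioi 0) :=
    iT.neg.sub ((iH2.const_mul _).add (iH1.const_mul _))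
  have hlim : Tendsto S atTop (𝓝 0) := by
    have hz : Tendsto (fun w : ℝ => 2 * C * (1 / w)) atTop (𝓝 (2 * C * 0)) :=
      (tendsto_const_nhds.div_atTop tendsto_id).const_mul _
    rw [mul_zero] at hz
    refine squeeze_zero_norm' ?_ hz
    filter_upwards [eventually_gt_atTop 0] with w hw
    have hX := hX0 w
    have e1 : |1 / 2 * (w * (2 * x + w ^ 2)) * abelSource₁ (x + w ^ 2) t|
        ≤ w * (x + w ^ 2) * (C / (x + w ^ 2) ^ 2) := by
      rw [abs_mul, abs_of_nonneg (by positivity : 0 ≤ 1 / 2 * (w * (2 * x + w ^ 2)))]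
      have : 1 / 2 * (w * (2 * x + w ^ 2)) ≤ w * (x + w ^ 2) := by nlinarith [pow_pos hw 3]
      exact mul_le_mul this (b1 w) (abs_nonneg _) (by positivity)
    have e2 : |3 / 4 * w * abelSource (x + w ^ 2) t| ≤ w * (C / (x + w ^ 2)) := by
      rw [abs_mul, abs_of_nonneg (by positivity : 0 ≤ 3 / 4 * w)]
      exact mul_le_mul (by linarith) (b0 w) (abs_nonneg _) hw.le
    have e3 : w * (x + w ^ 2) * (C / (x + w ^ 2) ^ 2) = w * (C / (x + w ^ 2)) := by field_simp
    have e4 : w * (C / (x + w ^ 2)) ≤ C * (1 / w) := by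
      rw [mul_one_div, ← mul_div_assoc, div_le_div_iff₀ hX hw]
      nlinarith [mul_nonneg hC0 (by linarith : (0 : ℝ) ≤ x)]
    calc ‖S w‖ ≤ _ := abs_add_le _ _
      _ ≤ 2 * C * (1 / w) := by linarith
  have h := integral_Ioi_of_hasDerivAt_of_tendsto' hdS hiS hlim
  have i12 : IntegrableOn (fun w => (x ^ 2 - 1) * abelSource₂ (x + w ^ 2) t
      + 2 * x * abelSource₁ (x + w ^ 2) t) (Ioi 0) := (iH2.const_mul _).add (iH1.const_mul _)
  have iT' : IntegrableOn (fun w => -abelSourceTime₂ (x + w ^ 2) t) (Ioi 0) := iT.neg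
  rw [integral_sub iT' i12, integral_add (iH2.const_mul _) (iH1.const_mul _), integral_neg,
    integral_const_mul, integral_const_mul] at h
  have hS0 : S 0 = 0 := by simp [hS]
  rw [hS0] at h
  unfold abelTransform
  linarith

/-! ### The density in the variable `η` -/

/-- The substitution `cosh φ = cosh η + w²` turns the singular integral over `φ > η` into an
integral over `w > 0`. -/
lemma image_arcosh_cosh_add_sq {η : ℝ} (hη : 0 ≤ η) :
    (fun w : ℝ => Real.arcosh (Real.cosh η + w ^ 2)) '' Ioi 0 = Ioi η := by
  ext φ; constructor
  · rintro ⟨w, hw, rfl⟩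
    have hw' : (0 : ℝ) < w := hw
    have h1 := Real.one_le_cosh η
    calc η = Real.arcosh (Real.cosh η) := (Real.arcosh_cosh hη).symm
      _ < _ := (Real.arcosh_lt_arcosh (by positivity) (by positivity)).2 (by nlinarith)
  · intro hφ
    have hlt : Real.cosh η < Real.cosh φ :=
      Real.cosh_lt_cosh.2 (by rw [abs_of_nonneg hη, abs_of_pos (hη.trans_lt hφ)]; exact hφ)
    refine ⟨√(Real.cosh φ - Real.cosh η), Real.sqrt_pos.2 (by linarith), ?_⟩
    simp only
    rw [Real.sq_sqrt (by linarith), add_sub_cancel, Real.arcosh_cosh (hη.trans hφ.le)]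

lemma one_lt_cosh_add_sq (η : ℝ) {w : ℝ} (hw : 0 < w) : 1 < Real.cosh η + w ^ 2 := by
  have := Real.one_le_cosh η; nlinarith

lemma hasDerivWithinAt_arcosh_cosh_add_sq (η : ℝ) : ∀ w ∈ Ioi (0 : ℝ),
    HasDerivWithinAt (fun w : ℝ => Real.arcosh (Real.cosh η + w ^ 2))
      (2 * w / √((Real.cosh η + w ^ 2) ^ 2 - 1)) (Ioi 0) w := by
  intro w hw
  have h := (Real.hasDerivAt_arcosh (one_lt_cosh_add_sq η hw)).comp w
    ((hasDerivAt_pow 2 w).const_add (Real.cosh η))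
  refine (h.congr_deriv ?_).hasDerivWithinAt
  push_cast
  ring

lemma injOn_arcosh_cosh_add_sq (η : ℝ) :
    InjOn (fun w : ℝ => Real.arcosh (Real.cosh η + w ^ 2)) (Ioi 0) := by
  intro w hw v hv h
  have := Real.arcosh_injOn (one_lt_cosh_add_sq η hw).le (one_lt_cosh_add_sq η hv).le h
  exact (pow_left_inj₀ (le_of_lt hw) (le_of_lt hv) two_ne_zero).1 (by linarith)

lemma pJ2Integrand_eq {η t φ : ℝ} (ht : 0 < t) : pJ2Integrand η t φ
    = 2 * (φ / √(Real.cosh φ - Real.cosh η) * gigIntegral 3 (φ ^ 2 + t ^ 2)) := by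
  rw [pJ2Integrand, mul_assoc, ← gigIntegral_three_eq_besselK (by positivity)]; ring

lemma abs_deriv_smul_pJ2Integrand {η t : ℝ} (ht : 0 < t) {w : ℝ} (hw : w ∈ Ioi (0 : ℝ)) :
    |2 * w / √((Real.cosh η + w ^ 2) ^ 2 - 1)| •
      pJ2Integrand η t (Real.arcosh (Real.cosh η + w ^ 2))
      = 4 / t * abelSource (Real.cosh η + w ^ 2) t := by
  have hw' : (0 : ℝ) < w := hw
  have hX := one_lt_cosh_add_sq η hw'
  have hr : 0 < √((Real.cosh η + w ^ 2) ^ 2 - 1) := Real.sqrt_pos.2 (sq_sub_one_pos hX)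
  rw [abs_of_pos (by positivity), smul_eq_mul, pJ2Integrand_eq ht, Real.cosh_arcosh hX.le,
    add_sub_cancel_left, Real.sqrt_sq hw'.le, abelSource, besselFactor, arcoshRatio]
  field_simp
  ring

lemma integrableOn_abelSource {x t : ℝ} (hx : 1 < x) (ht : 0 < t) :
    IntegrableOn (fun w => abelSource (x + w ^ 2) t) (Ioi 0) := by
  obtain ⟨C, hC0, hC⟩ := exists_bound_abelSource hx ht ht
  refine integrableOn_of_le_inv_one_add_sq
    (continuousOn_comp_add_sq (continuousOn_abelSource ht) hx)
    fun w _ => decay_le one_ne_zero hC0 hx ?_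
  simpa using (hC (x + w ^ 2) (by nlinarith [sq_nonneg w]) t le_rfl le_rfl).1

lemma integrableOn_pJ2Integrand {η t : ℝ} (hη : 0 < η) (ht : 0 < t) :
    IntegrableOn (pJ2Integrand η t) (Ioi η) := by
  rw [← image_arcosh_cosh_add_sq hη.le, integrableOn_image_iff_integrableOn_abs_deriv_smul
    measurableSet_Ioi (hasDerivWithinAt_arcosh_cosh_add_sq η) (injOn_arcosh_cosh_add_sq η)]
  refine ((integrableOn_abelSource (Real.one_lt_cosh.2 hη.ne') ht).const_mul (4 / t)).congr ?_
  filter_upwards [ae_restrict_mem measurableSet_Ioi] with w hw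
  exact (abs_deriv_smul_pJ2Integrand ht hw).symm

/-- `p_{J₂}` is, up to the factor `√2 sinh η / π`, an Abel transform evaluated at `cosh η`. -/
lemma pJ2_eq_abelTransform {η t : ℝ} (hη : 0 < η) (ht : 0 < t) :
    pJ2 η t = √2 / Real.pi * (Real.sinh η * abelTransform abelSource (Real.cosh η) t) := by
  have h : ∫ φ in Ioi η, pJ2Integrand η t φ = 4 / t * abelTransform abelSource (Real.cosh η) t := by
    rw [← image_arcosh_cosh_add_sq hη.le, integral_image_eq_integral_abs_deriv_smul
      measurableSet_Ioi (hasDerivWithinAt_arcosh_cosh_add_sq η) (injOn_arcosh_cosh_add_sq η),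
      abelTransform, ← integral_const_mul]
    exact setIntegral_congr_fun measurableSet_Ioi fun w hw => abs_deriv_smul_pJ2Integrand ht hw
  have h8 : √(2 ^ 3) = 2 * √2 := by
    rw [show (2 : ℝ) ^ 3 = 2 ^ 2 * 2 by norm_num, Real.sqrt_mul (by positivity),
      Real.sqrt_sq (by norm_num)]
  rw [pJ2, h, h8]
  have h2 : √2 ^ 2 = (2 : ℝ) := Real.sq_sqrt (by norm_num)
  have h0 : 0 < √(2 : ℝ) := by positivity
  field_simp
  linear_combination (-2 * abelTransform abelSource (Real.cosh η) t) * h2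

lemma hasDerivAt_pJ2_time {η : ℝ} (hη : 0 < η) : ∀ t ∈ Ioi (0 : ℝ), HasDerivAt (fun t => pJ2 η t)
    (√2 / Real.pi * (Real.sinh η * abelTransform abelSourceTime₁ (Real.cosh η) t)) t := by
  intro t ht
  refine (((hasDerivAt_abelTransform_time (Real.one_lt_cosh.2 hη.ne') ht).const_mul
    (Real.sinh η)).const_mul (√2 / Real.pi)).congr_of_eventuallyEq ?_
  filter_upwards [Ioi_mem_nhds ht] with s hs using pJ2_eq_abelTransform hη hs

lemma hasDerivAt_pJ2_time₁ {η t : ℝ} (hη : 0 < η) (ht : 0 < t) : HasDerivAt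
    (fun t => √2 / Real.pi * (Real.sinh η * abelTransform abelSourceTime₁ (Real.cosh η) t))
    (√2 / Real.pi * (Real.sinh η * abelTransform abelSourceTime₂ (Real.cosh η) t)) t :=
  ((hasDerivAt_abelTransform_time₁ (Real.one_lt_cosh.2 hη.ne') ht).const_mul
    (Real.sinh η)).const_mul (√2 / Real.pi)

lemma contDiffOn_pJ2_time {η : ℝ} (hη : 0 < η) : ContDiffOn ℝ 2 (fun t => pJ2 η t) (Ioi 0) :=
  contDiffOn_two_of_hasDerivAt isOpen_Ioi (hasDerivAt_pJ2_time hη)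
    (fun _ ht => hasDerivAt_pJ2_time₁ hη ht) fun _ ht =>
      ((continuousAt_abelTransform_time₂ (Real.one_lt_cosh.2 hη.ne') ht).const_mul
        _).const_mul _ |>.continuousWithinAt

lemma hasDerivAt_comp_cosh {F : ℝ → ℝ} {F' η : ℝ} (h : HasDerivAt F F' (Real.cosh η)) :
    HasDerivAt (fun η => F (Real.cosh η)) (F' * Real.sinh η) η :=
  h.comp η (Real.hasDerivAt_cosh η)

lemma hasDerivAt_pJ2_space {t : ℝ} (ht : 0 < t) : ∀ η ∈ Ioi (0 : ℝ),
    HasDerivAt (fun η => pJ2 η t) (√2 / Real.pi *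
      (Real.cosh η * abelTransform abelSource (Real.cosh η) t
        + Real.sinh η ^ 2 * abelTransform abelSource₁ (Real.cosh η) t)) η := by
  intro η hη
  have hQ := hasDerivAt_comp_cosh
    (hasDerivAt_abelTransform (Real.one_lt_cosh.2 (ne_of_gt hη)) ht)
  refine ((((Real.hasDerivAt_sinh η).mul hQ).const_mul (√2 / Real.pi)).congr_deriv ?_
    ).congr_of_eventuallyEq ?_
  · ring
  · filter_upwards [Ioi_mem_nhds hη] with s hs using pJ2_eq_abelTransform hs ht

lemma hasDerivAt_pJ2_space₁ {η t : ℝ} (hη : 0 < η) (ht : 0 < t) : HasDerivAt (fun η =>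
    √2 / Real.pi * (Real.cosh η * abelTransform abelSource (Real.cosh η) t
        + Real.sinh η ^ 2 * abelTransform abelSource₁ (Real.cosh η) t))
    (√2 / Real.pi * (Real.sinh η * abelTransform abelSource (Real.cosh η) t
      + 3 * Real.sinh η * Real.cosh η * abelTransform abelSource₁ (Real.cosh η) t
      + Real.sinh η ^ 3 * abelTransform abelSource₂ (Real.cosh η) t)) η := by
  have hx := Real.one_lt_cosh.2 hη.ne'
  have hQ := hasDerivAt_comp_cosh (hasDerivAt_abelTransform hx ht)
  have hQ₁ := hasDerivAt_comp_cosh (hasDerivAt_abelTransform₁ hx ht)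
  refine ((((Real.hasDerivAt_cosh η).mul hQ).add (((Real.hasDerivAt_sinh η).pow 2).mul
    hQ₁)).const_mul (√2 / Real.pi)).congr_deriv ?_
  simp only [Pi.pow_apply]
  push_cast
  ring

lemma contDiffOn_pJ2_space {t : ℝ} (ht : 0 < t) : ContDiffOn ℝ 2 (fun η => pJ2 η t) (Ioi 0) := by
  refine contDiffOn_two_of_hasDerivAt isOpen_Ioi (hasDerivAt_pJ2_space ht)
    (fun _ hη => hasDerivAt_pJ2_space₁ hη ht) fun η hη => ContinuousAt.continuousWithinAt ?_
  have hx := Real.one_lt_cosh.2 (ne_of_gt hη)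
  have c0 := (hasDerivAt_comp_cosh (hasDerivAt_abelTransform hx ht)).continuousAt
  have c1 := (hasDerivAt_comp_cosh (hasDerivAt_abelTransform₁ hx ht)).continuousAt
  have c2 : ContinuousAt (fun η => abelTransform abelSource₂ (Real.cosh η) t) η :=
    ContinuousAt.comp (f := Real.cosh) (g := fun x => abelTransform abelSource₂ x t)
      (continuousAt_abelTransform₂ hx ht) Real.continuous_cosh.continuousAt
  fun_prop

lemma pJ2_pde {η t : ℝ} (hη : 0 < η) (ht : 0 < t) :
    -iteratedDeriv 2 (fun τ => pJ2 η τ) t =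
      iteratedDeriv 2 (fun ξ => pJ2 ξ t) η - deriv (fun ξ => 1 / Real.tanh ξ * pJ2 ξ t) η := by
  have hx := Real.one_lt_cosh.2 hη.ne'
  rw [iteratedDeriv_two_eq_of_hasDerivAt isOpen_Ioi (hasDerivAt_pJ2_time hη) ht
    (hasDerivAt_pJ2_time₁ hη ht), iteratedDeriv_two_eq_of_hasDerivAt isOpen_Ioi
    (hasDerivAt_pJ2_space ht) hη (hasDerivAt_pJ2_space₁ hη ht)]
  have hQ := hasDerivAt_comp_cosh (hasDerivAt_abelTransform hx ht)
  have hd : HasDerivAt (fun ξ => 1 / Real.tanh ξ * pJ2 ξ t)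
      (√2 / Real.pi * (Real.sinh η * abelTransform abelSource (Real.cosh η) t
        + Real.cosh η * (abelTransform abelSource₁ (Real.cosh η) t * Real.sinh η))) η := by
    refine (((Real.hasDerivAt_cosh η).mul hQ).const_mul (√2 / Real.pi)).congr_of_eventuallyEq ?_
    filter_upwards [Ioi_mem_nhds hη] with s hs
    have hs' : Real.sinh s ≠ 0 := (Real.sinh_pos_iff.2 hs).ne'
    rw [pJ2_eq_abelTransform hs ht, Real.tanh_eq_sinh_div_cosh]
    simp only [Pi.mul_apply]
    field_simp
  rw [hd.deriv]
  have hsq : Real.cosh η ^ 2 = Real.sinh η ^ 2 + 1 := Real.cosh_sq η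
  have := abelTransform_pde hx ht
  rw [hsq] at this
  linear_combination (√2 / Real.pi * Real.sinh η) * this

/-! ### The tail of the radial density -/

lemma lintegral_Ioo_of_hasDerivAt_of_nonneg {F F' : ℝ → ℝ} {a b : ℝ} (hab : a ≤ b)
    (hc : ContinuousOn F (Icc a b)) (hd : ∀ x ∈ Ioo a b, HasDerivAt F (F' x) x)
    (h0 : ∀ x ∈ Ioo a b, 0 ≤ F' x) :
    ∫⁻ x in Ioo a b, ENNReal.ofReal (F' x) = ENNReal.ofReal (F b - F a) := by
  have hi := intervalIntegral.integrableOn_deriv_of_nonneg hc hd h0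
  have hI := intervalIntegral.integral_eq_sub_of_hasDerivAt_of_le hab hc hd
    ((intervalIntegrable_iff_integrableOn_Ioc_of_le hab).2 hi)
  rw [← hI, intervalIntegral.integral_of_le hab, integral_Ioc_eq_integral_Ioo,
    ofReal_integral_eq_lintegral_ofReal (hi.mono_set Ioo_subset_Ioc_self)]
  filter_upwards [ae_restrict_mem measurableSet_Ioo] with x hx using h0 x hx

lemma lintegral_Ioi_swap {f : ℝ → ℝ → ℝ≥0∞} (hf : Measurable (Function.uncurry f)) (a : ℝ) :
    ∫⁻ x in Ioi a, ∫⁻ y in Ioi x, f x y = ∫⁻ y in Ioi a, ∫⁻ x in Ioo a y, f x y := by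
  have hS : MeasurableSet {p : ℝ × ℝ | a < p.1 ∧ p.1 < p.2} :=
    (measurableSet_lt measurable_const measurable_fst).inter
      (measurableSet_lt measurable_fst measurable_snd)
  set g : ℝ → ℝ → ℝ≥0∞ := fun x y =>
    {p : ℝ × ℝ | a < p.1 ∧ p.1 < p.2}.indicator (Function.uncurry f) (x, y) with hg
  have hgm : Measurable (Function.uncurry g) := hf.indicator hS
  have h1 : ∫⁻ x in Ioi a, ∫⁻ y in Ioi x, f x y = ∫⁻ x, ∫⁻ y, g x y := by
    rw [← lintegral_indicator measurableSet_Ioi]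
    congr 1; ext x
    by_cases hx : a < x
    · rw [indicator_of_mem (mem_Ioi.2 hx), ← lintegral_indicator measurableSet_Ioi]
      congr 1; ext y
      by_cases hy : x < y <;> simp [hg, indicator, hx, hy]
    · rw [indicator_of_notMem (by simpa using hx)]
      simp [hg, indicator, hx]
  have h2 : ∫⁻ y in Ioi a, ∫⁻ x in Ioo a y, f x y = ∫⁻ y, ∫⁻ x, g x y := by
    rw [← lintegral_indicator measurableSet_Ioi]
    congr 1; ext y
    by_cases hy : a < y
    · rw [indicator_of_mem (mem_Ioi.2 hy), ← lintegral_indicator measurableSet_Ioo]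
      congr 1
    · rw [indicator_of_notMem (by simpa using hy)]
      have : ∀ x, g x y = 0 := fun x => by
        simp only [hg]
        refine indicator_of_notMem ?_ _
        simp only [mem_ofPred_eq]
        exact fun h => hy (h.1.trans h.2)
      simp [this]
  rw [h1, h2]
  exact lintegral_lintegral_swap hgm.aemeasurable

lemma hasDerivAt_two_mul_sqrt {u : ℝ → ℝ} {u' x : ℝ} (h : HasDerivAt u u' x) (hx : 0 < u x) :
    HasDerivAt (fun x => 2 * √(u x)) (u' / √(u x)) x := by
  have hs : 0 < √(u x) := Real.sqrt_pos.2 hx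
  refine ((h.sqrt hx.ne').const_mul 2).congr_deriv ?_
  field_simp

/-- `∫_η^φ sinh ξ / √(cosh φ - cosh ξ) dξ = 2 √(cosh φ - cosh η)`. -/
lemma lintegral_sinh_div_sqrt_cosh_sub_left {η φ : ℝ} (hη : 0 ≤ η) (h : η ≤ φ) :
    ∫⁻ ξ in Ioo η φ, ENNReal.ofReal (Real.sinh ξ / √(Real.cosh φ - Real.cosh ξ))
      = ENNReal.ofReal (2 * √(Real.cosh φ - Real.cosh η)) := by
  have hpos : ∀ ξ ∈ Ioo η φ, 0 < Real.cosh φ - Real.cosh ξ := fun ξ hξ => sub_pos.2 <|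
    Real.cosh_lt_cosh.2 (by
      rw [abs_of_nonneg (hη.trans hξ.1.le), abs_of_nonneg (hη.trans h)]; exact hξ.2)
  have := lintegral_Ioo_of_hasDerivAt_of_nonneg (a := η) (b := φ)
    (F := fun ξ => -(2 * √(Real.cosh φ - Real.cosh ξ)))
    (F' := fun ξ => Real.sinh ξ / √(Real.cosh φ - Real.cosh ξ)) h (by fun_prop) (fun ξ hξ => by
      refine (hasDerivAt_two_mul_sqrt ((Real.hasDerivAt_cosh ξ).const_sub (Real.cosh φ))
        (hpos ξ hξ)).neg.congr_deriv ?_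
      ring) (fun ξ hξ => by
      have := Real.sinh_nonneg_iff.2 (hη.trans hξ.1.le)
      positivity)
  rw [this]
  simp

/-- `∫_η^φ sinh ξ / √(cosh ξ - cosh η) dξ = 2 √(cosh φ - cosh η)`. -/
lemma lintegral_sinh_div_sqrt_cosh_sub_right {η φ : ℝ} (hη : 0 ≤ η) (h : η ≤ φ) :
    ∫⁻ ξ in Ioo η φ, ENNReal.ofReal (Real.sinh ξ / √(Real.cosh ξ - Real.cosh η))
      = ENNReal.ofReal (2 * √(Real.cosh φ - Real.cosh η)) := by
  have hpos : ∀ ξ ∈ Ioo η φ, 0 < Real.cosh ξ - Real.cosh η := fun ξ hξ => sub_pos.2 <|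
    Real.cosh_lt_cosh.2 (by
      rw [abs_of_nonneg (hη.trans hξ.1.le), abs_of_nonneg hη]; exact hξ.1)
  have := lintegral_Ioo_of_hasDerivAt_of_nonneg (a := η) (b := φ)
    (F := fun ξ => 2 * √(Real.cosh ξ - Real.cosh η))
    (F' := fun ξ => Real.sinh ξ / √(Real.cosh ξ - Real.cosh η)) h (by fun_prop) (fun ξ hξ =>
      hasDerivAt_two_mul_sqrt ((Real.hasDerivAt_cosh ξ).sub_const (Real.cosh η)) (hpos ξ hξ))
    (fun ξ hξ => by
      have := Real.sinh_nonneg_iff.2 (hη.trans hξ.1.le)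
      positivity)
  rw [this]
  simp

/-- `∫_v^∞ (φ / s) e^{-φ² / (2s)} dφ = e^{-v² / (2s)}`. -/
lemma lintegral_Ioi_mul_exp_neg_sq {v s : ℝ} (hv : 0 ≤ v) (hs : 0 < s) :
    ∫⁻ φ in Ioi v, ENNReal.ofReal (φ / s * Real.exp (-φ ^ 2 / (2 * s)))
      = ENNReal.ofReal (Real.exp (-v ^ 2 / (2 * s))) := by
  have hd : ∀ φ ∈ Ici v, HasDerivAt (fun φ : ℝ => -Real.exp (-φ ^ 2 / (2 * s)))
      (φ / s * Real.exp (-φ ^ 2 / (2 * s))) φ := fun φ _ => by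
    have h1 : HasDerivAt (fun φ : ℝ => -φ ^ 2 / (2 * s)) (-(2 * φ) / (2 * s)) φ := by
      simpa using ((hasDerivAt_pow 2 φ).neg.div_const (2 * s))
    refine h1.exp.neg.congr_deriv ?_
    field_simp
  have h0 : ∀ φ ∈ Ioi v, 0 ≤ φ / s * Real.exp (-φ ^ 2 / (2 * s)) := fun φ hφ => by
    have : 0 ≤ φ := hv.trans (le_of_lt hφ)
    positivity
  have hl : Tendsto (fun φ : ℝ => -Real.exp (-φ ^ 2 / (2 * s))) atTop (𝓝 0) := by
    rw [← neg_zero]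
    refine (Real.tendsto_exp_atBot.comp ?_).neg
    have : Tendsto (fun φ : ℝ => φ ^ 2 / (2 * s)) atTop atTop :=
      (tendsto_pow_atTop two_ne_zero).atTop_div_const (by positivity)
    refine (tendsto_neg_atTop_atBot.comp this).congr fun φ => ?_
    simp [neg_div]
  have hI := integral_Ioi_of_hasDerivAt_of_nonneg' hd h0 hl
  have hi := integrableOn_Ioi_deriv_of_nonneg' hd h0 hl
  rw [← ofReal_integral_eq_lintegral_ofReal hi
    (by filter_upwards [ae_restrict_mem measurableSet_Ioi] with φ hφ using h0 φ hφ), hI]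
  simp

/-- The tail `P(R_s > η)` of the radial part of the hyperbolic Brownian motion at time `s`, in the
form given by the Abel inversion. -/
noncomputable def radialTail (η s : ℝ) : ℝ≥0∞ :=
  ∫⁻ v in Ioi η, ENNReal.ofReal (Real.exp (-s / 8) / √(Real.pi * s) *
    (Real.sinh v / √(Real.cosh v - Real.cosh η) * Real.exp (-v ^ 2 / (2 * s))))

lemma sqrt_pi_mul_cube {s : ℝ} (hs : 0 < s) : √(Real.pi * s ^ 3) = √(Real.pi * s) * s := by
  rw [show Real.pi * s ^ 3 = Real.pi * s * s ^ 2 by ring, Real.sqrt_mul (by positivity),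
    Real.sqrt_sq hs.le]

/-- The tail with the square root in the numerator: write `e^{-v² / (2s)}` as an integral over
`φ > v`, and integrate first in `v`. -/
lemma radialTail_eq {η s : ℝ} (hη : 0 ≤ η) (hs : 0 < s) : radialTail η s =
    ∫⁻ φ in Ioi η, ENNReal.ofReal (Real.exp (-s / 8) / √(Real.pi * s ^ 3)
      * (φ * Real.exp (-φ ^ 2 / (2 * s)))) *
        ENNReal.ofReal (2 * √(Real.cosh φ - Real.cosh η)) := by
  set c := Real.exp (-s / 8) / √(Real.pi * s) with hc
  have hc0 : 0 ≤ c := by positivity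
  have hm : Measurable (Function.uncurry fun v φ : ℝ =>
      ENNReal.ofReal (Real.sinh v / √(Real.cosh v - Real.cosh η)) *
        ENNReal.ofReal (c * (φ / s * Real.exp (-φ ^ 2 / (2 * s))))) := by
    unfold Function.uncurry; fun_prop
  have h1 : radialTail η s = ∫⁻ v in Ioi η, ∫⁻ φ in Ioi v,
      ENNReal.ofReal (Real.sinh v / √(Real.cosh v - Real.cosh η)) *
        ENNReal.ofReal (c * (φ / s * Real.exp (-φ ^ 2 / (2 * s)))) := by
    refine setLIntegral_congr_fun measurableSet_Ioi fun v hv => ?_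
    have hv0 : 0 ≤ v := hη.trans (le_of_lt hv)
    have hs0 : 0 ≤ Real.sinh v / √(Real.cosh v - Real.cosh η) := by
      have := Real.sinh_nonneg_iff.2 hv0
      positivity
    simp_rw [ENNReal.ofReal_mul hc0]
    rw [lintegral_const_mul _ (by fun_prop), lintegral_const_mul _ (by fun_prop),
      lintegral_Ioi_mul_exp_neg_sq hv0 hs, ← hc, ENNReal.ofReal_mul hc0, ENNReal.ofReal_mul hs0]
    ring
  rw [h1, lintegral_Ioi_swap hm]
  refine setLIntegral_congr_fun measurableSet_Ioi fun φ hφ => ?_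
  rw [lintegral_mul_const _ (by fun_prop), lintegral_sinh_div_sqrt_cosh_sub_right hη (le_of_lt hφ),
    mul_comm]
  congr 2
  rw [hc, sqrt_pi_mul_cube hs]
  field_simp

/-- A lower bound for the Bessel factor by a Gaussian: keep only `s ≤ u ≤ 2s` in the integral. -/
lemma exists_exp_neg_sq_le_gigIntegral {s : ℝ} (hs : 0 < s) : ∃ C, ∀ φ : ℝ,
    Real.exp (-φ ^ 2 / (2 * s)) ≤ C * gigIntegral 3 (φ ^ 2 + 1 ^ 2) := by
  set c : ℝ := s * (Real.exp (-(2 * s) / 8 - 1 / (2 * s)) / (2 * s) ^ 3) with hc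
  have hc0 : 0 < c := by positivity
  refine ⟨c⁻¹, fun φ => ?_⟩
  rw [← div_eq_inv_mul, le_div_iff₀ hc0]
  have hsub : Ioo s (2 * s) ⊆ Ioi 0 := fun u hu => hs.trans hu.1
  have hint := integrableOn_gigKernel 3 (a := φ ^ 2 + 1 ^ 2) (by positivity)
  calc Real.exp (-φ ^ 2 / (2 * s)) * c
      = ∫ _ in Ioo s (2 * s), Real.exp (-φ ^ 2 / (2 * s)) *
          (Real.exp (-(2 * s) / 8 - 1 / (2 * s)) / (2 * s) ^ 3) := by
        rw [setIntegral_const, measureReal_def, Real.volume_Ioo,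
          ENNReal.toReal_ofReal (by linarith), smul_eq_mul, hc]
        ring
    _ ≤ ∫ u in Ioo s (2 * s), gigKernel 3 (φ ^ 2 + 1 ^ 2) u := by
        refine setIntegral_mono_on (integrableOn_const (by simp)) (hint.mono_set hsub)
          measurableSet_Ioo fun u hu => ?_
        have hu0 : 0 < u := hs.trans hu.1
        unfold gigKernel
        rw [← mul_div_assoc, ← Real.exp_add]
        have h1 : 1 / (2 * u) ≤ 1 / (2 * s) := by
          apply one_div_le_one_div_of_le <;> linarith [hu.1]
        have h2 : φ ^ 2 / (2 * u) ≤ φ ^ 2 / (2 * s) :=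
          div_le_div_of_nonneg_left (by positivity) (by positivity) (by linarith [hu.1])
        have h3 := hu.2
        gcongr 2
        · have : (φ ^ 2 + 1 ^ 2) / (2 * u) = φ ^ 2 / (2 * u) + 1 / (2 * u) := by ring
          rw [this, neg_div (2 * s) (φ ^ 2)]
          linarith
    _ ≤ gigIntegral 3 (φ ^ 2 + 1 ^ 2) := by
        refine setIntegral_mono_set hint ?_ hsub.eventuallyLE
        filter_upwards [ae_restrict_mem measurableSet_Ioi] with u hu using (gigKernel_pos 3 _ hu).le

/-- By comparison with the integrand of `p_{J₂}(η, 1)`. -/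
lemma integrableOn_hypRadialIntegrand {η s : ℝ} (hη : 0 < η) (hs : 0 < s) : IntegrableOn
    (fun φ => φ * Real.exp (-φ ^ 2 / (2 * s)) / √(Real.cosh φ - Real.cosh η)) (Ioi η) := by
  obtain ⟨C, hC⟩ := exists_exp_neg_sq_le_gigIntegral hs
  refine ((integrableOn_pJ2Integrand hη one_pos).const_mul (C / 2)).mono'
    (Measurable.aestronglyMeasurable (by fun_prop)) ?_
  filter_upwards [ae_restrict_mem measurableSet_Ioi] with φ hφ
  have hφ0 : 0 < φ := hη.trans hφ
  rw [Real.norm_of_nonneg (by positivity), pJ2Integrand_eq one_pos]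
  calc φ * Real.exp (-φ ^ 2 / (2 * s)) / √(Real.cosh φ - Real.cosh η)
      = φ / √(Real.cosh φ - Real.cosh η) * Real.exp (-φ ^ 2 / (2 * s)) := by ring
    _ ≤ φ / √(Real.cosh φ - Real.cosh η) * (C * gigIntegral 3 (φ ^ 2 + 1 ^ 2)) := by
        gcongr; exact hC φ
    _ = _ := by ring

lemma ofReal_hypRadialDensity {η s : ℝ} (hη : 0 < η) (hs : 0 < s) :
    ENNReal.ofReal (hypRadialDensity η s) = ∫⁻ φ in Ioi η, ENNReal.ofReal
      (Real.exp (-s / 8) / √(Real.pi * s ^ 3) * (φ * Real.exp (-φ ^ 2 / (2 * s)))) *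
        ENNReal.ofReal (Real.sinh η / √(Real.cosh φ - Real.cosh η)) := by
  have h0 : 0 < Real.sinh η := Real.sinh_pos_iff.2 hη
  rw [hypRadialDensity, ← integral_const_mul, ofReal_integral_eq_lintegral_ofReal
    ((integrableOn_hypRadialIntegrand hη hs).const_mul _)]
  · refine setLIntegral_congr_fun measurableSet_Ioi fun φ hφ => ?_
    have hφ0 : 0 < φ := hη.trans hφ
    rw [← ENNReal.ofReal_mul (by positivity)]
    congr 1
    ring
  · filter_upwards [ae_restrict_mem measurableSet_Ioi] with φ hφ
    have hφ0 : 0 < φ := hη.trans hφ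
    simp only [Pi.zero_apply]
    positivity

/-- Integrating the radial density over `(η, ∞)` gives the tail. -/
lemma lintegral_hypRadialDensity {η s : ℝ} (hη : 0 ≤ η) (hs : 0 < s) :
    ∫⁻ ξ in Ioi η, ENNReal.ofReal (hypRadialDensity ξ s) = radialTail η s := by
  have hm : Measurable (Function.uncurry fun ξ φ : ℝ => ENNReal.ofReal
      (Real.exp (-s / 8) / √(Real.pi * s ^ 3) * (φ * Real.exp (-φ ^ 2 / (2 * s)))) *
        ENNReal.ofReal (Real.sinh ξ / √(Real.cosh φ - Real.cosh ξ))) := by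
    unfold Function.uncurry; fun_prop
  rw [radialTail_eq hη hs, setLIntegral_congr_fun measurableSet_Ioi
    (fun ξ hξ => ofReal_hypRadialDensity (hη.trans_lt hξ) hs), lintegral_Ioi_swap hm]
  refine setLIntegral_congr_fun measurableSet_Ioi fun φ hφ => ?_
  rw [lintegral_const_mul _ (by fun_prop), lintegral_sinh_div_sqrt_cosh_sub_left hη (le_of_lt hφ)]

lemma lintegral_eq_lintegral_Ioi_add_neg {f : ℝ → ℝ≥0∞} (hf : Measurable f) :
    ∫⁻ x, f x = ∫⁻ x in Ioi (0 : ℝ), (f x + f (-x)) := by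
  rw [lintegral_add_left hf]
  have h1 : ∫⁻ x in Ioi (0 : ℝ), f (-x) = ∫⁻ x in Iio (0 : ℝ), f x := by
    have := (Measure.measurePreserving_neg (volume : Measure ℝ)).setLIntegral_comp_preimage
      (s := Iio (0 : ℝ)) measurableSet_Iio hf
    rw [← this]
    congr 2
    ext x; simp
  rw [h1, add_comm, ← lintegral_add_compl f (measurableSet_Iio (a := (0 : ℝ))), compl_Iio,
    setLIntegral_congr Ioi_ae_eq_Ici]

/-- At `η = 0` the integrand is the sum of the densities of `N(s / 2, s)` at `v` and `-v`. -/
lemma radialTail_zero {s : ℝ} (hs : 0 < s) : radialTail 0 s = 1 := by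
  have hv : s.toNNReal ≠ 0 := (Real.toNNReal_pos.2 hs).ne'
  rw [← lintegral_gaussianPDF_eq_one (s / 2) hv,
    lintegral_eq_lintegral_Ioi_add_neg (measurable_gaussianPDF _ _)]
  refine setLIntegral_congr_fun measurableSet_Ioi fun v hv => ?_
  have hv0 : (0 : ℝ) < v := hv
  simp only [gaussianPDF]
  rw [← ENNReal.ofReal_add (gaussianPDFReal_nonneg _ _ _) (gaussianPDFReal_nonneg _ _ _)]
  congr 1
  have h1 : Real.sinh v / √(Real.cosh v - Real.cosh 0) = √2 * Real.cosh (v / 2) := by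
    have hsh : 0 < Real.sinh (v / 2) := Real.sinh_pos_iff.2 (by positivity)
    have e1 : Real.sinh v = 2 * Real.sinh (v / 2) * Real.cosh (v / 2) := by
      rw [← Real.sinh_two_mul]; ring_nf
    have e2 : Real.cosh v - Real.cosh 0 = 2 * Real.sinh (v / 2) ^ 2 := by
      have := Real.cosh_two_mul (v / 2)
      rw [Real.cosh_sq] at this
      rw [Real.cosh_zero]
      have e : 2 * (v / 2) = v := by ring
      rw [e] at this
      linarith
    rw [e1, e2, Real.sqrt_mul (by norm_num), Real.sqrt_sq hsh.le]
    have h2 : √2 * √2 = (2 : ℝ) := Real.mul_self_sqrt (by norm_num)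
    have h3 : 0 < √(2 : ℝ) := by positivity
    field_simp
    linarith
  rw [h1]
  unfold gaussianPDFReal
  rw [Real.coe_toNNReal s hs.le]
  have e1 : -(v - s / 2) ^ 2 / (2 * s) = -s / 8 + -v ^ 2 / (2 * s) + v / 2 := by
    field_simp; ring
  have e2 : -(-v - s / 2) ^ 2 / (2 * s) = -s / 8 + -v ^ 2 / (2 * s) + -(v / 2) := by
    field_simp; ring
  have e3 : √(2 * Real.pi * s) = √2 * √(Real.pi * s) := by
    rw [mul_assoc, Real.sqrt_mul (by norm_num)]
  have h2 : √2 * √2 = (2 : ℝ) := Real.mul_self_sqrt (by norm_num)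
  have h3 : 0 < √(2 : ℝ) := by positivity
  have h4 : 0 < √(Real.pi * s) := by positivity
  simp only [e1, e2, e3, Real.exp_add, Real.cosh_eq]
  generalize Real.exp (-s / 8) = E
  generalize Real.exp (-v ^ 2 / (2 * s)) = G
  field_simp
  linear_combination (E * G) * h2

lemma radialTail_le_one {η s : ℝ} (hη : 0 ≤ η) (hs : 0 < s) : radialTail η s ≤ 1 := by
  rw [← radialTail_zero hs, ← lintegral_hypRadialDensity hη hs,
    ← lintegral_hypRadialDensity le_rfl hs]
  exact lintegral_mono_set (Ioi_subset_Ioi hη)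

/-! ### Subordination, total mass and initial condition -/

lemma firstPassageDensity_nonneg {s t : ℝ} (ht : 0 ≤ t) : 0 ≤ firstPassageDensity s t := by
  unfold firstPassageDensity; positivity

lemma measurable_firstPassageDensity (t : ℝ) : Measurable fun s => firstPassageDensity s t := by
  unfold firstPassageDensity; fun_prop

/-- The substitution `s = t² / x²`: under the density `g(·, t)`, the time `s` is distributed as
`t² / N²` with `N` standard normal. -/
lemma lintegral_firstPassageDensity_mul {t : ℝ} (ht : 0 < t) (f : ℝ → ℝ≥0∞) :
    ∫⁻ s in Ioi 0, ENNReal.ofReal (firstPassageDensity s t) * f s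
      = ∫⁻ x in Ioi 0, 2 * gaussianPDF 0 1 x * f (t ^ 2 / x ^ 2) := by
  have himg : (fun x : ℝ => t ^ 2 / x ^ 2) '' Ioi 0 = Ioi 0 := by
    ext s; constructor
    · rintro ⟨x, hx, rfl⟩
      have hx' : (0 : ℝ) < x := hx
      exact mem_Ioi.2 (by positivity)
    · intro hs
      have hs' : (0 : ℝ) < s := hs
      refine ⟨t / √s, mem_Ioi.2 (by positivity), ?_⟩
      simp only
      rw [div_pow, Real.sq_sqrt hs'.le]
      field_simp
  have hd : ∀ x ∈ Ioi (0 : ℝ), HasDerivWithinAt (fun x : ℝ => t ^ 2 / x ^ 2)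
      (-(2 * t ^ 2 / x ^ 3)) (Ioi 0) x := fun x hx => by
    have hx' : (0 : ℝ) < x := hx
    have h := ((hasDerivAt_pow 2 x).inv (by positivity)).const_mul (t ^ 2)
    refine (h.congr_deriv ?_).hasDerivWithinAt
    simp
    field_simp
  have hinj : InjOn (fun x : ℝ => t ^ 2 / x ^ 2) (Ioi 0) := by
    intro x hx y hy h
    have hx' : (0 : ℝ) < x := hx
    have hy' : (0 : ℝ) < y := hy
    simp only at h
    rw [div_eq_div_iff (by positivity) (by positivity)] at h
    exact ((pow_left_inj₀ hy'.le hx'.le two_ne_zero).1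
      (mul_left_cancel₀ (by positivity : t ^ 2 ≠ 0) h)).symm
  rw [← himg, lintegral_image_eq_lintegral_abs_deriv_mul measurableSet_Ioi hd hinj, himg]
  refine setLIntegral_congr_fun measurableSet_Ioi fun x hx => ?_
  have hx' : (0 : ℝ) < x := hx
  have h2 : (2 : ℝ≥0∞) = ENNReal.ofReal 2 := by simp
  rw [← mul_assoc, gaussianPDF, h2, ← ENNReal.ofReal_mul (abs_nonneg _),
    ← ENNReal.ofReal_mul (by norm_num)]
  congr 2
  rw [abs_neg, abs_of_pos (by positivity), firstPassageDensity, gaussianPDFReal]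
  have e1 : √(2 * Real.pi * (t ^ 2 / x ^ 2) ^ 3) = √(2 * Real.pi) * (t / x) ^ 3 := by
    rw [Real.sqrt_mul (by positivity)]
    congr 1
    rw [← div_pow, ← pow_mul, mul_comm 2 3, pow_mul, Real.sqrt_sq (by positivity)]
  have e2 : -t ^ 2 / (2 * (t ^ 2 / x ^ 2)) = -(x - 0) ^ 2 / (2 * ((1 : ℝ≥0) : ℝ)) := by
    simp; field_simp
  rw [e1, e2]
  simp only [NNReal.coe_one, mul_one]
  have h3 : 0 < √(2 * Real.pi) := by positivity
  field_simp

lemma lintegral_Ioi_two_mul_gaussianPDF {v : ℝ≥0} (hv : v ≠ 0) :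
    ∫⁻ x in Ioi 0, 2 * gaussianPDF 0 v x = 1 := by
  rw [← lintegral_gaussianPDF_eq_one 0 hv,
    lintegral_eq_lintegral_Ioi_add_neg (measurable_gaussianPDF _ _)]
  refine lintegral_congr fun x => ?_
  simp only [gaussianPDF, gaussianPDFReal, sub_zero, neg_sq]
  rw [two_mul]

lemma lintegral_firstPassageDensity {t : ℝ} (ht : 0 < t) :
    ∫⁻ s in Ioi 0, ENNReal.ofReal (firstPassageDensity s t) = 1 := by
  have := lintegral_firstPassageDensity_mul ht 1
  simp only [Pi.one_apply, mul_one] at this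
  rw [this, lintegral_Ioi_two_mul_gaussianPDF one_ne_zero]

lemma pJ2_nonneg {η t : ℝ} (hη : 0 < η) (ht : 0 < t) : 0 ≤ pJ2 η t := by
  have h0 : 0 < Real.sinh η := Real.sinh_pos_iff.2 hη
  refine mul_nonneg (by positivity) (setIntegral_nonneg measurableSet_Ioi fun φ hφ => ?_)
  have hφ0 : 0 < φ := hη.trans hφ
  rw [pJ2Integrand_eq ht]
  have := gigIntegral_nonneg 3 (φ ^ 2 + t ^ 2)
  positivity

lemma hypRadialDensity_nonneg {η s : ℝ} (hη : 0 < η) (hs : 0 < s) : 0 ≤ hypRadialDensity η s := by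
  have h0 : 0 < Real.sinh η := Real.sinh_pos_iff.2 hη
  refine mul_nonneg (by positivity) (setIntegral_nonneg measurableSet_Ioi fun φ hφ => ?_)
  have hφ0 : 0 < φ := hη.trans hφ
  positivity

lemma measurable_hypRadialDensity : Measurable (Function.uncurry hypRadialDensity) := by
  have h : StronglyMeasurable (Function.uncurry fun (p : ℝ × ℝ) (φ : ℝ) =>
      (Ioi p.1).indicator (fun φ => φ * Real.exp (-φ ^ 2 / (2 * p.2))
        / √(Real.cosh φ - Real.cosh p.1)) φ) := by
    refine Measurable.stronglyMeasurable ?_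
    refine Measurable.ite (p := fun q : (ℝ × ℝ) × ℝ => q.2 ∈ Ioi q.1.1) ?_ (by fun_prop)
      measurable_const
    exact measurableSet_lt (measurable_fst.comp measurable_fst) measurable_snd
  have h2 := (h.integral_prod_right (ν := volume)).measurable
  simp_rw [integral_indicator measurableSet_Ioi] at h2
  unfold hypRadialDensity Function.uncurry
  exact Measurable.mul (by fun_prop) h2

/-- Subordination: the density of the stopped radial part is the mixture of the densities
`p₂(·, s)` by the first passage density. -/
lemma lintegral_hypRadialDensity_mul_firstPassageDensity {η t : ℝ} (hη : 0 < η) (ht : 0 < t) :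
    ∫⁻ s in Ioi 0, ENNReal.ofReal (hypRadialDensity η s * firstPassageDensity s t)
      = ENNReal.ofReal (pJ2 η t) := by
  have hsh : 0 < Real.sinh η := Real.sinh_pos_iff.2 hη
  set c : ℝ := t * Real.sinh η / (√2 * Real.pi) with hc
  have hc0 : 0 ≤ c := by positivity
  have h1 : ∀ s ∈ Ioi (0 : ℝ), ENNReal.ofReal (hypRadialDensity η s * firstPassageDensity s t)
      = ∫⁻ φ in Ioi η, ENNReal.ofReal (c * (φ / √(Real.cosh φ - Real.cosh η))) *
        ENNReal.ofReal (gigKernel 3 (φ ^ 2 + t ^ 2) s) := by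
    intro s hs
    have hs' : (0 : ℝ) < s := hs
    rw [ENNReal.ofReal_mul (hypRadialDensity_nonneg hη hs), ofReal_hypRadialDensity hη hs,
      ← lintegral_mul_const _ (by fun_prop)]
    refine setLIntegral_congr_fun measurableSet_Ioi fun φ hφ => ?_
    have hφ0 : 0 < φ := hη.trans hφ
    have hlt : Real.cosh η < Real.cosh φ :=
      Real.cosh_lt_cosh.2 (by rw [abs_of_pos hη, abs_of_pos hφ0]; exact hφ)
    have hq : 0 < √(Real.cosh φ - Real.cosh η) := Real.sqrt_pos.2 (sub_pos.2 hlt)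
    rw [← ENNReal.ofReal_mul (by positivity), ← ENNReal.ofReal_mul (by positivity),
      ← ENNReal.ofReal_mul (by positivity)]
    congr 1
    have e1 : √(Real.pi * s ^ 3) * √(2 * Real.pi * s ^ 3) = √2 * (Real.pi * s ^ 3) := by
      have : √(2 * Real.pi * s ^ 3) = √2 * √(Real.pi * s ^ 3) := by
        rw [mul_assoc 2, Real.sqrt_mul (by norm_num)]
      rw [this, mul_left_comm, Real.mul_self_sqrt (by positivity)]
    have e2 : Real.exp (-s / 8) * Real.exp (-φ ^ 2 / (2 * s)) * Real.exp (-t ^ 2 / (2 * s))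
        = Real.exp (-s / 8 - (φ ^ 2 + t ^ 2) / (2 * s)) := by
      rw [← Real.exp_add, ← Real.exp_add]; ring_nf
    unfold firstPassageDensity gigKernel
    rw [← e2, hc]
    calc _ = Real.exp (-s / 8) * Real.exp (-φ ^ 2 / (2 * s)) * Real.exp (-t ^ 2 / (2 * s)) * φ * t
            * Real.sinh η / √(Real.cosh φ - Real.cosh η)
            / (√(Real.pi * s ^ 3) * √(2 * Real.pi * s ^ 3)) := by ring
      _ = _ := by
        rw [e1]
        have := Real.pi_pos
        have h2 : 0 < √(2 : ℝ) := by positivity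
        field_simp
  rw [setLIntegral_congr_fun measurableSet_Ioi h1, lintegral_lintegral_swap]
  · have h2 : ∀ φ ∈ Ioi η, ∫⁻ s in Ioi 0, ENNReal.ofReal (c * (φ / √(Real.cosh φ - Real.cosh η))) *
        ENNReal.ofReal (gigKernel 3 (φ ^ 2 + t ^ 2) s)
        = ENNReal.ofReal (c / 2 * pJ2Integrand η t φ) := by
      intro φ hφ
      have hφ0 : 0 < φ := hη.trans hφ
      rw [lintegral_const_mul _ (measurable_gigKernel _ _).ennreal_ofReal,
        ← ofReal_integral_eq_lintegral_ofReal (integrableOn_gigKernel 3 (by positivity)),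
        ← ENNReal.ofReal_mul (by positivity)]
      · congr 1
        rw [pJ2Integrand_eq ht, gigIntegral]
        ring
      · filter_upwards [ae_restrict_mem measurableSet_Ioi] with s hs
          using (gigKernel_pos 3 _ hs).le
    rw [setLIntegral_congr_fun measurableSet_Ioi h2, ← ofReal_integral_eq_lintegral_ofReal
      ((integrableOn_pJ2Integrand hη ht).const_mul _)]
    · congr 1
      have h8 : √(2 ^ 3) = 2 * √2 := by
        rw [show (2 : ℝ) ^ 3 = 2 ^ 2 * 2 by norm_num, Real.sqrt_mul (by positivity),
          Real.sqrt_sq (by norm_num)]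
      rw [integral_const_mul, pJ2, hc, h8]
      field_simp
    · filter_upwards [ae_restrict_mem measurableSet_Ioi] with φ hφ
      have hφ0 : 0 < φ := hη.trans hφ
      have := gigIntegral_nonneg 3 (φ ^ 2 + t ^ 2)
      rw [Pi.zero_apply, pJ2Integrand_eq ht]
      positivity
  · refine Measurable.aemeasurable ?_
    unfold Function.uncurry gigKernel
    fun_prop

lemma aestronglyMeasurable_hypRadialDensity_mul (η t : ℝ) (μ : Measure ℝ) :
    AEStronglyMeasurable (fun s => hypRadialDensity η s * firstPassageDensity s t) μ :=
  ((measurable_hypRadialDensity.comp (measurable_const.prodMk measurable_id)).mul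
    (measurable_firstPassageDensity t)).aestronglyMeasurable

lemma hypRadialDensity_mul_nonneg_ae {η t : ℝ} (hη : 0 < η) (ht : 0 < t) :
    0 ≤ᵐ[volume.restrict (Ioi 0)] fun s => hypRadialDensity η s * firstPassageDensity s t := by
  filter_upwards [ae_restrict_mem measurableSet_Ioi] with s hs
  exact mul_nonneg (hypRadialDensity_nonneg hη hs) (firstPassageDensity_nonneg ht.le)

lemma integrableOn_hypRadialDensity_mul {η t : ℝ} (hη : 0 < η) (ht : 0 < t) :
    IntegrableOn (fun s => hypRadialDensity η s * firstPassageDensity s t) (Ioi 0) := by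
  refine ⟨aestronglyMeasurable_hypRadialDensity_mul η t _, ?_⟩
  rw [hasFiniteIntegral_iff_ofReal (hypRadialDensity_mul_nonneg_ae hη ht),
    lintegral_hypRadialDensity_mul_firstPassageDensity hη ht]
  exact ENNReal.ofReal_lt_top

lemma pJ2_eq_integral {η t : ℝ} (hη : 0 < η) (ht : 0 < t) :
    pJ2 η t = ∫ s in Ioi (0 : ℝ), hypRadialDensity η s * firstPassageDensity s t := by
  rw [integral_eq_lintegral_of_nonneg_ae (hypRadialDensity_mul_nonneg_ae hη ht)
    (aestronglyMeasurable_hypRadialDensity_mul η t _),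
    lintegral_hypRadialDensity_mul_firstPassageDensity hη ht,
    ENNReal.toReal_ofReal (pJ2_nonneg hη ht)]

/-- The tail of `p_{J₂}(·, t)` is the mixture of the tails of the radial laws. -/
lemma lintegral_pJ2 {a t : ℝ} (ha : 0 ≤ a) (ht : 0 < t) :
    ∫⁻ η in Ioi a, ENNReal.ofReal (pJ2 η t)
      = ∫⁻ s in Ioi 0, ENNReal.ofReal (firstPassageDensity s t) * radialTail a s := by
  have h1 : ∀ η ∈ Ioi a, ENNReal.ofReal (pJ2 η t) = ∫⁻ s in Ioi 0,
      ENNReal.ofReal (firstPassageDensity s t) * ENNReal.ofReal (hypRadialDensity η s) := by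
    intro η hη
    have hη0 : 0 < η := ha.trans_lt hη
    rw [← lintegral_hypRadialDensity_mul_firstPassageDensity hη0 ht]
    refine setLIntegral_congr_fun measurableSet_Ioi fun s hs => ?_
    rw [ENNReal.ofReal_mul (hypRadialDensity_nonneg hη0 hs), mul_comm]
  rw [setLIntegral_congr_fun measurableSet_Ioi h1, lintegral_lintegral_swap]
  · refine setLIntegral_congr_fun measurableSet_Ioi fun s hs => ?_
    have hm : Measurable fun η => ENNReal.ofReal (hypRadialDensity η s) :=
      (measurable_hypRadialDensity.comp (measurable_id.prodMk measurable_const)).ennreal_ofReal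
    rw [lintegral_const_mul _ hm, lintegral_hypRadialDensity ha hs]
  · exact (((measurable_firstPassageDensity t).comp measurable_snd).ennreal_ofReal.mul
      measurable_hypRadialDensity.ennreal_ofReal).aemeasurable

lemma lintegral_pJ2_eq_one {t : ℝ} (ht : 0 < t) :
    ∫⁻ η in Ioi 0, ENNReal.ofReal (pJ2 η t) = 1 := by
  rw [lintegral_pJ2 le_rfl ht, ← lintegral_firstPassageDensity ht]
  refine setLIntegral_congr_fun measurableSet_Ioi fun s hs => ?_
  rw [radialTail_zero hs, mul_one]

lemma pJ2_nonneg_ae {t : ℝ} (ht : 0 < t) : 0 ≤ᵐ[volume.restrict (Ioi 0)] fun η => pJ2 η t := by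
  filter_upwards [ae_restrict_mem measurableSet_Ioi] with η hη using pJ2_nonneg hη ht

lemma aestronglyMeasurable_pJ2 {t : ℝ} (ht : 0 < t) :
    AEStronglyMeasurable (fun η => pJ2 η t) (volume.restrict (Ioi 0)) :=
  (contDiffOn_pJ2_space ht).continuousOn.aestronglyMeasurable measurableSet_Ioi

lemma integrableOn_pJ2 {t : ℝ} (ht : 0 < t) : IntegrableOn (fun η => pJ2 η t) (Ioi 0) := by
  refine ⟨aestronglyMeasurable_pJ2 ht, ?_⟩
  rw [hasFiniteIntegral_iff_ofReal (pJ2_nonneg_ae ht), lintegral_pJ2_eq_one ht]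
  exact ENNReal.one_lt_top

lemma integral_pJ2 {t : ℝ} (ht : 0 < t) : ∫ η in Ioi (0 : ℝ), pJ2 η t = 1 := by
  rw [integral_eq_lintegral_of_nonneg_ae (pJ2_nonneg_ae ht) (aestronglyMeasurable_pJ2 ht),
    lintegral_pJ2_eq_one ht, ENNReal.toReal_one]

lemma measurable_radialTail (η : ℝ) : Measurable (radialTail η) := by
  unfold radialTail
  refine Measurable.lintegral_prod_right' (f := fun p : ℝ × ℝ => ENNReal.ofReal
    (Real.exp (-p.1 / 8) / √(Real.pi * p.1) * (Real.sinh p.2 / √(Real.cosh p.2 - Real.cosh η) *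
      Real.exp (-p.2 ^ 2 / (2 * p.1))))) ?_
  fun_prop

/-- For `s ≤ 1` the tail beyond `δ` is `O(√s)`, by comparison with its value `≤ 1` at time `2`. -/
lemma radialTail_le_sqrt {δ s : ℝ} (hδ : 0 < δ) (hs : 0 < s) (hs1 : s ≤ 1) :
    radialTail δ s ≤ ENNReal.ofReal (√2 * Real.exp (1 / 4) * (4 / δ ^ 2) * √s) := by
  have h2 := radialTail_le_one hδ.le (s := 2) two_pos
  set A : ℝ := √2 * Real.exp (1 / 4) * (4 / δ ^ 2) * √s with hA
  have hA0 : 0 ≤ A := by positivity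
  calc radialTail δ s ≤ ∫⁻ v in Ioi δ, ENNReal.ofReal A * ENNReal.ofReal
        (Real.exp (-2 / 8) / √(Real.pi * 2) * (Real.sinh v / √(Real.cosh v - Real.cosh δ) *
          Real.exp (-v ^ 2 / (2 * 2)))) := by
        refine setLIntegral_mono' measurableSet_Ioi fun v hv => ?_
        have hv0 : 0 < v := hδ.trans hv
        have hsh : 0 < Real.sinh v := Real.sinh_pos_iff.2 hv0
        rw [← ENNReal.ofReal_mul hA0]
        refine ENNReal.ofReal_le_ofReal ?_
        have e1 : Real.exp (-v ^ 2 / (2 * s)) ≤ (4 / δ ^ 2 * s) * Real.exp (-v ^ 2 / (2 * 2)) := by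
          have h3 : δ ^ 2 / (4 * s) + 1 ≤ Real.exp (δ ^ 2 / (4 * s)) := Real.add_one_le_exp _
          have h4 : Real.exp (-(δ ^ 2 / (4 * s))) ≤ 4 / δ ^ 2 * s := by
            rw [Real.exp_neg, inv_le_comm₀ (Real.exp_pos _) (by positivity)]
            have : (4 / δ ^ 2 * s)⁻¹ = δ ^ 2 / (4 * s) := by field_simp
            linarith
          have h5 : -v ^ 2 / (2 * s) ≤ -(δ ^ 2 / (4 * s)) + -v ^ 2 / (2 * 2) := by
            have hv2 : δ ^ 2 ≤ v ^ 2 := by gcongr; exact le_of_lt hv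
            have h6 : δ ^ 2 / (4 * s) ≤ v ^ 2 / (4 * s) := by gcongr
            have h7 : v ^ 2 / (2 * 2) ≤ v ^ 2 / (4 * s) :=
              div_le_div_of_nonneg_left (by positivity) (by positivity) (by linarith)
            have h8 : -v ^ 2 / (2 * s) = -(v ^ 2 / (4 * s)) - v ^ 2 / (4 * s) := by
              field_simp; ring
            rw [h8, neg_div]
            linarith
          calc Real.exp (-v ^ 2 / (2 * s)) ≤ _ := Real.exp_le_exp.2 h5
            _ = Real.exp (-(δ ^ 2 / (4 * s))) * Real.exp (-v ^ 2 / (2 * 2)) := Real.exp_add _ _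
            _ ≤ _ := by gcongr
        have e2 : Real.exp (-s / 8) ≤ 1 := Real.exp_le_one_iff.2 (by linarith)
        calc Real.exp (-s / 8) / √(Real.pi * s) * (Real.sinh v / √(Real.cosh v - Real.cosh δ) *
              Real.exp (-v ^ 2 / (2 * s)))
            ≤ 1 / √(Real.pi * s) * (Real.sinh v / √(Real.cosh v - Real.cosh δ) *
              ((4 / δ ^ 2 * s) * Real.exp (-v ^ 2 / (2 * 2)))) := by gcongr
          _ = _ := by
            rw [hA, Real.sqrt_mul Real.pi_pos.le, Real.sqrt_mul Real.pi_pos.le]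
            have e3 : Real.exp (1 / 4) * Real.exp (-2 / 8) = 1 := by
              rw [← Real.exp_add]; norm_num
            have e4 : √s * √s = s := Real.mul_self_sqrt hs.le
            have p1 : 0 < √s := Real.sqrt_pos.2 hs
            have p2 : 0 < √Real.pi := Real.sqrt_pos.2 Real.pi_pos
            have p3 : 0 < √(2 : ℝ) := by positivity
            generalize Real.sinh v / √(Real.cosh v - Real.cosh δ) = Z
            generalize Real.exp (-v ^ 2 / (2 * 2)) = G
            have : √2 * Real.exp (1 / 4) * (4 / δ ^ 2) * √s *
                (Real.exp (-2 / 8) / (√Real.pi * √2) * (Z * G))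
                = (Real.exp (1 / 4) * Real.exp (-2 / 8)) * (4 / δ ^ 2) * √s / √Real.pi *
                  (Z * G) := by
              field_simp
            rw [this, e3]
            field_simp
            linear_combination (-(Z * G)) * e4
    _ = ENNReal.ofReal A * radialTail δ 2 := by
        rw [lintegral_const_mul _ (by fun_prop)]; rfl
    _ ≤ ENNReal.ofReal A := mul_le_of_le_one_right zero_le h2

lemma tendsto_radialTail {δ : ℝ} (hδ : 0 < δ) :
    Tendsto (radialTail δ) (𝓝[>] 0) (𝓝 0) := by
  have h : Tendsto (fun s : ℝ => ENNReal.ofReal (√2 * Real.exp (1 / 4) * (4 / δ ^ 2) * √s))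
      (𝓝[>] 0) (𝓝 0) := by
    have hc : Continuous fun s : ℝ =>
        ENNReal.ofReal (√2 * Real.exp (1 / 4) * (4 / δ ^ 2) * √s) := by
      refine ENNReal.continuous_ofReal.comp ?_
      fun_prop
    simpa using (hc.tendsto 0).mono_left nhdsWithin_le_nhds
  refine tendsto_of_tendsto_of_tendsto_of_le_of_le' tendsto_const_nhds h
    (Eventually.of_forall fun _ => zero_le) ?_
  filter_upwards [Ioc_mem_nhdsGT one_pos] with s hs using radialTail_le_sqrt hδ hs.1 hs.2

/-- The mass of `p_{J₂}(·, t)` beyond any `δ > 0` vanishes as `t → 0`: it is the mean of the tail at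
the time `t² / N²`, `N` standard normal, and dominated convergence applies. -/
lemma tendsto_lintegral_pJ2_tail {δ : ℝ} (hδ : 0 < δ) :
    Tendsto (fun t => ∫⁻ η in Ioi δ, ENNReal.ofReal (pJ2 η t)) (𝓝[>] 0) (𝓝 0) := by
  have heq : (fun t => ∫⁻ x in Ioi (0 : ℝ), 2 * gaussianPDF 0 1 x * radialTail δ (t ^ 2 / x ^ 2))
      =ᶠ[𝓝[>] 0] fun t => ∫⁻ η in Ioi δ, ENNReal.ofReal (pJ2 η t) := by
    filter_upwards [self_mem_nhdsWithin] with t ht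
    rw [lintegral_pJ2 hδ.le ht, lintegral_firstPassageDensity_mul ht]
  refine Tendsto.congr' heq ?_
  have h := tendsto_lintegral_filter_of_dominated_convergence (μ := volume.restrict (Ioi (0 : ℝ)))
    (l := 𝓝[>] (0 : ℝ))
    (F := fun t x => 2 * gaussianPDF 0 1 x * radialTail δ (t ^ 2 / x ^ 2)) (f := fun _ => 0)
    (fun x => 2 * gaussianPDF 0 1 x) ?_ ?_ ?_ ?_
  · simpa using h
  · refine Eventually.of_forall fun t => ?_
    exact ((measurable_gaussianPDF 0 1).const_mul 2).mul
      ((measurable_radialTail δ).comp (by fun_prop))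
  · filter_upwards [self_mem_nhdsWithin] with t ht
    filter_upwards [ae_restrict_mem measurableSet_Ioi] with x hx
    have hx' : (0 : ℝ) < x := hx
    have ht' : (0 : ℝ) < t := ht
    exact mul_le_of_le_one_right zero_le (radialTail_le_one hδ.le (by positivity))
  · rw [lintegral_Ioi_two_mul_gaussianPDF one_ne_zero]; exact ENNReal.one_ne_top
  · filter_upwards [ae_restrict_mem measurableSet_Ioi] with x hx
    have hx' : (0 : ℝ) < x := hx
    have h1 : Tendsto (fun t : ℝ => t ^ 2 / x ^ 2) (𝓝[>] 0) (𝓝[>] 0) := by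
      refine tendsto_nhdsWithin_iff.2 ⟨?_, ?_⟩
      · have : Continuous fun t : ℝ => t ^ 2 / x ^ 2 := by fun_prop
        simpa using (this.tendsto 0).mono_left nhdsWithin_le_nhds
      · filter_upwards [self_mem_nhdsWithin] with t ht
        have ht' : (0 : ℝ) < t := ht
        exact mem_Ioi.2 (by positivity)
    have h2 := ENNReal.Tendsto.const_mul (a := 2 * gaussianPDF 0 1 x)
      ((tendsto_radialTail hδ).comp h1) (Or.inr ?_)
    · simpa using h2
    · exact ENNReal.mul_ne_top (by simp) (by simp [gaussianPDF])

/-- The densities `p_{J₂}(·, t)` have mass one and concentrate at `0`. -/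
lemma tendsto_integral_mul_pJ2 (f : ℝ →ᵇ ℝ) :
    Tendsto (fun t => ∫ η in Ioi (0 : ℝ), f η * pJ2 η t) (𝓝[>] 0) (𝓝 (f 0)) := by
  rw [Metric.tendsto_nhds]
  intro ε hε
  obtain ⟨δ, hδ, hfδ⟩ := Metric.continuousAt_iff.1 f.continuous.continuousAt (ε / 2) (half_pos hε)
  have hC : 0 < 2 * ‖f‖ + 1 := by positivity
  have htail := (tendsto_lintegral_pJ2_tail (half_pos hδ)).eventually
    (Iio_mem_nhds (ENNReal.ofReal_pos.2 (by positivity : 0 < ε / (2 * (2 * ‖f‖ + 1)))))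
  filter_upwards [htail, self_mem_nhdsWithin] with t htl ht
  have hi := integrableOn_pJ2 ht
  have hif : IntegrableOn (fun η => f η * pJ2 η t) (Ioi 0) :=
    hi.bdd_mul f.continuous.aestronglyMeasurable (Eventually.of_forall f.norm_coe_le_norm)
  have hm : ∫ η in Ioi (δ / 2), pJ2 η t < ε / (2 * (2 * ‖f‖ + 1)) := by
    have hnn : 0 ≤ᵐ[volume.restrict (Ioi (δ / 2))] fun η => pJ2 η t := by
      filter_upwards [ae_restrict_mem measurableSet_Ioi] with η hη
        using pJ2_nonneg ((half_pos hδ).trans hη) ht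
    rw [integral_eq_lintegral_of_nonneg_ae hnn (hi.mono_set
      (Ioi_subset_Ioi (half_pos hδ).le)).aestronglyMeasurable]
    exact ENNReal.toReal_lt_of_lt_ofReal htl
  have hid : IntegrableOn (fun η => ε / 2 * pJ2 η t) (Ioi 0) := hi.const_mul _
  have hic : IntegrableOn ((Ioi (δ / 2)).indicator fun η => 2 * ‖f‖ * pJ2 η t) (Ioi 0) :=
    (hi.const_mul _).indicator measurableSet_Ioi
  rw [Real.dist_eq]
  have e1 : (∫ η in Ioi (0 : ℝ), f η * pJ2 η t) - f 0
      = ∫ η in Ioi (0 : ℝ), (f η - f 0) * pJ2 η t := by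
    simp_rw [sub_mul]
    rw [integral_sub hif (hi.const_mul _), integral_const_mul, integral_pJ2 ht, mul_one]
  have e2 : ∫ η in Ioi (0 : ℝ), (Ioi (δ / 2)).indicator (fun η => 2 * ‖f‖ * pJ2 η t) η
      = 2 * ‖f‖ * ∫ η in Ioi (δ / 2), pJ2 η t := by
    rw [setIntegral_indicator measurableSet_Ioi, Ioi_inter_Ioi, sup_of_le_right (half_pos hδ).le,
      integral_const_mul]
  rw [e1]
  calc |∫ η in Ioi (0 : ℝ), (f η - f 0) * pJ2 η t|
      ≤ ∫ η in Ioi (0 : ℝ), |(f η - f 0) * pJ2 η t| := abs_integral_le_integral_abs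
    _ ≤ ∫ η in Ioi (0 : ℝ), (ε / 2 * pJ2 η t
          + (Ioi (δ / 2)).indicator (fun η => 2 * ‖f‖ * pJ2 η t) η) := by
        refine setIntegral_mono_on ?_ (hid.add hic) measurableSet_Ioi fun η hη => ?_
        · simp_rw [sub_mul]
          exact (hif.sub (hi.const_mul _)).abs
        · have hp := pJ2_nonneg hη ht
          have hη' : (0 : ℝ) < η := hη
          rw [abs_mul, abs_of_nonneg hp]
          by_cases h : δ / 2 < η
          · rw [indicator_of_mem (mem_Ioi.2 h)]
            have h1 : |f η - f 0| ≤ 2 * ‖f‖ := f.dist_le_two_norm η 0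
            have : |f η - f 0| * pJ2 η t ≤ 2 * ‖f‖ * pJ2 η t := by gcongr
            have h3 : 0 ≤ ε / 2 * pJ2 η t := by positivity
            linarith
          · rw [indicator_of_notMem (by simpa using h), add_zero]
            have hd : dist η 0 < δ := by
              rw [Real.dist_eq, sub_zero, abs_of_pos hη']; linarith
            have h1 := hfδ hd
            rw [Real.dist_eq] at h1
            gcongr
    _ = ε / 2 + 2 * ‖f‖ * ∫ η in Ioi (δ / 2), pJ2 η t := by
        rw [integral_add hid hic, integral_const_mul, integral_pJ2 ht, mul_one, e2]
    _ < ε := by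
        have h0 : 2 * ‖f‖ * ∫ η in Ioi (δ / 2), pJ2 η t
            ≤ 2 * ‖f‖ * (ε / (2 * (2 * ‖f‖ + 1))) := by gcongr
        have h1 : 2 * ‖f‖ * (ε / (2 * (2 * ‖f‖ + 1))) < ε / 2 := by
          rw [← mul_div_assoc, div_lt_div_iff₀ (by positivity) two_pos]
          nlinarith
        linarith

/-! ### The reflection principle -/

section

lemma tendsto_measure_of_ae_eventually_mem_iff {Ω : Type*} [MeasurableSpace Ω] {P : Measure Ω}
    [IsFiniteMeasure P] {A : ℕ → Set Ω} {A' : Set Ω} (hA : ∀ n, NullMeasurableSet (A n) P)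
    (h : ∀ᵐ ω ∂P, ∀ᶠ n in atTop, ω ∈ A n ↔ ω ∈ A') :
    Tendsto (fun n => P (A n)) atTop (𝓝 (P A')) := by
  have hA' : NullMeasurableSet A' P := nullMeasurableSet_of_tendsto_indicator atTop hA h
  obtain ⟨C', hC', hCA'⟩ := hA'
  choose C hC hCA using hA
  rw [measure_congr hCA']
  simp_rw [fun n => measure_congr (hCA n)]
  refine tendsto_measure_of_ae_tendsto_indicator_of_isFiniteMeasure atTop hC' hC ?_
  filter_upwards [h, ae_all_iff.2 hCA, hCA'] with ω h1 h2 h3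
  filter_upwards [h1] with n hn
  have e2 : (ω ∈ A n) = (ω ∈ C n) := h2 n
  have e3 : (ω ∈ A') = (ω ∈ C') := h3
  rw [← e2, ← e3]
  exact hn

/-- The `k`-th point of the regular grid with `n` steps on `[0, N]`. -/
noncomputable def gridPoint (N : ℝ≥0) (n k : ℕ) : ℝ≥0 := N * (k / n)

lemma gridPoint_mono (N : ℝ≥0) (n : ℕ) : Monotone (gridPoint N n) := fun j k h => by
  unfold gridPoint; gcongr

lemma gridPoint_lt {N : ℝ≥0} (hN : 0 < N) {n k : ℕ} (h : k < n) : gridPoint N n k < N := by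
  have hn : (0 : ℝ≥0) < n := by exact_mod_cast (Nat.zero_le k).trans_lt h
  have : (k : ℝ≥0) / n < 1 := (div_lt_one hn).2 (by exact_mod_cast h)
  calc gridPoint N n k < N * 1 := by unfold gridPoint; gcongr
    _ = N := mul_one N

lemma gridPoint_succ_le (N : ℝ≥0) (n k : ℕ) : gridPoint N n (k + 1) = gridPoint N n k + N / n := by
  unfold gridPoint; push_cast; rw [add_div, mul_add, mul_one_div]

/-- `k` is the first grid index at which the path `b` exceeds the level `t`. -/
def IsFirstAbove (N : ℝ≥0) (t : ℝ) (n k : ℕ) (b : ℝ≥0 → ℝ) : Prop :=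
  (∀ j < k, b (gridPoint N n j) ≤ t) ∧ t < b (gridPoint N n k)

lemma exists_gridPoint_mem {N : ℝ≥0} (hN : 0 < N) {U : Set ℝ≥0} (hU : IsOpen U) {s : ℝ≥0}
    (hs : s ∈ U) (hsN : s < N) : ∀ᶠ n : ℕ in atTop, ∃ k < n, gridPoint N n k ∈ U := by
  have hNr : (0 : ℝ) < N := hN
  have h1 : Tendsto (fun n : ℕ => (N : ℝ) * ((⌊(s / N : ℝ) * n⌋₊ : ℝ) / n)) atTop
      (𝓝 (N * (s / N))) :=
    ((tendsto_nat_floor_mul_div_atTop (by positivity : (0 : ℝ) ≤ s / N)).comp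
      tendsto_natCast_atTop_atTop).const_mul (N : ℝ)
  have h2 : Tendsto (fun n : ℕ => gridPoint N n ⌊(s / N : ℝ) * n⌋₊) atTop (𝓝 s) := by
    rw [← NNReal.tendsto_coe]
    convert h1 using 2
    · unfold gridPoint; push_cast; rfl
    · field_simp
  filter_upwards [h2.eventually (hU.mem_nhds hs), eventually_gt_atTop 0] with n hn hn0
  refine ⟨_, ?_, hn⟩
  have hn0' : (0 : ℝ) < n := by exact_mod_cast hn0
  rw [Nat.floor_lt (by positivity)]
  have : (s : ℝ) / N < 1 := (div_lt_one hNr).2 hsN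
  nlinarith

lemma exists_isFirstAbove {N : ℝ≥0} {t : ℝ} {n : ℕ} {b : ℝ≥0 → ℝ}
    (h : ∃ k < n, t < b (gridPoint N n k)) : ∃ k < n, IsFirstAbove N t n k b := by
  classical
  obtain ⟨k, hk, hb⟩ := h
  have hex : ∃ k, t < b (gridPoint N n k) := ⟨k, hb⟩
  exact ⟨Nat.find hex, (Nat.find_min' hex hb).trans_lt hk,
    fun j hj => not_lt.1 (Nat.find_min hex hj), Nat.find_spec hex⟩

lemma eventually_exists_isFirstAbove_iff {N : ℝ≥0} (hN : 0 < N) {t : ℝ} {b : ℝ≥0 → ℝ}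
    (hb : Continuous b) : ∀ᶠ n : ℕ in atTop,
      (∃ k < n, IsFirstAbove N t n k b) ↔ ∃ s < N, t < b s := by
  by_cases h : ∃ s < N, t < b s
  · obtain ⟨s, hsN, hs⟩ := h
    filter_upwards [exists_gridPoint_mem hN (isOpen_lt continuous_const hb) hs hsN] with n hn
    exact iff_of_true (exists_isFirstAbove hn) ⟨s, hsN, hs⟩
  · refine Eventually.of_forall fun n => iff_of_false ?_ h
    rintro ⟨k, hk, -, hk2⟩
    exact h ⟨_, gridPoint_lt hN hk, hk2⟩

/-- At the first grid time above the level, a continuous path is close to the level. -/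
lemma eventually_isFirstAbove_lt {N : ℝ≥0} {t : ℝ} {b : ℝ≥0 → ℝ} (hN : 0 < N)
    (hb : Continuous b) (h0 : b 0 < t) {c : ℝ} (hc : t < c) :
    ∀ᶠ n : ℕ in atTop, ∀ k < n, IsFirstAbove N t n k b → b (gridPoint N n k) < c := by
  have huc := (isCompact_Icc (a := (0 : ℝ≥0)) (b := N)).uniformContinuousOn_of_continuous
    hb.continuousOn
  obtain ⟨δ, hδ, hd⟩ := Metric.uniformContinuousOn_iff.1 huc (c - t) (sub_pos.2 hc)
  have hlim : Tendsto (fun n : ℕ => (N : ℝ) / n) atTop (𝓝 0) :=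
    tendsto_const_nhds.div_atTop tendsto_natCast_atTop_atTop
  filter_upwards [hlim.eventually (gt_mem_nhds hδ)] with n hn k hk hfirst
  obtain ⟨h1, h2⟩ := hfirst
  cases k with
  | zero =>
    exfalso
    have : gridPoint N n 0 = 0 := by simp [gridPoint]
    rw [this] at h2
    exact absurd h2 (not_lt.2 h0.le)
  | succ j =>
    have hj := h1 j (Nat.lt_succ_self j)
    have hdist : dist (gridPoint N n (j + 1)) (gridPoint N n j) < δ := by
      rw [gridPoint_succ_le, NNReal.dist_eq]
      push_cast
      rw [add_sub_cancel_left, abs_of_nonneg (by positivity)]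
      exact hn
    have := hd _ ⟨zero_le, (gridPoint_lt hN hk).le⟩ _
      ⟨zero_le, (gridPoint_lt hN (Nat.lt_of_succ_lt hk)).le⟩ hdist
    rw [Real.dist_eq] at this
    linarith [(abs_lt.1 this).2]

/-- On fine grids, the path ends above its value at the first grid time above the level if and only
if it ends above the level. -/
lemma eventually_exists_isFirstAbove_and_lt_iff {N : ℝ≥0} (hN : 0 < N) {t : ℝ} {b : ℝ≥0 → ℝ}
    (hb : Continuous b) (h0 : b 0 < t) (hne : b N ≠ t) : ∀ᶠ n : ℕ in atTop,
      (∃ k < n, IsFirstAbove N t n k b ∧ b (gridPoint N n k) < b N) ↔ t < b N := by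
  rcases lt_or_gt_of_ne hne with h | h
  · refine Eventually.of_forall fun n => iff_of_false ?_ (not_lt.2 h.le)
    rintro ⟨k, -, ⟨-, hk2⟩, hk3⟩
    exact absurd (hk2.trans hk3) (not_lt.2 h.le)
  · have hex : ∃ s < N, t < b s := by
      have hopen : IsOpen {s | t < b s} := isOpen_lt continuous_const hb
      have hmem := hopen.mem_nhds h
      obtain ⟨l, hl, hsub⟩ := exists_Ioc_subset_of_mem_nhds hmem ⟨0, hN⟩
      obtain ⟨m, hm1, hm2⟩ := exists_between hl
      exact ⟨m, hm2, hsub ⟨hm1, hm2.le⟩⟩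
    filter_upwards [eventually_exists_isFirstAbove_iff hN hb (t := t),
      eventually_isFirstAbove_lt hN hb h0 h] with n h1 h2
    obtain ⟨k, hk, hf⟩ := h1.2 hex
    exact iff_of_true ⟨k, hk, hf, h2 k hk hf⟩ h

lemma two_mul_gaussianReal_Ioi_zero {v : ℝ≥0} (hv : v ≠ 0) : 2 * gaussianReal 0 v (Ioi 0) = 1 := by
  rw [gaussianReal_apply _ hv, ← lintegral_const_mul _ (measurable_gaussianPDF _ _),
    lintegral_Ioi_two_mul_gaussianPDF hv]

variable {Ω : Type*} [MeasurableSpace Ω] {P : Measure Ω} {B : ℝ≥0 → Ω → ℝ}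

lemma nullMeasurableSet_isFirstAbove (hB : IsPreBrownianReal B P) (N : ℝ≥0) (t : ℝ) (n k : ℕ) :
    NullMeasurableSet {ω | IsFirstAbove N t n k (B · ω)} P := by
  have h : {ω | IsFirstAbove N t n k (B · ω)} = (⋂ j : Fin k, {ω | B (gridPoint N n j) ω ≤ t}) ∩
      {ω | t < B (gridPoint N n k) ω} := by
    ext ω
    simp only [IsFirstAbove, mem_inter_iff, mem_iInter, mem_ofPred_eq]
    exact and_congr_left fun _ => ⟨fun h j => h j j.2, fun h j hj => h ⟨j, hj⟩⟩
  rw [h]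
  exact (NullMeasurableSet.iInter fun j => nullMeasurableSet_le (hB.aemeasurable _)
    aemeasurable_const).inter (nullMeasurableSet_lt aemeasurable_const (hB.aemeasurable _))

/-- Given that the level is first exceeded at the `k`-th grid time, the remaining increment is
independent and symmetric. -/
lemma measure_isFirstAbove_eq_two_mul (hB : IsPreBrownianReal B P) {N : ℝ≥0} (hN : 0 < N) (t : ℝ)
    {n k : ℕ} (hk : k < n) : P {ω | IsFirstAbove N t n k (B · ω)} =
      2 * P ({ω | IsFirstAbove N t n k (B · ω)} ∩ {ω | B (gridPoint N n k) ω < B N ω}) := by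
  set s := gridPoint N n k with hs
  have hsN : s < N := gridPoint_lt hN hk
  have hind := hB.indepFun_shift s
  set S : Set (Set.Iic s → ℝ) :=
    (⋂ j : Fin k, {f | f ⟨gridPoint N n j, mem_Iic.2 (gridPoint_mono N n j.2.le)⟩ ≤ t}) ∩
      {f | t < f ⟨s, mem_Iic.2 le_rfl⟩} with hS
  have hSm : MeasurableSet S := by
    refine (MeasurableSet.iInter fun j => ?_).inter ?_
    · exact measurableSet_le (measurable_pi_apply _) measurable_const
    · exact measurableSet_lt measurable_const (measurable_pi_apply _)
  set D : Set (ℝ≥0 → ℝ) := {f | 0 < f (N - s)} with hD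
  have hDm : MeasurableSet D := measurableSet_lt measurable_const (measurable_pi_apply _)
  have e1 : {ω | IsFirstAbove N t n k (B · ω)} = (fun ω (u : Set.Iic s) => B u ω) ⁻¹' S := by
    ext ω
    simp only [IsFirstAbove, hS, mem_inter_iff, mem_iInter, mem_ofPred_eq, mem_preimage]
    exact and_congr_left fun _ => ⟨fun h j => h j j.2, fun h j hj => h ⟨j, hj⟩⟩
  have e2 : {ω | B s ω < B N ω} = (fun ω u => B (s + u) ω - B s ω) ⁻¹' D := by
    ext ω
    simp only [hD, mem_ofPred_eq, mem_preimage]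
    rw [add_tsub_cancel_of_le hsN.le, sub_pos]
  have hlaw := (hB.shift s).hasLaw_eval (N - s)
  have e3 : 2 * P ((fun ω u => B (s + u) ω - B s ω) ⁻¹' D) = 1 := by
    rw [← two_mul_gaussianReal_Ioi_zero (v := N - s) (tsub_pos_of_lt hsN).ne', ← hlaw.map_eq,
      Measure.map_apply_of_aemeasurable hlaw.aemeasurable measurableSet_Ioi]
    rfl
  rw [e1, e2, inter_comm, hind.measure_inter_preimage_eq_mul _ _ hDm hSm, ← mul_assoc, e3, one_mul]

lemma pairwise_disjoint_isFirstAbove (N : ℝ≥0) (t : ℝ) (n : ℕ) {j k : ℕ} (hjk : j ≠ k)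
    (b : ℝ≥0 → ℝ) (hj : IsFirstAbove N t n j b) (hk : IsFirstAbove N t n k b) : False := by
  rcases lt_or_gt_of_ne hjk with h | h
  · exact absurd hj.2 (not_lt.2 (hk.1 j h))
  · exact absurd hk.2 (not_lt.2 (hj.1 k h))

/-- The reflection principle: `P(max_{s < N} B_s > t) = 2 P(B_N > t)`. -/
lemma measure_exists_gt_eq_two_mul (hB : IsBrownianReal B P) {N : ℝ≥0} (hN : 0 < N) {t : ℝ}
    (ht : 0 < t) : P {ω | ∃ s < N, t < B s ω} = 2 * P {ω | t < B N ω} := by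
  have hpre := hB.toIsPreBrownianReal
  have : IsProbabilityMeasure P := hpre.isGaussianProcess.isProbabilityMeasure
  set A : ℕ → ℕ → Set Ω := fun n k => {ω | IsFirstAbove N t n k (B · ω)} with hA
  set A' : ℕ → ℕ → Set Ω := fun n k => A n k ∩ {ω | B (gridPoint N n k) ω < B N ω} with hA'
  have hAm : ∀ n k, NullMeasurableSet (A n k) P := nullMeasurableSet_isFirstAbove hpre N t
  have hAm' : ∀ n k, NullMeasurableSet (A' n k) P := fun n k =>
    (hAm n k).inter (nullMeasurableSet_lt (hpre.aemeasurable _) (hpre.aemeasurable _))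
  have hdisj : ∀ n j k, j ≠ k → Disjoint (A n j) (A n k) := fun n j k hjk =>
    Set.disjoint_left.2 fun ω h1 h2 =>
      pairwise_disjoint_isFirstAbove N t n hjk _ (mem_ofPred.1 h1) (mem_ofPred.1 h2)
  have heq : ∀ n, P (⋃ k ∈ Finset.range n, A n k) = 2 * P (⋃ k ∈ Finset.range n, A' n k) := by
    intro n
    rw [measure_biUnion_finset₀ (fun j _ k _ hjk => (hdisj n j k hjk).aedisjoint)
      (fun k _ => hAm n k), measure_biUnion_finset₀ (fun j _ k _ hjk =>
        ((hdisj n j k hjk).mono inter_subset_left inter_subset_left).aedisjoint)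
      (fun k _ => hAm' n k), Finset.mul_sum]
    exact Finset.sum_congr rfl fun k hk =>
      measure_isFirstAbove_eq_two_mul hpre hN t (Finset.mem_range.1 hk)
  have hne : ∀ᵐ ω ∂P, B N ω ≠ t := by
    have hlaw := hpre.hasLaw_eval N
    have := nullSingletonClass_gaussianReal (μ := 0) hN.ne'
    have h0 : P {ω | B N ω = t} = 0 := by
      have := Measure.map_apply_of_aemeasurable hlaw.aemeasurable (measurableSet_singleton t)
      rw [hlaw.map_eq, measure_singleton] at this
      exact this.symm
    exact measure_eq_zero_iff_ae_notMem.1 h0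
  have hlim1 : Tendsto (fun n => P (⋃ k ∈ Finset.range n, A n k)) atTop
      (𝓝 (P {ω | ∃ s < N, t < B s ω})) := by
    refine tendsto_measure_of_ae_eventually_mem_iff (fun n =>
      NullMeasurableSet.biUnion (Finset.countable_toSet _) fun k _ => hAm n k) ?_
    filter_upwards [hB.cont] with ω hc
    filter_upwards [eventually_exists_isFirstAbove_iff hN hc (t := t)] with n hn
    simpa [hA] using hn
  have hlim2 : Tendsto (fun n => P (⋃ k ∈ Finset.range n, A' n k)) atTop
      (𝓝 (P {ω | t < B N ω})) := by
    refine tendsto_measure_of_ae_eventually_mem_iff (fun n =>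
      NullMeasurableSet.biUnion (Finset.countable_toSet _) fun k _ => hAm' n k) ?_
    filter_upwards [hB.cont, hpre.eval_zero_ae_eq_zero, hne] with ω hc h0 hω
    filter_upwards [eventually_exists_isFirstAbove_and_lt_iff hN hc (by rw [h0]; exact ht) hω]
      with n hn
    simp only [hA', hA, mem_iUnion, mem_inter_iff, Finset.mem_range, exists_prop, mem_ofPred_eq]
    exact hn
  simp_rw [heq] at hlim1
  exact tendsto_nhds_unique hlim1 (ENNReal.Tendsto.const_mul hlim2 (Or.inr (by simp)))

end

/-! ### The first-passage time -/

section

variable {Ω : Type*} [MeasurableSpace Ω] {P : Measure Ω} {B : ℝ≥0 → Ω → ℝ}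

lemma exists_gt_of_exists_eq {b : ℝ≥0 → ℝ} (hb : Continuous b) {t : ℝ} {a : ℝ≥0} (ha : 0 < a) :
    (∃ s ≤ a, b s = t) → ∀ ε > 0, ∃ s < a, t - ε < b s := by
  rintro ⟨s, hsa, hs⟩ ε hε
  rcases hsa.lt_or_eq with h | rfl
  · exact ⟨s, h, by linarith⟩
  · have hopen : IsOpen {u | t - ε < b u} := isOpen_lt continuous_const hb
    obtain ⟨l, hl, hsub⟩ := exists_Ioc_subset_of_mem_nhds
      (hopen.mem_nhds (show t - ε < b s by linarith)) ⟨0, ha⟩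
    obtain ⟨m, hm1, hm2⟩ := exists_between hl
    exact ⟨m, hm2, hsub ⟨hm1, hm2.le⟩⟩

lemma exists_eq_of_le {b : ℝ≥0 → ℝ} (hb : Continuous b) {t : ℝ} (h0 : b 0 ≤ t) {s : ℝ≥0}
    (hs : t ≤ b s) : ∃ u ≤ s, b u = t := by
  obtain ⟨u, hu, hut⟩ := intermediate_value_Icc (zero_le : 0 ≤ s) hb.continuousOn ⟨h0, hs⟩
  exact ⟨u, hu.2, hut⟩

/-- The distribution function of the passage time, by reflection: `P(T_t ≤ a) = 2 P(B_a > t)`. -/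
lemma measure_exists_eq (hB : IsBrownianReal B P) {a : ℝ≥0} (ha : 0 < a) {t : ℝ} (ht : 0 < t) :
    P {ω | ∃ s ≤ a, B s ω = t} = 2 * gaussianReal 0 a (Ioi t) := by
  have hpre := hB.toIsPreBrownianReal
  have hlaw := hpre.hasLaw_eval a
  have hgt : ∀ u, P {ω | u < B a ω} = gaussianReal 0 a (Ioi u) := fun u => by
    rw [← hlaw.map_eq, Measure.map_apply_of_aemeasurable hlaw.aemeasurable measurableSet_Ioi]; rfl
  have := nullSingletonClass_gaussianReal (μ := 0) ha.ne'
  refine le_antisymm ?_ ?_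
  · -- the event forces the path above `t - ε` before time `a`
    have hle : ∀ n : ℕ, P {ω | ∃ s ≤ a, B s ω = t}
        ≤ 2 * gaussianReal 0 a (Ioi (t - t / (n + 2))) := by
      intro n
      have hn : (0 : ℝ) < n + 2 := by positivity
      have hpos : 0 < t - t / (n + 2) := by
        rw [sub_pos, div_lt_iff₀ hn]
        nlinarith [(Nat.cast_nonneg n : (0 : ℝ) ≤ n)]
      rw [← hgt, ← measure_exists_gt_eq_two_mul hB ha hpos]
      refine measure_mono_ae ?_
      filter_upwards [hB.cont] with ω hc hω
      exact exists_gt_of_exists_eq hc ha hω (t / (n + 2)) (by positivity)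
    have hanti : Antitone fun n : ℕ => Ioi (t - t / ((n : ℝ) + 2)) := fun m n hmn =>
      Ioi_subset_Ioi (by gcongr)
    have hlim := tendsto_measure_iInter_atTop (μ := gaussianReal 0 a)
      (s := fun n : ℕ => Ioi (t - t / ((n : ℝ) + 2)))
      (fun n => (measurableSet_Ioi (a := t - t / ((n : ℝ) + 2))).nullMeasurableSet) hanti
      ⟨0, measure_ne_top _ _⟩
    have hInter : ⋂ n : ℕ, Ioi (t - t / ((n : ℝ) + 2)) = Ici t := by
      ext x
      simp only [mem_iInter, mem_Ioi, mem_Ici]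
      constructor
      · intro h
        have hl : Tendsto (fun n : ℕ => t - t / ((n : ℝ) + 2)) atTop (𝓝 (t - 0)) :=
          (tendsto_const_nhds.div_atTop
            (tendsto_atTop_add_const_right _ _ tendsto_natCast_atTop_atTop)).const_sub t
        rw [sub_zero] at hl
        exact le_of_tendsto' hl fun n => (h n).le
      · intro h n
        have : 0 < t / ((n : ℝ) + 2) := by positivity
        linarith
    rw [hInter, ← measure_congr Ioi_ae_eq_Ici] at hlim
    exact ge_of_tendsto' (ENNReal.Tendsto.const_mul hlim (Or.inr (by simp))) hle
  · rw [← hgt, ← measure_exists_gt_eq_two_mul hB ha ht]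
    refine measure_mono_ae ?_
    filter_upwards [hB.cont, hpre.eval_zero_ae_eq_zero] with ω hc h0 hω
    obtain ⟨s, hs, hst⟩ := hω
    obtain ⟨u, hu, hut⟩ := exists_eq_of_le hc (by rw [h0]; exact ht.le) hst.le
    exact ⟨u, hu.trans hs.le, hut⟩

/-- The distribution function of the passage density, via `s = t² / x²`. -/
lemma setLIntegral_firstPassageDensity {a : ℝ≥0} (ha : 0 < a) {t : ℝ} (ht : 0 < t) :
    ∫⁻ s in Ioi 0 ∩ Iic (a : ℝ), ENNReal.ofReal (firstPassageDensity s t)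
      = 2 * gaussianReal 0 a (Ioi t) := by
  have ha' : (0 : ℝ) < a := ha
  have hsq : 0 < √(a : ℝ) := Real.sqrt_pos.2 ha'
  have h1 : ∫⁻ s in Ioi 0 ∩ Iic (a : ℝ), ENNReal.ofReal (firstPassageDensity s t)
      = ∫⁻ s in Ioi 0, ENNReal.ofReal (firstPassageDensity s t) * (Iic (a : ℝ)).indicator 1 s := by
    rw [inter_comm, ← Measure.restrict_restrict measurableSet_Iic,
      ← lintegral_indicator measurableSet_Iic]
    refine lintegral_congr fun s => ?_
    by_cases h : s ∈ Iic (a : ℝ) <;> simp [h]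
  have h2 : ∀ x ∈ Ioi (0 : ℝ), 2 * gaussianPDF 0 1 x * (Iic (a : ℝ)).indicator 1 (t ^ 2 / x ^ 2)
      = (Ici (t / √a)).indicator (fun x => 2 * gaussianPDF 0 1 x) x := by
    intro x hx
    have hx' : (0 : ℝ) < x := hx
    have hiff : t ^ 2 / x ^ 2 ∈ Iic (a : ℝ) ↔ x ∈ Ici (t / √a) := by
      rw [mem_Iic, mem_Ici, ← div_pow, ← Real.le_sqrt' (div_pos ht hx'), div_le_iff₀ hx',
        div_le_iff₀ hsq, mul_comm]
    by_cases h : x ∈ Ici (t / √a)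
    · rw [indicator_of_mem h, indicator_of_mem (hiff.2 h)]; simp
    · rw [indicator_of_notMem h, indicator_of_notMem (fun h' => h (hiff.1 h'))]; simp
  have hscale : gaussianReal 0 a (Ici t) = gaussianReal 0 1 (Ici (t / √a)) := by
    have hv : gaussianReal 0 a = (gaussianReal 0 1).map (√(a : ℝ) * ·) := by
      rw [gaussianReal_map_const_mul]
      congr 1
      · simp
      · ext; simp
    rw [hv, Measure.map_apply (by fun_prop) measurableSet_Ici]
    congr 1
    ext x
    rw [mem_preimage, mem_Ici, mem_Ici, div_le_iff₀ hsq, mul_comm]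
  have hsub : Ioi (0 : ℝ) ∩ Ici (t / √a) = Ici (t / √a) :=
    inter_eq_right.2 fun x hx => (by positivity : 0 < t / √(a : ℝ)).trans_le hx
  have := nullSingletonClass_gaussianReal (μ := 0) ha.ne'
  rw [h1, lintegral_firstPassageDensity_mul ht, setLIntegral_congr_fun measurableSet_Ioi h2,
    lintegral_indicator measurableSet_Ici, Measure.restrict_restrict measurableSet_Ici, inter_comm,
    hsub, lintegral_const_mul _ (measurable_gaussianPDF _ _),
    ← gaussianReal_apply 0 one_ne_zero, ← hscale, measure_congr Ioi_ae_eq_Ici]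

lemma measure_exists_eq_le (hB : IsBrownianReal B P) {a : ℝ≥0} (ha : 0 < a) {t : ℝ} (ht : 0 < t) :
    P {ω | ∃ s ≤ a, B s ω = t}
      = ∫⁻ s in Ioi 0 ∩ Iic (a : ℝ), ENNReal.ofReal (firstPassageDensity s t) := by
  rw [measure_exists_eq hB ha ht, setLIntegral_firstPassageDensity ha ht]

lemma exists_nnrat_btwn {a b : ℝ≥0} (h : a < b) : ∃ q : ℚ≥0, a < (q : ℝ≥0) ∧ (q : ℝ≥0) < b := by
  obtain ⟨q, hq1, hq2⟩ := exists_rat_btwn (NNReal.coe_lt_coe.2 h)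
  have hq : 0 ≤ q := by exact_mod_cast a.2.trans hq1.le
  lift q to ℚ≥0 using hq
  exact ⟨q, by exact_mod_cast hq1, by exact_mod_cast hq2⟩

/-- Whether a continuous path hits the level up to a rational time is decided by its values at
rational times; approaching the level up to `1 / (m + 1)` suffices by compactness. -/
lemma exists_eq_of_le_exists_nnrat {b : ℝ≥0 → ℝ} (hb : Continuous b) {t : ℝ} (h0 : b 0 ≤ t)
    (q : ℚ≥0) :
    (∀ m : ℕ, ∃ p ≤ q, t - 1 / ((m : ℝ) + 1) < b (p : ℝ≥0)) ↔ ∃ s ≤ (q : ℝ≥0), b s = t := by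
  constructor
  · intro h
    obtain ⟨s, hs, hmax⟩ := (isCompact_Icc (a := (0 : ℝ≥0)) (b := q)).exists_isMaxOn
      ⟨0, left_mem_Icc.2 zero_le⟩ hb.continuousOn
    have hle : t ≤ b s := by
      have hl : Tendsto (fun m : ℕ => t - 1 / ((m : ℝ) + 1)) atTop (𝓝 (t - 0)) :=
        tendsto_one_div_add_atTop_nhds_zero_nat.const_sub t
      rw [sub_zero] at hl
      refine le_of_tendsto' hl fun m => ?_
      obtain ⟨p, hp, hpt⟩ := h m
      exact hpt.le.trans (hmax ⟨zero_le, by exact_mod_cast hp⟩)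
    obtain ⟨u, hu, hut⟩ := exists_eq_of_le hb h0 hle
    exact ⟨u, hu.trans hs.2, hut⟩
  · rintro ⟨s, hs, rfl⟩ m
    have hm : (0 : ℝ) < 1 / ((m : ℝ) + 1) := by positivity
    rcases hs.lt_or_eq with h | h
    · have hopen : IsOpen {u | b s - 1 / ((m : ℝ) + 1) < b u} := isOpen_lt continuous_const hb
      obtain ⟨l, hl, hsub⟩ := exists_Ico_subset_of_mem_nhds
        (hopen.mem_nhds (show b s - 1 / ((m : ℝ) + 1) < b s by linarith)) ⟨_, h⟩
      obtain ⟨p, hp1, hp2⟩ := exists_nnrat_btwn (lt_min hl h)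
      exact ⟨p, by exact_mod_cast (hp2.trans_le (min_le_right _ _)).le,
        hsub ⟨hp1.le, hp2.trans_le (min_le_left _ _)⟩⟩
    · exact ⟨q, le_rfl, by rw [← h]; linarith⟩

open Classical in
/-- The first-passage time to the level `t`, as a functional of the values of a continuous path at
rational times. -/
noncomputable def ratFirstPassage (t : ℝ) (b : ℚ≥0 → ℝ) : ℝ≥0 :=
  (⨅ q : ℚ≥0, {b : ℚ≥0 → ℝ | ∀ m : ℕ, ∃ p ≤ q, t - 1 / ((m : ℝ) + 1) < b p}.piecewise
    (fun _ => ((q : ℝ≥0) : ℝ≥0∞)) (fun _ => ⊤) b).toNNReal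

lemma measurableSet_forall_exists_nnrat (t : ℝ) (q : ℚ≥0) :
    MeasurableSet {b : ℚ≥0 → ℝ | ∀ m : ℕ, ∃ p ≤ q, t - 1 / ((m : ℝ) + 1) < b p} := by
  have h : {b : ℚ≥0 → ℝ | ∀ m : ℕ, ∃ p ≤ q, t - 1 / ((m : ℝ) + 1) < b p} =
      ⋂ m : ℕ, ⋃ p : ℚ≥0, ⋃ _ : p ≤ q, {b : ℚ≥0 → ℝ | t - 1 / ((m : ℝ) + 1) < b p} := by
    ext b; simp
  rw [h]
  exact MeasurableSet.iInter fun m => MeasurableSet.iUnion fun p => MeasurableSet.iUnion fun _ =>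
    measurableSet_lt measurable_const (measurable_pi_apply p)

lemma measurable_ratFirstPassage (t : ℝ) : Measurable (ratFirstPassage t) :=
  Measurable.ennreal_toNNReal (Measurable.iInf fun q => Measurable.piecewise
    (measurableSet_forall_exists_nnrat t q) measurable_const measurable_const)

lemma firstPassage_mem {Ω : Type*} {B : ℝ≥0 → Ω → ℝ} {t : ℝ} {ω : Ω}
    (hb : Continuous (B · ω)) (h : ∃ s, B s ω = t) :
    B (firstPassage B t ω) ω = t :=
  (isClosed_eq hb continuous_const : IsClosed {s : ℝ≥0 | B s ω = t}).csInf_mem h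
    (OrderBot.bddBelow _)

lemma firstPassage_le_iff {Ω : Type*} {B : ℝ≥0 → Ω → ℝ} {t : ℝ} {ω : Ω}
    (hb : Continuous (B · ω)) (h : ∃ s, B s ω = t) (a : ℝ≥0) :
    firstPassage B t ω ≤ a ↔ ∃ s ≤ a, B s ω = t :=
  ⟨fun ha => ⟨_, ha, firstPassage_mem hb h⟩, fun ⟨_, hs, hst⟩ =>
    (csInf_le (OrderBot.bddBelow _) hst : firstPassage B t ω ≤ _).trans hs⟩

lemma ratFirstPassage_eq {Ω : Type*} {B : ℝ≥0 → Ω → ℝ} {t : ℝ} {ω : Ω}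
    (hb : Continuous (B · ω)) (h0 : B 0 ω ≤ t) (h : ∃ s, B s ω = t) :
    ratFirstPassage t (fun q => B q ω) = firstPassage B t ω := by
  classical
  have hiff : ∀ q : ℚ≥0, ((fun q : ℚ≥0 => B q ω) ∈
      {b : ℚ≥0 → ℝ | ∀ m : ℕ, ∃ p ≤ q, t - 1 / ((m : ℝ) + 1) < b p}) ↔
        firstPassage B t ω ≤ (q : ℝ≥0) := fun q => by
    rw [firstPassage_le_iff hb h, ← exists_eq_of_le_exists_nnrat hb h0]; rfl
  unfold ratFirstPassage
  rw [← ENNReal.toNNReal_coe (firstPassage B t ω)]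
  congr 1
  refine le_antisymm (ENNReal.le_of_forall_pos_le_add fun ε hε _ => ?_) (le_iInf fun q => ?_)
  · obtain ⟨u, hu⟩ := exists_nnrat_btwn (lt_add_of_pos_right (firstPassage B t ω) hε)
    refine (iInf_le _ u).trans ?_
    rw [piecewise_eq_of_mem _ _ _ ((hiff u).2 hu.1.le)]
    exact_mod_cast hu.2.le
  · by_cases hq : firstPassage B t ω ≤ (q : ℝ≥0)
    · rw [piecewise_eq_of_mem _ _ _ ((hiff q).2 hq)]
      exact_mod_cast hq
    · rw [piecewise_eq_of_notMem _ _ _ fun h => hq ((hiff q).1 h)]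
      exact le_top

/-- Brownian motion reaches every positive level almost surely, because the passage density has
total mass one. -/
lemma ae_exists_eq (hB : IsBrownianReal B P) {t : ℝ} (ht : 0 < t) : ∀ᵐ ω ∂P, ∃ s, B s ω = t := by
  have hpre := hB.toIsPreBrownianReal
  have : IsProbabilityMeasure P := hpre.isGaussianProcess.isProbabilityMeasure
  set μ : Measure ℝ := (volume.restrict (Ioi (0 : ℝ))).withDensity
    (fun s => ENNReal.ofReal (firstPassageDensity s t)) with hμ
  have hμ1 : μ univ = 1 := by
    rw [hμ, withDensity_apply _ MeasurableSet.univ, Measure.restrict_univ,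
      lintegral_firstPassageDensity ht]
  have hμI : ∀ a : ℝ≥0, 0 < a → μ (Iic (a : ℝ)) = P {ω | ∃ s ≤ a, B s ω = t} := fun a ha => by
    rw [measure_exists_eq_le hB ha ht, hμ, withDensity_apply _ measurableSet_Iic,
      Measure.restrict_restrict measurableSet_Iic, inter_comm]
  have hmono : Monotone fun n : ℕ => Iic (((n : ℝ≥0) + 1 : ℝ≥0) : ℝ) := fun m n h =>
    Iic_subset_Iic.2 (by push_cast; gcongr)
  have hlim := tendsto_measure_iUnion_atTop (μ := μ) hmono
  have hU : ⋃ n : ℕ, Iic (((n : ℝ≥0) + 1 : ℝ≥0) : ℝ) = univ := by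
    refine eq_univ_of_forall fun x => mem_iUnion.2 ?_
    obtain ⟨n, hn⟩ := exists_nat_ge x
    exact ⟨n, mem_Iic.2 (by push_cast; linarith)⟩
  rw [hU, hμ1] at hlim
  have hle : 1 ≤ P {ω | ∃ s, B s ω = t} := by
    refine le_of_tendsto' hlim fun n => ?_
    simp only [Function.comp]
    rw [hμI _ (by positivity)]
    exact measure_mono fun ω ⟨s, _, hs⟩ => ⟨s, hs⟩
  have hnull : NullMeasurableSet {ω | ∃ s, B s ω = t} P := by
    have hcoord : AEMeasurable (fun ω (q : ℚ≥0) => B q ω) P :=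
      aemeasurable_pi_lambda _ fun _ => hpre.aemeasurable _
    have h1 : NullMeasurableSet (⋃ q : ℚ≥0, (fun ω (q : ℚ≥0) => B q ω) ⁻¹'
        {b : ℚ≥0 → ℝ | ∀ m : ℕ, ∃ p ≤ q, t - 1 / ((m : ℝ) + 1) < b p}) P :=
      NullMeasurableSet.iUnion fun q =>
        hcoord.nullMeasurable (measurableSet_forall_exists_nnrat t q)
    refine h1.congr ?_
    filter_upwards [hB.cont, hpre.eval_zero_ae_eq_zero] with ω hc h0
    refine propext ?_
    have hiff := exists_eq_of_le_exists_nnrat hc (t := t) (by rw [h0]; exact ht.le)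
    constructor
    · intro h
      obtain ⟨q, hq⟩ := mem_iUnion.1 h
      obtain ⟨s, -, hs⟩ := (hiff q).1 hq
      exact ⟨s, hs⟩
    · rintro ⟨s, hs⟩
      obtain ⟨n, hn⟩ := exists_nat_ge s
      exact mem_iUnion.2 ⟨n, (hiff n).2 ⟨s, by simpa using hn, hs⟩⟩
  have h2 := (prob_compl_eq_zero_iff₀ hnull).2 (le_antisymm prob_le_one hle)
  exact h2

lemma ae_ratFirstPassage_eq (hB : IsBrownianReal B P) {t : ℝ} (ht : 0 < t) :
    (fun ω => ratFirstPassage t fun q => B q ω) =ᵐ[P] firstPassage B t := by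
  filter_upwards [hB.cont, hB.toIsPreBrownianReal.eval_zero_ae_eq_zero, ae_exists_eq hB ht]
    with ω hc h0 h
  exact ratFirstPassage_eq hc (by rw [h0]; exact ht.le) h

lemma aemeasurable_firstPassage (hB : IsBrownianReal B P) {t : ℝ} (ht : 0 < t) :
    AEMeasurable (firstPassage B t) P :=
  (((measurable_ratFirstPassage t).comp_aemeasurable (aemeasurable_pi_lambda _ fun _ =>
    hB.toIsPreBrownianReal.aemeasurable _)).congr (ae_ratFirstPassage_eq hB ht))

/-- The first-passage time of Brownian motion has density `g(·, t)`. -/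
lemma map_firstPassage (hB : IsBrownianReal B P) {t : ℝ} (ht : 0 < t) :
    P.map (fun ω => (firstPassage B t ω : ℝ)) = (volume.restrict (Ioi (0 : ℝ))).withDensity
      (fun s => ENNReal.ofReal (firstPassageDensity s t)) := by
  have hpre := hB.toIsPreBrownianReal
  have : IsProbabilityMeasure P := hpre.isGaussianProcess.isProbabilityMeasure
  have hm : AEMeasurable (fun ω => (firstPassage B t ω : ℝ)) P :=
    (aemeasurable_firstPassage hB ht).coe_nnreal_real
  have : IsProbabilityMeasure (P.map fun ω => (firstPassage B t ω : ℝ)) :=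
    Measure.isProbabilityMeasure_map hm
  refine Measure.ext_of_Iic _ _ fun a => ?_
  rw [Measure.map_apply_of_aemeasurable hm measurableSet_Iic,
    withDensity_apply _ measurableSet_Iic, Measure.restrict_restrict measurableSet_Iic, inter_comm]
  rcases le_or_gt a 0 with ha | ha
  · have hempty : Ioi 0 ∩ Iic a = ∅ := by
      ext x; simp only [mem_inter_iff, mem_Ioi, mem_Iic, mem_empty_iff_false, iff_false]
      rintro ⟨h1, h2⟩; linarith
    rw [hempty, Measure.restrict_empty, lintegral_zero_measure]
    -- a path from `0` which reaches `t > 0` does so at a positive time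
    refine measure_mono_null (t := {ω | ¬ ((∃ s, B s ω = t) ∧ B 0 ω = 0 ∧ Continuous (B · ω))})
      (fun ω hω hn => ?_) ?_
    · obtain ⟨h, h0, hc⟩ := hn
      have hT : firstPassage B t ω = 0 := by
        have : (firstPassage B t ω : ℝ) ≤ 0 := (mem_Iic.1 hω).trans ha
        exact le_antisymm (by exact_mod_cast this) zero_le
      have := firstPassage_mem hc h
      rw [hT, h0] at this
      exact ht.ne this
    · change ∀ᵐ ω ∂P, (∃ s, B s ω = t) ∧ B 0 ω = 0 ∧ Continuous (B · ω)
      filter_upwards [hB.cont, hpre.eval_zero_ae_eq_zero, ae_exists_eq hB ht] with ω hc h0 h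
      exact ⟨h, h0, hc⟩
  · have hae : a = ((a.toNNReal : ℝ≥0) : ℝ) := (Real.coe_toNNReal a ha.le).symm
    rw [hae, ← measure_exists_eq_le hB (by simpa using ha) ht]
    refine measure_congr ?_
    filter_upwards [hB.cont, ae_exists_eq hB ht] with ω hc h
    exact propext (NNReal.coe_le_coe.trans (firstPassage_le_iff hc h _))

end

/-! ### Busemann functions and test functions on the half-plane -/

/-- The logarithm of the imaginary part of the image of `z` under the rotation of `ℍ` about `i`
with bottom row `(q, p)`, where `p² + q² = 1`. Up to sign this is the Busemann function, normalised
at `i`, of the boundary point `-p / q`. -/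
noncomputable def busemann (p q : ℝ) (z : ℂ) : ℝ :=
  Real.log z.im - Real.log ((p + q * z.re) ^ 2 + (q * z.im) ^ 2)

/-- The logarithm of `cosh (dist z i)`, a smooth proper function on `ℍ`. -/
noncomputable def logCoshDist (z : ℂ) : ℝ :=
  Real.log (z.re ^ 2 + z.im ^ 2 + 1) - Real.log (2 * z.im)

/-- The function `a (log cosh dist(z, i)) F (busemann z)` on `ℍ`, extended by zero. -/
noncomputable def testFunction (a F : ℝ → ℝ) (p q : ℝ) (z : ℂ) : ℝ :=
  if 0 < z.im then a (logCoshDist z) * F (busemann p q z) else 0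

lemma busemann_denom_pos {p q : ℝ} (hpq : p ^ 2 + q ^ 2 = 1) (x : ℝ) {y : ℝ} (hy : 0 < y) :
    0 < (p + q * x) ^ 2 + (q * y) ^ 2 := by
  rcases eq_or_ne q 0 with rfl | hq
  · have : p ^ 2 = 1 := by simpa using hpq
    simp [this]
  · have : 0 < (q * y) ^ 2 := by positivity
    positivity

lemma contDiffAt_busemann {p q : ℝ} (hpq : p ^ 2 + q ^ 2 = 1) {z : ℂ} (hz : 0 < z.im) :
    ContDiffAt ℝ (⊤ : ℕ∞) (busemann p q) z := by
  have hre : ContDiffAt ℝ (⊤ : ℕ∞) Complex.re z := Complex.reCLM.contDiff.contDiffAt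
  have him : ContDiffAt ℝ (⊤ : ℕ∞) Complex.im z := Complex.imCLM.contDiff.contDiffAt
  exact (him.log hz.ne').sub ((((contDiffAt_const.add (contDiffAt_const.mul hre)).pow 2).add
    ((contDiffAt_const.mul him).pow 2)).log (busemann_denom_pos hpq _ hz).ne')

lemma contDiffAt_logCoshDist {z : ℂ} (hz : 0 < z.im) :
    ContDiffAt ℝ (⊤ : ℕ∞) logCoshDist z := by
  have hre : ContDiffAt ℝ (⊤ : ℕ∞) Complex.re z := Complex.reCLM.contDiff.contDiffAt
  have him : ContDiffAt ℝ (⊤ : ℕ∞) Complex.im z := Complex.imCLM.contDiff.contDiffAt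
  exact ((((hre.pow 2).add (him.pow 2)).add contDiffAt_const).log
    (by positivity : (0 : ℝ) < z.re ^ 2 + z.im ^ 2 + 1).ne').sub
    ((contDiffAt_const.mul him).log (by positivity : (0 : ℝ) < 2 * z.im).ne')

/-- A closed hyperbolic ball about `i`, described so that it is visibly compact in `ℂ`. -/
lemma isCompact_hypBall (R : ℝ) :
    IsCompact {z : ℂ | z.re ^ 2 + z.im ^ 2 + 1 ≤ Real.exp R * (2 * z.im)} := by
  refine Metric.isCompact_of_isClosed_isBounded (isClosed_le ?_ ?_) ?_
  · exact ((Complex.continuous_re.pow 2).add (Complex.continuous_im.pow 2)).add continuous_const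
  · exact continuous_const.mul (continuous_const.mul Complex.continuous_im)
  · refine (Metric.isBounded_closedBall (x := (0 : ℂ)) (r := 2 * Real.exp R)).subset fun z hz => ?_
    have hz' : z.re ^ 2 + z.im ^ 2 + 1 ≤ Real.exp R * (2 * z.im) := hz
    have hE := Real.exp_pos R
    rw [mem_closedBall_zero_iff]
    have h1 : ‖z‖ ^ 2 = z.re ^ 2 + z.im ^ 2 := by rw [Complex.sq_norm, Complex.normSq_apply]; ring
    have h2 : z.im ≤ ‖z‖ := (le_abs_self _).trans (Complex.abs_im_le_norm z)
    by_contra! hlt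
    nlinarith [norm_nonneg z]

lemma logCoshDist_le_iff {z : ℂ} (hz : 0 < z.im) {R : ℝ} :
    logCoshDist z ≤ R ↔ z.re ^ 2 + z.im ^ 2 + 1 ≤ Real.exp R * (2 * z.im) := by
  have h1 : (0 : ℝ) < z.re ^ 2 + z.im ^ 2 + 1 := by positivity
  have h2 : (0 : ℝ) < 2 * z.im := by positivity
  rw [logCoshDist, ← Real.log_div h1.ne' h2.ne', Real.log_le_iff_le_exp (by positivity),
    div_le_iff₀ h2]

lemma im_pos_of_mem_hypBall {z : ℂ} {R : ℝ}
    (hz : z.re ^ 2 + z.im ^ 2 + 1 ≤ Real.exp R * (2 * z.im)) : 0 < z.im := by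
  by_contra! h
  have := Real.exp_pos R
  nlinarith [sq_nonneg z.re, sq_nonneg z.im]

lemma support_testFunction_subset {a F : ℝ → ℝ} {R : ℝ} (ha : ∀ x, R < x → a x = 0) (p q : ℝ) :
    Function.support (testFunction a F p q) ⊆
      {z : ℂ | z.re ^ 2 + z.im ^ 2 + 1 ≤ Real.exp R * (2 * z.im)} := by
  intro z hz
  have hz' : testFunction a F p q z ≠ 0 := hz
  unfold testFunction at hz'
  split_ifs at hz' with him
  · refine (logCoshDist_le_iff him).1 (not_lt.1 fun h => hz' ?_)
    rw [ha _ h, zero_mul]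
  · exact absurd rfl hz'

lemma hasCompactSupport_testFunction {a F : ℝ → ℝ} {R : ℝ} (ha : ∀ x, R < x → a x = 0) (p q : ℝ) :
    HasCompactSupport (testFunction a F p q) :=
  HasCompactSupport.of_support_subset_isCompact (isCompact_hypBall R)
    (support_testFunction_subset ha p q)

lemma tsupport_testFunction_subset {a F : ℝ → ℝ} {R : ℝ} (ha : ∀ x, R < x → a x = 0) (p q : ℝ) :
    tsupport (testFunction a F p q) ⊆ {z : ℂ | 0 < z.im} :=
  (closure_minimal (support_testFunction_subset ha p q) (isCompact_hypBall R).isClosed).trans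
    fun _ hz => im_pos_of_mem_hypBall hz

lemma testFunction_eventuallyEq (a F : ℝ → ℝ) (p q : ℝ) {z : ℂ} (hz : 0 < z.im) :
    testFunction a F p q =ᶠ[𝓝 z] fun z => a (logCoshDist z) * F (busemann p q z) := by
  filter_upwards [(isOpen_lt continuous_const Complex.continuous_im).mem_nhds hz] with w hw
  exact if_pos hw

lemma contDiff_testFunction {a F : ℝ → ℝ} (ha : ContDiff ℝ (⊤ : ℕ∞) a)
    (hF : ContDiff ℝ (⊤ : ℕ∞) F) {R : ℝ} (haR : ∀ x, R < x → a x = 0) {p q : ℝ}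
    (hpq : p ^ 2 + q ^ 2 = 1) : ContDiff ℝ (⊤ : ℕ∞) (testFunction a F p q) := by
  refine contDiff_iff_contDiffAt.2 fun z => ?_
  by_cases hz : 0 < z.im
  · exact ((ha.contDiffAt.comp z (contDiffAt_logCoshDist hz)).mul
      (hF.contDiffAt.comp z (contDiffAt_busemann hpq hz))).congr_of_eventuallyEq
      (testFunction_eventuallyEq a F p q hz)
  · refine (contDiffAt_const (c := (0 : ℝ))).congr_of_eventuallyEq ?_
    have hopen := (isCompact_hypBall R).isClosed.isOpen_compl
    filter_upwards [hopen.mem_nhds fun h => hz (im_pos_of_mem_hypBall h)] with w hw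
    by_contra hne
    exact hw (support_testFunction_subset haR p q hne)

/-- The second derivative along a line, computed by differentiating twice in one variable. -/
lemma iteratedFDeriv_two_eq_of_hasDerivAt {E : Type*} [NormedAddCommGroup E] [NormedSpace ℝ E]
    {f : E → ℝ} {x v : E} (hf : ContDiffAt ℝ 2 f x) {g : ℝ → ℝ} {c : ℝ}
    (h1 : ∀ᶠ s in 𝓝 (0 : ℝ), HasDerivAt (fun s => f (x + s • v)) (g s) s)
    (h2 : HasDerivAt g c 0) : iteratedFDeriv ℝ 2 f x ![v, v] = c := by
  have hline : ∀ s : ℝ, HasDerivAt (fun s : ℝ => x + s • v) v s := fun s => by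
    simpa using ((hasDerivAt_id s).smul_const v).const_add x
  have hlim : Tendsto (fun s : ℝ => x + s • v) (𝓝 0) (𝓝 x) := by
    simpa using (hline 0).continuousAt.tendsto
  have hdiff : ∀ᶠ y in 𝓝 x, DifferentiableAt ℝ f y :=
    (hf.eventually (by simp)).mono fun y hy => hy.differentiableAt (by simp)
  have hg : g =ᶠ[𝓝 0] fun s => fderiv ℝ f (x + s • v) v := by
    filter_upwards [h1, hlim.eventually hdiff] with s hs hd
    exact hs.unique (hd.hasFDerivAt.comp_hasDerivAt s (hline s))
  have hd2 : HasFDerivAt (fderiv ℝ f) (fderiv ℝ (fderiv ℝ f) x) (x + (0 : ℝ) • v) := by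
    rw [zero_smul, add_zero]
    exact ((hf.fderiv_right (m := 1) (by norm_num)).differentiableAt (by simp)).hasFDerivAt
  have h3 : HasDerivAt (fun s : ℝ => fderiv ℝ f (x + s • v)) (fderiv ℝ (fderiv ℝ f) x v) 0 :=
    hd2.comp_hasDerivAt (0 : ℝ) (hline 0)
  have h4 : HasDerivAt (fun s : ℝ => fderiv ℝ f (x + s • v) v)
      (fderiv ℝ (fderiv ℝ f) x v v) 0 := by
    simpa using h3.clm_apply (hasDerivAt_const (0 : ℝ) v)
  rw [iteratedFDeriv_two_apply]
  exact h4.unique (h2.congr_of_eventuallyEq hg.symm)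

/-- The first two derivatives of `a (r s) F (l s)`. -/
lemma hasDerivAt_comp_mul_comp {a F : ℝ → ℝ} (ha : ContDiff ℝ (⊤ : ℕ∞) a)
    (hF : ContDiff ℝ (⊤ : ℕ∞) F) {r l r₁ l₁ : ℝ → ℝ} {r₂ l₂ : ℝ}
    (hr : ∀ᶠ s in 𝓝 (0 : ℝ), HasDerivAt r (r₁ s) s) (hr₁ : HasDerivAt r₁ r₂ 0)
    (hl : ∀ᶠ s in 𝓝 (0 : ℝ), HasDerivAt l (l₁ s) s) (hl₁ : HasDerivAt l₁ l₂ 0) :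
    ∃ g : ℝ → ℝ, (∀ᶠ s in 𝓝 (0 : ℝ), HasDerivAt (fun s => a (r s) * F (l s)) (g s) s) ∧
      HasDerivAt g (deriv (deriv a) (r 0) * r₁ 0 ^ 2 * F (l 0) + deriv a (r 0) * r₂ * F (l 0)
        + 2 * (deriv a (r 0) * deriv F (l 0)) * (r₁ 0 * l₁ 0)
        + a (r 0) * (deriv (deriv F) (l 0) * l₁ 0 ^ 2 + deriv F (l 0) * l₂)) 0 := by
  have h1 : ∀ {f : ℝ → ℝ}, ContDiff ℝ (⊤ : ℕ∞) f → ∀ x, HasDerivAt f (deriv f x) x :=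
    fun hf x => (hf.differentiable (by simp) x).hasDerivAt
  have h2 : ∀ {f : ℝ → ℝ}, ContDiff ℝ (⊤ : ℕ∞) f → ContDiff ℝ (⊤ : ℕ∞) (deriv f) := fun hf =>
    (contDiff_infty_iff_deriv.1 hf).2
  refine ⟨fun s => deriv a (r s) * r₁ s * F (l s) + a (r s) * (deriv F (l s) * l₁ s), ?_, ?_⟩
  · filter_upwards [hr, hl] with s hrs hls
    exact ((h1 ha _).comp s hrs).mul ((h1 hF _).comp s hls)
  · have hr0 := hr.self_of_nhds
    have hl0 := hl.self_of_nhds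
    have e := ((((h1 (h2 ha) _).comp 0 hr0).mul hr₁).mul ((h1 hF _).comp 0 hl0)).add
      (((h1 ha _).comp 0 hr0).mul (((h1 (h2 hF) _).comp 0 hl0).mul hl₁))
    refine e.congr_deriv ?_
    simp only [Function.comp, Pi.mul_apply]
    ring

/-! ### The generator on test functions -/

lemma hasDerivAt_log_add_sq {A b c s : ℝ} (h : 0 < A + (b + c * s) ^ 2) :
    HasDerivAt (fun s => Real.log (A + (b + c * s) ^ 2))
      (2 * c * (b + c * s) / (A + (b + c * s) ^ 2)) s := by
  have h1 : HasDerivAt (fun s : ℝ => b + c * s) c s := by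
    simpa using ((hasDerivAt_id s).const_mul c).const_add b
  refine (((h1.pow 2).const_add A).log h.ne').congr_deriv ?_
  simp only [Pi.pow_apply]
  push_cast
  ring

lemma hasDerivAt_log_add_sq_two {A b c s : ℝ} (h : 0 < A + (b + c * s) ^ 2) :
    HasDerivAt (fun s => 2 * c * (b + c * s) / (A + (b + c * s) ^ 2))
      (2 * c ^ 2 / (A + (b + c * s) ^ 2)
        - (2 * c * (b + c * s)) ^ 2 / (A + (b + c * s) ^ 2) ^ 2) s := by
  have h1 : HasDerivAt (fun s : ℝ => b + c * s) c s := by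
    simpa using ((hasDerivAt_id s).const_mul c).const_add b
  refine ((h1.const_mul (2 * c)).div ((h1.pow 2).const_add A) h.ne').congr_deriv ?_
  simp only [Pi.pow_apply]
  field_simp
  push_cast
  ring

lemma hasDerivAt_log_mul_add {c y s : ℝ} (hc : c ≠ 0) (h : 0 < y + s) :
    HasDerivAt (fun s => Real.log (c * (y + s))) (1 / (y + s)) s := by
  have h1 : HasDerivAt (fun s : ℝ => c * (y + s)) c s := by
    simpa using ((hasDerivAt_id s).const_add y).const_mul c
  refine (h1.log (mul_ne_zero hc h.ne')).congr_deriv ?_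
  field_simp

lemma hasDerivAt_one_div_add {y s : ℝ} (h : 0 < y + s) :
    HasDerivAt (fun s => 1 / (y + s)) (-1 / (y + s) ^ 2) s := by
  simpa using ((hasDerivAt_id s).const_add y).fun_inv h.ne'

/-- The squared hyperbolic gradients of `log cosh dist(·, i)` and of the Busemann function are
`1 - w` and `1`, their hyperbolic Laplacians are `1 + w` and `-1`, and `g` is the product of the two
gradients. -/
lemma exists_hypGenerator_testFunction_eq {a F : ℝ → ℝ} (ha : ContDiff ℝ (⊤ : ℕ∞) a)
    (hF : ContDiff ℝ (⊤ : ℕ∞) F) {p q : ℝ} (hpq : p ^ 2 + q ^ 2 = 1) {z : ℂ} (hz : 0 < z.im) :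
    ∃ w g : ℝ, 0 ≤ w ∧ w ≤ 1 ∧ |g| ≤ 1 ∧ hypGenerator (testFunction a F p q) z =
      deriv (deriv a) (logCoshDist z) * F (busemann p q z) * ((1 - w) / 2)
      + deriv a (logCoshDist z) * F (busemann p q z) * ((1 + w) / 2)
      + deriv a (logCoshDist z) * deriv F (busemann p q z) * g
      + a (logCoshDist z) *
        ((deriv (deriv F) (busemann p q z) - deriv F (busemann p q z)) / 2) := by
  have hsmooth : ContDiffAt ℝ 2 (fun z => a (logCoshDist z) * F (busemann p q z)) z :=
    ((ha.contDiffAt.comp z (contDiffAt_logCoshDist hz)).mul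
      (hF.contDiffAt.comp z (contDiffAt_busemann hpq hz))).of_le
      (WithTop.coe_le_coe.2 (le_top : (2 : ℕ∞) ≤ ⊤))
  obtain ⟨x, y⟩ := z
  replace hz : 0 < y := hz
  have hS0 : 0 < x ^ 2 + y ^ 2 + 1 := by positivity
  have hD0 : 0 < (p + q * x) ^ 2 + (q * y) ^ 2 := busemann_denom_pos hpq x hz
  have hnear : ∀ᶠ s in 𝓝 (0 : ℝ), 0 < y + s := by
    have : Tendsto (fun s : ℝ => y + s) (𝓝 0) (𝓝 (y + 0)) := tendsto_id.const_add y
    rw [add_zero] at this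
    exact this.eventually (lt_mem_nhds hz)
  have hx1 : ∀ s : ℝ, (⟨x, y⟩ : ℂ) + s • (1 : ℂ) = ⟨x + s, y⟩ := fun s => by
    apply Complex.ext <;> simp
  have hy1 : ∀ s : ℝ, (⟨x, y⟩ : ℂ) + s • Complex.I = ⟨x, y + s⟩ := fun s => by
    apply Complex.ext <;> simp
  -- first and second derivatives in the horizontal direction
  have hrx : ∀ s : ℝ, HasDerivAt (fun s => logCoshDist ((⟨x, y⟩ : ℂ) + s • (1 : ℂ)))
      (2 * 1 * (x + 1 * s) / ((y ^ 2 + 1) + (x + 1 * s) ^ 2)) s := fun s => by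
    refine ((hasDerivAt_log_add_sq (by positivity)).sub_const (Real.log (2 * y))
      ).congr_of_eventuallyEq (Eventually.of_forall fun s => ?_)
    simp only [hx1, logCoshDist]
    congr 2; ring
  have hrx2 := hasDerivAt_log_add_sq_two (A := y ^ 2 + 1) (b := x) (c := 1) (s := 0)
    (by positivity)
  have hDx : ∀ s : ℝ, 0 < (q * y) ^ 2 + ((p + q * x) + q * s) ^ 2 := fun s => by
    have := busemann_denom_pos hpq (x + s) hz
    linarith [show (p + q * (x + s)) ^ 2 = ((p + q * x) + q * s) ^ 2 by ring]
  have hlx : ∀ s : ℝ, HasDerivAt (fun s => busemann p q ((⟨x, y⟩ : ℂ) + s • (1 : ℂ)))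
      (-(2 * q * ((p + q * x) + q * s) / ((q * y) ^ 2 + ((p + q * x) + q * s) ^ 2))) s :=
    fun s => by
    refine ((hasDerivAt_log_add_sq (hDx s)).const_sub (Real.log y)).congr_of_eventuallyEq
      (Eventually.of_forall fun s => ?_)
    simp only [hx1, busemann]
    congr 2; ring
  have hlx2 := (hasDerivAt_log_add_sq_two (hDx 0)).neg
  -- first and second derivatives in the vertical direction
  have hry : ∀ᶠ s in 𝓝 (0 : ℝ), HasDerivAt (fun s => logCoshDist ((⟨x, y⟩ : ℂ) + s • Complex.I))
      (2 * 1 * (y + 1 * s) / ((x ^ 2 + 1) + (y + 1 * s) ^ 2) - 1 / (y + s)) s := by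
    filter_upwards [hnear] with s hs
    refine ((hasDerivAt_log_add_sq (by positivity)).sub
      (hasDerivAt_log_mul_add two_ne_zero hs)).congr_of_eventuallyEq
      (Eventually.of_forall fun s => ?_)
    simp only [hy1, logCoshDist, Pi.sub_apply]
    congr 2; ring
  have hry2 := (hasDerivAt_log_add_sq_two (A := x ^ 2 + 1) (b := y) (c := 1) (s := 0)
    (by positivity)).sub (hasDerivAt_one_div_add (y := y) (s := 0) (by simpa using hz))
  have hDy : ∀ s : ℝ, 0 < y + s → 0 < (p + q * x) ^ 2 + (q * y + q * s) ^ 2 := fun s hs => by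
    have := busemann_denom_pos hpq x hs
    rwa [mul_add] at this
  have hly : ∀ᶠ s in 𝓝 (0 : ℝ), HasDerivAt (fun s => busemann p q ((⟨x, y⟩ : ℂ) + s • Complex.I))
      (1 / (y + s) - 2 * q * (q * y + q * s) / ((p + q * x) ^ 2 + (q * y + q * s) ^ 2)) s := by
    filter_upwards [hnear] with s hs
    refine ((hasDerivAt_log_mul_add one_ne_zero hs).sub
      (hasDerivAt_log_add_sq (hDy s hs))).congr_of_eventuallyEq
      (Eventually.of_forall fun s => ?_)
    simp only [hy1, busemann, Pi.sub_apply, one_mul, mul_add]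
  have hly2 := (hasDerivAt_one_div_add (y := y) (s := 0) (by simpa using hz)).sub
    (hasDerivAt_log_add_sq_two (hDy 0 (by simpa using hz)))
  obtain ⟨gx, hgx, hgx2⟩ := hasDerivAt_comp_mul_comp ha hF (Eventually.of_forall hrx) hrx2
    (Eventually.of_forall hlx) hlx2
  obtain ⟨gy, hgy, hgy2⟩ := hasDerivAt_comp_mul_comp ha hF hry hry2 hly hly2
  have kx := iteratedFDeriv_two_eq_of_hasDerivAt hsmooth hgx hgx2
  have ky := iteratedFDeriv_two_eq_of_hasDerivAt hsmooth hgy hgy2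
  simp only [zero_smul, add_zero, mul_zero, mul_one, one_pow] at kx ky
  have hL : hypGenerator (testFunction a F p q) ⟨x, y⟩ = y ^ 2 / 2 *
      (iteratedFDeriv ℝ 2 (fun z => a (logCoshDist z) * F (busemann p q z)) ⟨x, y⟩ ![1, 1] +
      iteratedFDeriv ℝ 2 (fun z => a (logCoshDist z) * F (busemann p q z)) ⟨x, y⟩
        ![Complex.I, Complex.I]) := by
    rw [hypGenerator, (InnerProductSpace.laplacian_congr_nhds
      (testFunction_eventuallyEq a F p q (z := ⟨x, y⟩) hz)).self_of_nhds,
      InnerProductSpace.laplacian_eq_iteratedFDeriv_complexPlane]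
  rw [hL, kx, ky]
  clear hL kx ky hgx hgx2 hgy hgy2 hrx hrx2 hry hry2 hlx hlx2 hly hly2 hx1 hy1 hDx hDy hsmooth hnear
  generalize logCoshDist ⟨x, y⟩ = R
  generalize busemann p q ⟨x, y⟩ = L
  rw [show y ^ 2 + 1 + x ^ 2 = x ^ 2 + y ^ 2 + 1 by ring,
    show x ^ 2 + 1 + y ^ 2 = x ^ 2 + y ^ 2 + 1 by ring,
    add_comm ((q * y) ^ 2) ((p + q * x) ^ 2)]
  generalize p + q * x = m at *
  obtain ⟨D, hD⟩ : ∃ D, D = m ^ 2 + (q * y) ^ 2 := ⟨_, rfl⟩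
  rw [← hD] at hD0 ⊢
  set r₁ := 2 * x / (x ^ 2 + y ^ 2 + 1) with hr₁
  set r₂ := 2 * y / (x ^ 2 + y ^ 2 + 1) - 1 / y with hr₂
  set l₁ := -(2 * q * m / D) with hl₁
  set l₂ := 1 / y - 2 * q * (q * y) / D with hl₂
  set w := 4 * y ^ 2 / (x ^ 2 + y ^ 2 + 1) ^ 2 with hw
  have hrr : y ^ 2 * (r₁ ^ 2 + r₂ ^ 2) = 1 - w := by
    rw [hr₁, hr₂, hw]; field_simp; ring
  have hrΔ : y ^ 2 * ((2 / (x ^ 2 + y ^ 2 + 1) - (2 * x) ^ 2 / (x ^ 2 + y ^ 2 + 1) ^ 2) +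
      (2 / (x ^ 2 + y ^ 2 + 1) - (2 * y) ^ 2 / (x ^ 2 + y ^ 2 + 1) ^ 2 - -1 / y ^ 2)) = 1 + w := by
    rw [hw]; field_simp; ring
  have hll : y ^ 2 * (l₁ ^ 2 + l₂ ^ 2) = 1 := by
    have h : y ^ 2 * (l₁ ^ 2 + l₂ ^ 2) =
        1 + 4 * (q * y) ^ 2 * (m ^ 2 + (q * y) ^ 2 - D) / D ^ 2 := by
      rw [hl₁, hl₂]; field_simp; ring
    rw [h, ← hD, sub_self, mul_zero, zero_div, add_zero]
  have hlΔ : y ^ 2 * (-(2 * q ^ 2 / D -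
      (2 * q * m) ^ 2 / D ^ 2) + (-1 / y ^ 2 - (2 * q ^ 2 /
        D - (2 * q * (q * y)) ^ 2 / D ^ 2))) = -1 := by
    have h : y ^ 2 * (-(2 * q ^ 2 / D - (2 * q * m) ^ 2 / D ^ 2) +
        (-1 / y ^ 2 - (2 * q ^ 2 / D - (2 * q * (q * y)) ^ 2 / D ^ 2))) =
        -1 + 4 * (q * y) ^ 2 * (m ^ 2 + (q * y) ^ 2 - D) / D ^ 2 := by
      field_simp; ring
    rw [h, ← hD, sub_self, mul_zero, zero_div, add_zero]
  have hw0 : 0 ≤ w := by positivity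
  have hw1 : 0 ≤ 1 - w := by rw [← hrr]; positivity
  refine ⟨w, y ^ 2 * (r₁ * l₁ + r₂ * l₂), hw0, by linarith, ?_, ?_⟩
  · -- Cauchy-Schwarz
    rw [← sq_le_one_iff_abs_le_one]
    have : (y ^ 2 * (r₁ * l₁ + r₂ * l₂)) ^ 2 ≤
        (y ^ 2 * (r₁ ^ 2 + r₂ ^ 2)) * (y ^ 2 * (l₁ ^ 2 + l₂ ^ 2)) := by
      have h : 0 ≤ (y ^ 2 * (r₁ * l₂ - r₂ * l₁)) ^ 2 := sq_nonneg _
      linarith [h, show (y ^ 2 * (r₁ ^ 2 + r₂ ^ 2)) * (y ^ 2 * (l₁ ^ 2 + l₂ ^ 2)) =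
        (y ^ 2 * (r₁ * l₁ + r₂ * l₂)) ^ 2 + (y ^ 2 * (r₁ * l₂ - r₂ * l₁)) ^ 2 by ring]
    rw [hrr, hll] at this
    linarith
  · linear_combination (deriv (deriv a) R * F L / 2) * hrr + (deriv a R * F L / 2) * hrΔ
      + (a R * deriv (deriv F) L / 2) * hll + (a R * deriv F L / 2) * hlΔ

/-- On test functions the generator acts like `F ↦ (F'' - F') / 2` in the Busemann coordinate, up
to an error controlled by the derivatives of the cut-off. -/
lemma abs_hypGenerator_testFunction_sub_le {a F : ℝ → ℝ} (ha : ContDiff ℝ (⊤ : ℕ∞) a)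
    (hF : ContDiff ℝ (⊤ : ℕ∞) F) {p q : ℝ} (hpq : p ^ 2 + q ^ 2 = 1) {ε C : ℝ}
    (ha₁ : ∀ x, |deriv a x| ≤ ε) (ha₂ : ∀ x, |deriv (deriv a) x| ≤ ε)
    (hF₀ : ∀ x, |F x| ≤ C) (hF₁ : ∀ x, |deriv F x| ≤ C) {z : ℂ} (hz : 0 < z.im) :
    |hypGenerator (testFunction a F p q) z - a (logCoshDist z) *
      ((deriv (deriv F) (busemann p q z) - deriv F (busemann p q z)) / 2)| ≤ 3 * (ε * C) := by
  have hεC : ∀ {u v : ℝ}, |u| ≤ ε → |v| ≤ C → |u * v| ≤ ε * C := fun hu hv => by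
    rw [abs_mul]; exact mul_le_mul hu hv (abs_nonneg _) ((abs_nonneg _).trans hu)
  obtain ⟨w, g, hw0, hw1, hg, h⟩ := exists_hypGenerator_testFunction_eq ha hF hpq hz
  have h1 : ∀ {u v : ℝ}, |u| ≤ ε * C → |v| ≤ 1 → |u * v| ≤ ε * C := fun hu hv => by
    rw [abs_mul]; exact (mul_le_of_le_one_right (abs_nonneg _) hv).trans hu
  rw [h, add_sub_cancel_right]
  refine (abs_add_three _ _ _).trans ?_
  have e1 := h1 (hεC (ha₂ (logCoshDist z)) (hF₀ (busemann p q z)))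
    (v := (1 - w) / 2) (by rw [abs_le]; constructor <;> linarith)
  have e2 := h1 (hεC (ha₁ (logCoshDist z)) (hF₀ (busemann p q z)))
    (v := (1 + w) / 2) (by rw [abs_le]; constructor <;> linarith)
  have e3 := h1 (hεC (ha₁ (logCoshDist z)) (hF₁ (busemann p q z))) hg
  linarith

/-! ### The martingale problem for a Busemann coordinate -/

section

/-- A smooth cut-off, equal to `1` on `[-1, 1]` and supported in `[-2, 2]`. -/
noncomputable def cutoff : ContDiffBump (0 : ℝ) := ⟨1, 2, one_pos, one_lt_two⟩

lemma exists_bound_deriv_cutoff :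
    ∃ C, (∀ x, |deriv cutoff x| ≤ C) ∧ ∀ x, |deriv (deriv cutoff) x| ≤ C := by
  have hc : ContDiff ℝ (⊤ : ℕ∞) cutoff := cutoff.contDiff
  have hc1 : ContDiff ℝ (⊤ : ℕ∞) (deriv cutoff) := (contDiff_infty_iff_deriv.1 hc).2
  have hc2 : ContDiff ℝ (⊤ : ℕ∞) (deriv (deriv cutoff)) := (contDiff_infty_iff_deriv.1 hc1).2
  have hs : HasCompactSupport (cutoff : ℝ → ℝ) := cutoff.hasCompactSupport
  obtain ⟨C₁, h₁⟩ := hc1.continuous.bounded_above_of_compact_support hs.deriv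
  obtain ⟨C₂, h₂⟩ := hc2.continuous.bounded_above_of_compact_support hs.deriv.deriv
  exact ⟨max C₁ C₂, fun x => (h₁ x).trans (le_max_left _ _),
    fun x => (h₂ x).trans (le_max_right _ _)⟩

lemma deriv_cutoff_div (N x : ℝ) :
    deriv (fun x => cutoff (x / N)) x = deriv cutoff (x / N) / N := by
  simpa [div_eq_mul_inv, mul_comm] using deriv_comp_mul_left N⁻¹ (cutoff : ℝ → ℝ) x

lemma deriv_deriv_cutoff_div (N x : ℝ) :
    deriv (deriv fun x => cutoff (x / N)) x = deriv (deriv cutoff) (x / N) / N ^ 2 := by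
  have h : (deriv fun x => cutoff (x / N)) = fun x => deriv cutoff (x / N) / N :=
    funext (deriv_cutoff_div N)
  have h2 : deriv (fun x => deriv cutoff (x / N)) x = deriv (deriv cutoff) (x / N) / N := by
    simpa [div_eq_mul_inv, mul_comm] using deriv_comp_mul_left N⁻¹ (deriv cutoff) x
  rw [h, deriv_div_const, h2, div_div, sq]

lemma continuous_hypGenerator {f : ℂ → ℝ} (hf : ContDiff ℝ (⊤ : ℕ∞) f) :
    Continuous (hypGenerator f) := by
  have h2 : Continuous (iteratedFDeriv ℝ 2 f) :=
    hf.continuous_iteratedFDeriv (WithTop.coe_le_coe.2 (le_top : (2 : ℕ∞) ≤ ⊤))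
  have : hypGenerator f = fun z => z.im ^ 2 / 2 * (iteratedFDeriv ℝ 2 f z ![1, 1] +
      iteratedFDeriv ℝ 2 f z ![Complex.I, Complex.I]) := by
    ext z
    rw [hypGenerator, InnerProductSpace.laplacian_eq_iteratedFDeriv_complexPlane]
  rw [this]
  exact ((Complex.continuous_im.pow 2).div_const 2).mul ((h2.eval_const _).add (h2.eval_const _))

variable {Ω : Type*} [MeasurableSpace Ω] {P : Measure Ω} {X : ℝ≥0 → Ω → ℍ}

lemma measurable_of_isHypBrownian (hX : IsHypBrownian X P) (s : ℝ≥0) : Measurable (X s) := by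
  obtain ⟨𝓕, h, -⟩ := hX.martingale_problem
  exact (h s).mono (𝓕.le s) le_rfl

lemma integral_martingale_eq [IsProbabilityMeasure P] (hX : IsHypBrownian X P) {f : ℂ → ℝ}
    (hf : ContDiff ℝ (⊤ : ℕ∞) f) (hc : HasCompactSupport f) (hs : tsupport f ⊆ {z : ℂ | 0 < z.im})
    (t : ℝ≥0) :
    Integrable (fun ω => f (X t ω : ℂ) -
      ∫ s in (0 : ℝ)..(t : ℝ), hypGenerator f (X s.toNNReal ω : ℂ)) P ∧
    ∫ ω, (f (X t ω : ℂ) - ∫ s in (0 : ℝ)..(t : ℝ), hypGenerator f (X s.toNNReal ω : ℂ)) ∂P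
      = f Complex.I := by
  obtain ⟨𝓕, -, h⟩ := hX.martingale_problem
  have hM := h f hf hc hs
  refine ⟨hM.integrable t, ?_⟩
  have h1 := hM.setIntegral_eq (zero_le : (0 : ℝ≥0) ≤ t) MeasurableSet.univ
  rw [setIntegral_univ, setIntegral_univ] at h1
  rw [← h1]
  have h2 : (fun ω => f (X 0 ω : ℂ) - ∫ s in (0 : ℝ)..((0 : ℝ≥0) : ℝ),
      hypGenerator f (X s.toNNReal ω : ℂ)) =ᵐ[P] fun _ => f Complex.I := by
    filter_upwards [hX.start] with ω hω
    rw [hω]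
    simp
  rw [integral_congr_ae h2]
  simp

lemma continuous_busemann_coe {p q : ℝ} (hpq : p ^ 2 + q ^ 2 = 1) :
    Continuous fun z : ℍ => busemann p q z :=
  continuous_iff_continuousAt.2 fun z =>
    (contDiffAt_busemann hpq z.im_pos).continuousAt.comp UpperHalfPlane.continuous_coe.continuousAt

/-- The martingale problem for functions of a Busemann coordinate, which are not compactly
supported: they are cut off at a large distance from `i`. -/
lemma integral_busemann_sub_eq [IsProbabilityMeasure P] (hX : IsHypBrownian X P) {p q : ℝ}
    (hpq : p ^ 2 + q ^ 2 = 1) {F : ℝ → ℝ} (hF : ContDiff ℝ (⊤ : ℕ∞) F) {C : ℝ}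
    (hF₀ : ∀ x, |F x| ≤ C) (hF₁ : ∀ x, |deriv F x| ≤ C) (hF₂ : ∀ x, |deriv (deriv F) x| ≤ C)
    (t : ℝ≥0) :
    ∫ ω, (F (busemann p q (X t ω)) - ∫ s in (0 : ℝ)..(t : ℝ),
      (deriv (deriv F) (busemann p q (X s.toNNReal ω)) -
        deriv F (busemann p q (X s.toNNReal ω))) / 2) ∂P = F 0 := by
  obtain ⟨C₁, hC₁, hC₂⟩ := exists_bound_deriv_cutoff
  have hC₁0 : 0 ≤ C₁ := (abs_nonneg _).trans (hC₁ 0)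
  have hC0 : 0 ≤ C := (abs_nonneg _).trans (hF₀ 0)
  set a : ℕ → ℝ → ℝ := fun n x => cutoff (x / ((n : ℝ) + 1)) with ha
  have hn : ∀ n : ℕ, (0 : ℝ) < (n : ℝ) + 1 := fun n => by positivity
  have hn1 : ∀ n : ℕ, (1 : ℝ) ≤ (n : ℝ) + 1 := fun n => by simp
  have has : ∀ n, ContDiff ℝ (⊤ : ℕ∞) (a n) := fun n =>
    cutoff.contDiff.comp (contDiff_id.div_const _)
  have ha0 : ∀ n x, |a n x| ≤ 1 := fun n x => by
    rw [abs_of_nonneg cutoff.nonneg]; exact cutoff.le_one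
  have ha1 : ∀ (n : ℕ) x, |deriv (a n) x| ≤ C₁ / (n + 1) := fun n x => by
    rw [ha, deriv_cutoff_div, abs_div, abs_of_pos (hn n)]
    gcongr
    exact hC₁ _
  have ha2 : ∀ (n : ℕ) x, |deriv (deriv (a n)) x| ≤ C₁ / (n + 1) := fun n x => by
    rw [ha, deriv_deriv_cutoff_div, abs_div, abs_of_pos (pow_pos (hn n) 2)]
    exact div_le_div₀ hC₁0 (hC₂ _) (hn n) (le_self_pow₀ (hn1 n) two_ne_zero)
  have haR : ∀ (n : ℕ) x, 2 * ((n : ℝ) + 1) < x → a n x = 0 := fun n x hx => by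
    refine cutoff.zero_of_le_dist ?_
    change (2 : ℝ) ≤ _
    rw [dist_zero_right, Real.norm_eq_abs]
    exact ((le_div_iff₀ (hn n)).2 hx.le).trans (le_abs_self _)
  have halim : ∀ x, Tendsto (fun n => a n x) atTop (𝓝 1) := fun x => by
    refine tendsto_const_nhds.congr' ?_
    obtain ⟨m, hm⟩ := exists_nat_ge |x|
    filter_upwards [eventually_ge_atTop m] with n hmn
    refine (cutoff.one_of_mem_closedBall ?_).symm
    rw [mem_closedBall_zero_iff, Real.norm_eq_abs, abs_div, abs_of_pos (hn n)]
    change _ ≤ (1 : ℝ)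
    rw [div_le_one (hn n)]
    have : (m : ℝ) ≤ n := by exact_mod_cast hmn
    linarith
  set f : ℕ → ℂ → ℝ := fun n => testFunction (a n) F p q with hf
  set H : ℂ → ℝ := fun z => (deriv (deriv F) (busemann p q z) - deriv F (busemann p q z)) / 2
    with hH
  have hH0 : ∀ z, |H z| ≤ C := fun z => by
    rw [hH, abs_div, abs_two, div_le_iff₀ two_pos]
    exact (abs_sub _ _).trans (by linarith [hF₁ (busemann p q z), hF₂ (busemann p q z)])
  have hgen : ∀ (n : ℕ) (z : ℍ), |hypGenerator (f n) z - a n (logCoshDist z) * H z|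
      ≤ 3 * (C₁ / (n + 1) * C) := fun n z =>
    abs_hypGenerator_testFunction_sub_le (has n) hF hpq (ha1 n) (ha2 n) hF₀ hF₁ z.im_pos
  -- the derivatives of the cut-off at distance `n + 1` are `O(1 / (n + 1))`
  have hεlim : Tendsto (fun n : ℕ => 3 * (C₁ / ((n : ℝ) + 1) * C)) atTop (𝓝 0) := by
    have h := (tendsto_const_nhds (x := C₁)).div_atTop
      (tendsto_atTop_add_const_right atTop (1 : ℝ) tendsto_natCast_atTop_atTop)
    simpa using (h.mul_const C).const_mul 3
  have hgenlim : ∀ z : ℍ, Tendsto (fun n => hypGenerator (f n) z) atTop (𝓝 (H z)) := fun z => by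
    have h1 : Tendsto (fun n => hypGenerator (f n) z - a n (logCoshDist z) * H z) atTop (𝓝 0) :=
      squeeze_zero_norm (fun n => hgen n z) hεlim
    simpa using h1.add ((halim (logCoshDist z)).mul_const (H z))
  set K := 3 * (C₁ * C) + C with hK
  have hgenK : ∀ n (z : ℍ), |hypGenerator (f n) z| ≤ K := fun n z => by
    have h1 : |a n (logCoshDist z) * H z| ≤ C := by
      rw [abs_mul]
      exact (mul_le_of_le_one_left (abs_nonneg _) (ha0 n _)).trans (hH0 z)
    have h2 : 3 * (C₁ / (n + 1) * C) ≤ 3 * (C₁ * C) := by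
      gcongr
      exact div_le_self hC₁0 (hn1 n)
    have h3 := abs_add_le (hypGenerator (f n) z - a n (logCoshDist z) * H z)
      (a n (logCoshDist z) * H z)
    rw [sub_add_cancel] at h3
    linarith [hgen n z]
  have hfz : ∀ n (z : ℍ), f n z = a n (logCoshDist z) * F (busemann p q z) := fun n z =>
    if_pos z.im_pos
  have hfK : ∀ n (z : ℍ), |f n z| ≤ C := fun n z => by
    rw [hfz, abs_mul]
    exact (mul_le_of_le_one_left (abs_nonneg _) (ha0 n _)).trans (hF₀ _)
  have hflim : ∀ z : ℍ, Tendsto (fun n => f n z) atTop (𝓝 (F (busemann p q z))) := fun z => by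
    simp_rw [hfz]
    simpa using (halim (logCoshDist z)).mul_const (F (busemann p q z))
  have hfs : ∀ n, ContDiff ℝ (⊤ : ℕ∞) (f n) := fun n => contDiff_testFunction (has n) hF (haR n) hpq
  have hM := fun n => integral_martingale_eq hX (hfs n)
    (hasCompactSupport_testFunction (haR n) p q) (tsupport_testFunction_subset (haR n) p q) t
  have hpath : ∀ ω, Continuous fun s : ℝ => X s.toNNReal ω := fun ω =>
    (hX.continuous_paths ω).comp continuous_real_toNNReal
  have hlim : Tendsto (fun n => ∫ ω, (f n (X t ω : ℂ) -
      ∫ s in (0 : ℝ)..(t : ℝ), hypGenerator (f n) (X s.toNNReal ω : ℂ)) ∂P) atTop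
      (𝓝 (∫ ω, (F (busemann p q (X t ω)) - ∫ s in (0 : ℝ)..(t : ℝ), H (X s.toNNReal ω)) ∂P)) := by
    refine tendsto_integral_filter_of_dominated_convergence (fun _ => C + K * t)
      (Eventually.of_forall fun n => (hM n).1.aestronglyMeasurable)
      (Eventually.of_forall fun n => Eventually.of_forall fun ω => ?_) (integrable_const _)
      (Eventually.of_forall fun ω => ?_)
    · refine (norm_sub_le _ _).trans (add_le_add (hfK n _) ?_)
      refine (intervalIntegral.norm_integral_le_of_norm_le_const fun s _ =>
        hgenK n (X s.toNNReal ω)).trans ?_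
      rw [sub_zero, NNReal.abs_eq]
    · refine (hflim _).sub ?_
      refine intervalIntegral.tendsto_integral_filter_of_dominated_convergence (fun _ => K)
        (Eventually.of_forall fun n => ?_)
        (Eventually.of_forall fun n => Eventually.of_forall fun s _ => hgenK n _)
        intervalIntegrable_const (Eventually.of_forall fun s _ => hgenlim _)
      exact ((continuous_hypGenerator (hfs n)).comp
        (UpperHalfPlane.continuous_coe.comp (hpath ω))).aestronglyMeasurable
  refine tendsto_nhds_unique hlim (tendsto_const_nhds.congr' (Eventually.of_forall fun n => ?_))
  refine Eq.trans ?_ (hM n).2.symm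
  have h0 : f n Complex.I = a n (logCoshDist Complex.I) * F (busemann p q Complex.I) :=
    if_pos (by simp)
  have h1 : logCoshDist Complex.I = 0 := by norm_num [logCoshDist]
  have h2 : busemann p q Complex.I = 0 := by simp [busemann, hpq]
  have h3 : a n 0 = 1 := by
    refine cutoff.one_of_mem_closedBall ?_
    rw [zero_div]
    exact Metric.mem_closedBall_self zero_le_one
  rw [h0, h1, h2, h3, one_mul]

end

/-! ### Gaussian law of a Busemann coordinate -/

section

variable {Ω : Type*} [MeasurableSpace Ω] {P : Measure Ω} {X : ℝ≥0 → Ω → ℍ}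

lemma continuous_path_toNNReal (hX : IsHypBrownian X P) (ω : Ω) :
    Continuous fun s : ℝ => X s.toNNReal ω :=
  (hX.continuous_paths ω).comp continuous_real_toNNReal

lemma measurable_uncurry_toNNReal (hX : IsHypBrownian X P) :
    Measurable (Function.uncurry fun (s : ℝ) ω => X s.toNNReal ω) :=
  measurable_uncurry_of_continuous_of_measurable (continuous_path_toNNReal hX)
    fun _ => measurable_of_isHypBrownian hX _

lemma continuous_integral_comp [IsProbabilityMeasure P] (hX : IsHypBrownian X P) {h : ℍ → ℝ}
    (hc : Continuous h) {C : ℝ} (hC : ∀ z, |h z| ≤ C) :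
    Continuous fun s : ℝ => ∫ ω, h (X s.toNNReal ω) ∂P :=
  continuous_of_dominated (bound := fun _ => C)
    (fun _ => (hc.measurable.comp (measurable_of_isHypBrownian hX _)).aestronglyMeasurable)
    (fun _ => Eventually.of_forall fun _ => hC _) (integrable_const _)
    (Eventually.of_forall fun ω => hc.comp (continuous_path_toNNReal hX ω))

lemma integrable_comp [IsProbabilityMeasure P] (hX : IsHypBrownian X P) {h : ℍ → ℝ}
    (hc : Continuous h) {C : ℝ} (hC : ∀ z, |h z| ≤ C) (s : ℝ≥0) :
    Integrable (fun ω => h (X s ω)) P :=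
  (integrable_const C).mono'
    (hc.measurable.comp (measurable_of_isHypBrownian hX _)).aestronglyMeasurable
    (Eventually.of_forall fun _ => hC _)

/-- The expectation of a function of a Busemann coordinate solves the forward equation of Brownian
motion with drift `-1/2`. -/
lemma integral_busemann_eq_add [IsProbabilityMeasure P] (hX : IsHypBrownian X P) {p q : ℝ}
    (hpq : p ^ 2 + q ^ 2 = 1) {F : ℝ → ℝ} (hF : ContDiff ℝ (⊤ : ℕ∞) F) {C : ℝ}
    (hF₀ : ∀ x, |F x| ≤ C) (hF₁ : ∀ x, |deriv F x| ≤ C) (hF₂ : ∀ x, |deriv (deriv F) x| ≤ C)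
    (t : ℝ≥0) :
    ∫ ω, F (busemann p q (X t ω)) ∂P = F 0 + ∫ s in (0 : ℝ)..(t : ℝ),
      ∫ ω, (deriv (deriv F) (busemann p q (X s.toNNReal ω)) -
        deriv F (busemann p q (X s.toNNReal ω))) / 2 ∂P := by
  set H : ℍ → ℝ := fun z => (deriv (deriv F) (busemann p q z) - deriv F (busemann p q z)) / 2
    with hH
  have hF' : ContDiff ℝ (⊤ : ℕ∞) (deriv F) := (contDiff_infty_iff_deriv.1 hF).2
  have hF'' : ContDiff ℝ (⊤ : ℕ∞) (deriv (deriv F)) := (contDiff_infty_iff_deriv.1 hF').2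
  have hbc := continuous_busemann_coe hpq
  have hHc : Continuous H :=
    ((hF''.continuous.comp hbc).sub (hF'.continuous.comp hbc)).div_const 2
  have hH0 : ∀ z, |H z| ≤ C := fun z => by
    rw [hH, abs_div, abs_two, div_le_iff₀ two_pos]
    exact (abs_sub _ _).trans (by linarith [hF₁ (busemann p q z), hF₂ (busemann p q z)])
  have hprod : Integrable (Function.uncurry fun ω (s : ℝ) => H (X s.toNNReal ω))
      (P.prod (volume.restrict (Ioc (0 : ℝ) t))) := by
    refine (integrable_const C).mono' ?_ (Eventually.of_forall fun _ => hH0 _)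
    exact (hHc.measurable.comp
      ((measurable_uncurry_toNNReal hX).comp measurable_swap)).aestronglyMeasurable
  have h : ∫ ω, (F (busemann p q (X t ω)) - ∫ s in (0 : ℝ)..(t : ℝ), H (X s.toNNReal ω)) ∂P
      = F 0 := integral_busemann_sub_eq hX hpq hF hF₀ hF₁ hF₂ t
  have hFint : Integrable (fun ω => F (busemann p q (X t ω))) P :=
    integrable_comp hX (hF.continuous.comp hbc) (fun _ => hF₀ _) t
  have hswap : ∫ ω, (∫ s in (0 : ℝ)..(t : ℝ), H (X s.toNNReal ω)) ∂P =
      ∫ s in (0 : ℝ)..(t : ℝ), ∫ ω, H (X s.toNNReal ω) ∂P := by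
    simp_rw [intervalIntegral.integral_of_le t.coe_nonneg]
    exact integral_integral_swap hprod
  have hint : Integrable (fun ω => ∫ s in (0 : ℝ)..(t : ℝ), H (X s.toNNReal ω)) P := by
    simp_rw [intervalIntegral.integral_of_le t.coe_nonneg]
    exact hprod.integral_prod_left
  rw [integral_sub hFint hint, hswap] at h
  linarith

lemma eq_exp_of_integral_equation {φ : ℝ → ℂ} (hφ : Continuous φ) {c : ℂ}
    (h : ∀ t : ℝ, 0 ≤ t → φ t = 1 + ∫ s in (0 : ℝ)..t, c * φ s) {t : ℝ} (ht : 0 ≤ t) :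
    φ t = Complex.exp (c * t) := by
  have hderiv : ∀ x : ℝ, 0 ≤ x → HasDerivWithinAt φ (c * φ x) (Ici x) x := fun x hx => by
    have h1 : HasDerivAt (fun t : ℝ => 1 + ∫ s in (0 : ℝ)..t, c * φ s) (c * φ x) x :=
      ((hφ.const_mul c).integral_hasStrictDerivAt 0 x).hasDerivAt.const_add 1
    exact h1.hasDerivWithinAt.congr (fun y hy => h y (hx.trans hy)) (h x hx)
  have hexp : ∀ x : ℝ, HasDerivAt (fun s : ℝ => Complex.exp (-(c * s)))
      (Complex.exp (-(c * x)) * -c) x := fun x => by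
    have : HasDerivAt (fun s : ℝ => -(c * (s : ℂ))) (-c) x := by
      simpa using (((hasDerivAt_id (x : ℂ)).comp_ofReal).const_mul c).fun_neg
    exact this.cexp
  have hconst := constant_of_has_deriv_right_zero (a := 0) (b := t)
    (f := fun s : ℝ => φ s * Complex.exp (-(c * s))) (by fun_prop)
    (fun x hx => ((hderiv x hx.1).mul (hexp x).hasDerivWithinAt).congr_deriv (by ring))
    t ⟨ht, le_rfl⟩
  have h0 : φ 0 = 1 := by simpa using h 0 le_rfl
  simp only [h0, Complex.ofReal_zero, mul_zero, neg_zero, Complex.exp_zero, mul_one] at hconst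
  rw [Complex.exp_neg] at hconst
  exact (mul_inv_eq_one₀ (Complex.exp_ne_zero _)).1 hconst

/-- The Busemann coordinate of hyperbolic Brownian motion is Gaussian, with mean `-s / 2` and
variance `s`. -/
lemma map_busemann [IsProbabilityMeasure P] (hX : IsHypBrownian X P) {p q : ℝ}
    (hpq : p ^ 2 + q ^ 2 = 1) (s : ℝ≥0) :
    P.map (fun ω => busemann p q (X s ω)) = gaussianReal (-(s / 2)) s := by
  have hbc := continuous_busemann_coe hpq
  have hm : ∀ s, Measurable fun ω => busemann p q (X s ω) := fun s =>
    hbc.measurable.comp (measurable_of_isHypBrownian hX s)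
  have := Measure.isProbabilityMeasure_map (μ := P) (hm s).aemeasurable
  refine Measure.ext_of_charFun (funext fun θ => ?_)
  rw [charFun_gaussianReal, charFun_apply_real, integral_map (hm s).aemeasurable
    (by fun_prop)]
  have hcos : ContDiff ℝ (⊤ : ℕ∞) fun x => Real.cos (θ * x) := by fun_prop
  have hsin : ContDiff ℝ (⊤ : ℕ∞) fun x => Real.sin (θ * x) := by fun_prop
  have hlin : ∀ x, HasDerivAt (fun x => θ * x) θ x := fun x => hasDerivAt_const_mul θ
  have hdc : deriv (fun x => Real.cos (θ * x)) = fun x => -θ * Real.sin (θ * x) :=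
    funext fun x => (hlin x).cos.deriv.trans (by ring)
  have hds : deriv (fun x => Real.sin (θ * x)) = fun x => θ * Real.cos (θ * x) :=
    funext fun x => (hlin x).sin.deriv.trans (by ring)
  have hdc2 : deriv (fun x => -θ * Real.sin (θ * x)) = fun x => -θ ^ 2 * Real.cos (θ * x) :=
    funext fun x => ((hlin x).sin.const_mul (-θ)).deriv.trans (by ring)
  have hds2 : deriv (fun x => θ * Real.cos (θ * x)) = fun x => -θ ^ 2 * Real.sin (θ * x) :=
    funext fun x => ((hlin x).cos.const_mul θ).deriv.trans (by ring)
  -- a common bound for `cos (θ x)`, `sin (θ x)` and their first two derivatives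
  set C := 1 + |θ| + θ ^ 2 with hC
  have hb : ∀ {k u : ℝ}, |k| ≤ C → |u| ≤ 1 → |k * u| ≤ C := fun hk hu => by
    rw [abs_mul]; exact (mul_le_of_le_one_right (abs_nonneg _) hu).trans hk
  have hk1 : |θ| ≤ C := by rw [hC]; nlinarith [abs_nonneg θ, sq_nonneg θ]
  have hk1' : |-θ| ≤ C := by rwa [abs_neg]
  have hk2 : |-θ ^ 2| ≤ C := by
    rw [abs_neg, abs_of_nonneg (sq_nonneg θ), hC]; linarith [abs_nonneg θ]
  have hk0 : (1 : ℝ) ≤ C := by rw [hC]; nlinarith [abs_nonneg θ, sq_nonneg θ]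
  have hec := fun t => integral_busemann_eq_add hX hpq hcos (C := C)
    (fun x => (Real.abs_cos_le_one _).trans hk0)
    (fun x => by rw [hdc]; exact hb hk1' (Real.abs_sin_le_one _))
    (fun x => by rw [hdc, hdc2]; exact hb hk2 (Real.abs_cos_le_one _)) t
  have hes := fun t => integral_busemann_eq_add hX hpq hsin (C := C)
    (fun x => (Real.abs_sin_le_one _).trans hk0)
    (fun x => by rw [hds]; exact hb hk1 (Real.abs_cos_le_one _))
    (fun x => by rw [hds, hds2]; exact hb hk2 (Real.abs_sin_le_one _)) t
  rw [hdc, hdc2] at hec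
  rw [hds, hds2] at hes
  -- `u + i v` is the characteristic function at `θ`, as a function of time
  set u : ℝ → ℝ := fun t => ∫ ω, Real.cos (θ * busemann p q (X t.toNNReal ω)) ∂P with hu
  set v : ℝ → ℝ := fun t => ∫ ω, Real.sin (θ * busemann p q (X t.toNNReal ω)) ∂P with hv
  have hcc : Continuous fun z : ℍ => Real.cos (θ * busemann p q z) := by fun_prop
  have hsc : Continuous fun z : ℍ => Real.sin (θ * busemann p q z) := by fun_prop
  have huc : Continuous u := continuous_integral_comp hX hcc fun _ => Real.abs_cos_le_one _
  have hvc : Continuous v := continuous_integral_comp hX hsc fun _ => Real.abs_sin_le_one _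
  have hic : ∀ t : ℝ≥0, Integrable (fun ω => Real.cos (θ * busemann p q (X t ω))) P := fun t =>
    integrable_comp hX hcc (fun _ => Real.abs_cos_le_one _) t
  have his : ∀ t : ℝ≥0, Integrable (fun ω => Real.sin (θ * busemann p q (X t ω))) P := fun t =>
    integrable_comp hX hsc (fun _ => Real.abs_sin_le_one _) t
  have heu : ∀ t : ℝ, 0 ≤ t → u t = 1 + ∫ s in (0 : ℝ)..t, (-θ ^ 2 * u s + θ * v s) / 2 :=
    fun t ht => by
      have h := hec t.toNNReal
      rw [Real.coe_toNNReal t ht, mul_zero, Real.cos_zero] at h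
      rw [hu]
      refine h.trans ?_
      congr 1
      refine intervalIntegral.integral_congr fun s _ => ?_
      dsimp only
      rw [integral_div, integral_sub ((hic _).const_mul _) ((his _).const_mul _),
        integral_const_mul, integral_const_mul]
      ring
  have hev : ∀ t : ℝ, 0 ≤ t → v t = ∫ s in (0 : ℝ)..t, (-θ ^ 2 * v s - θ * u s) / 2 :=
    fun t ht => by
      have h := hes t.toNNReal
      rw [Real.coe_toNNReal t ht, mul_zero, Real.sin_zero, zero_add] at h
      rw [hv]
      refine h.trans ?_
      refine intervalIntegral.integral_congr fun s _ => ?_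
      dsimp only
      rw [integral_div, integral_sub ((his _).const_mul _) ((hic _).const_mul _),
        integral_const_mul, integral_const_mul]
  have hφ := eq_exp_of_integral_equation (φ := fun t => (u t : ℂ) + v t * Complex.I)
    (c := -(θ ^ 2 + θ * Complex.I) / 2) (by fun_prop) (fun t ht => by
      have hi1 : IntervalIntegrable (fun s => (((-θ ^ 2 * u s + θ * v s) / 2 : ℝ) : ℂ))
          volume 0 t :=
        Continuous.intervalIntegrable (by fun_prop) _ _
      have hi2 : IntervalIntegrable
          (fun s => (((-θ ^ 2 * v s - θ * u s) / 2 : ℝ) : ℂ) * Complex.I) volume 0 t :=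
        Continuous.intervalIntegrable (by fun_prop) _ _
      rw [heu t ht, hev t ht]
      push_cast [← intervalIntegral.integral_ofReal]
      rw [add_assoc, ← intervalIntegral.integral_mul_const, ← intervalIntegral.integral_add
        (by simpa using hi1) (by simpa using hi2)]
      congr 1
      refine intervalIntegral.integral_congr fun s _ => ?_
      linear_combination ((θ : ℂ) * v s / 2) * Complex.I_sq) s.coe_nonneg
  have hchar : ∫ ω, Complex.exp (θ * busemann p q (X s ω) * Complex.I) ∂P =
      (u s : ℂ) + v s * Complex.I := by
    simp only [hu, hv, Real.toNNReal_coe]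
    rw [← integral_complex_ofReal, ← integral_complex_ofReal, ← integral_mul_const, ← integral_add
      (hic s).ofReal ((his s).ofReal.mul_const _)]
    refine integral_congr_ae (Eventually.of_forall fun ω => ?_)
    dsimp only
    rw [Complex.exp_mul_I]
    push_cast
    rfl
  rw [hchar]
  refine hφ.trans ?_
  congr 1
  push_cast
  ring

end

/-! ### Averaging over Busemann functions -/

/-- The kernel whose average over all Busemann coordinates of a point at distance `r` from `i` is
the indicator of `η < r`: it inverts the horocyclic Radon transform on radial indicators. -/
noncomputable def horocycleKernel (η : ℝ) : ℝ → ℝ≥0∞ :=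
  (Ioi η).indicator fun v =>
    ENNReal.ofReal (√2 * Real.exp (-v / 2) * (Real.sinh v / √(Real.cosh v - Real.cosh η)))

lemma measurable_horocycleKernel (η : ℝ) : Measurable (horocycleKernel η) :=
  Measurable.indicator (by fun_prop) measurableSet_Ioi

/-- The factor `e^{-v / 2}` of the kernel cancels the drift of the Gaussian. -/
lemma lintegral_horocycleKernel_gaussianReal (η : ℝ) {s : ℝ≥0} (hs : 0 < s) :
    ∫⁻ v, horocycleKernel η v ∂gaussianReal (s / 2) s = radialTail η s := by
  have hs' : (0 : ℝ) < s := hs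
  rw [gaussianReal_of_var_ne_zero _ hs.ne',
    lintegral_withDensity_eq_lintegral_mul _ (measurable_gaussianPDF _ _)
      (measurable_horocycleKernel η), radialTail, ← lintegral_indicator measurableSet_Ioi]
  refine lintegral_congr fun v => ?_
  rw [Pi.mul_apply, horocycleKernel]
  by_cases hv : v ∈ Ioi η
  · rw [indicator_of_mem hv, indicator_of_mem hv, gaussianPDF, ← ENNReal.ofReal_mul
      (gaussianPDFReal_nonneg _ _ _), gaussianPDFReal]
    congr 1
    have h1 : √(2 * Real.pi * s) = √2 * √(Real.pi * s) := by
      rw [mul_assoc, Real.sqrt_mul (by norm_num)]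
    have h2 : Real.exp (-(v - s / 2) ^ 2 / (2 * s)) * Real.exp (-v / 2) =
        Real.exp (-s / 8) * Real.exp (-v ^ 2 / (2 * s)) := by
      rw [← Real.exp_add, ← Real.exp_add]
      congr 1
      field_simp
      ring
    have h3 : √(Real.pi * s) ≠ 0 := (Real.sqrt_pos.2 (by positivity)).ne'
    rw [h1]
    calc (√2 * √(Real.pi * s))⁻¹ * Real.exp (-(v - s / 2) ^ 2 / (2 * s)) *
          (√2 * Real.exp (-v / 2) * (Real.sinh v / √(Real.cosh v - Real.cosh η)))
        = (Real.exp (-(v - s / 2) ^ 2 / (2 * s)) * Real.exp (-v / 2)) / √(Real.pi * s) *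
          (Real.sinh v / √(Real.cosh v - Real.cosh η)) := by field_simp
      _ = _ := by rw [h2]; ring
  · rw [indicator_of_notMem hv, indicator_of_notMem hv, mul_zero]

/-- An antiderivative of `-sinh v / √((cosh v - a) (b - cosh v))`, along a curve `v = V x`. -/
lemma hasDerivAt_arcsin_cosh {a b v v' x : ℝ} {V : ℝ → ℝ} (hV : HasDerivAt V v' x)
    (hv : V x = v) (ha : a < Real.cosh v) (hb : Real.cosh v < b) :
    HasDerivAt (fun x => -Real.arcsin ((2 * Real.cosh (V x) - a - b) / (b - a)))
      (-v' * Real.sinh v / (√(Real.cosh v - a) * √(b - Real.cosh v))) x := by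
  subst hv
  set c := Real.cosh (V x) with hc
  have hba : 0 < b - a := by linarith
  have hw1 : (2 * c - a - b) / (b - a) ≠ -1 := by
    rw [Ne, div_eq_iff hba.ne']; intro h; linarith
  have hw2 : (2 * c - a - b) / (b - a) ≠ 1 := by
    rw [Ne, div_eq_iff hba.ne']; intro h; linarith
  have h1 : HasDerivAt (fun x => (2 * Real.cosh (V x) - a - b) / (b - a))
      (2 * (Real.sinh (V x) * v') / (b - a)) x :=
    (((hV.cosh.const_mul 2).sub_const a).sub_const b).div_const _
  have h2 := ((Real.hasDerivAt_arcsin hw1 hw2).comp x h1).fun_neg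
  refine h2.congr_deriv ?_
  have hsq : √(1 - ((2 * c - a - b) / (b - a)) ^ 2) =
      2 * (√(c - a) * √(b - c)) / (b - a) := by
    rw [← Real.sqrt_mul (by linarith)]
    have : 1 - ((2 * c - a - b) / (b - a)) ^ 2 = (2 / (b - a)) ^ 2 * ((c - a) * (b - c)) := by
      field_simp; ring
    rw [this, Real.sqrt_mul (sq_nonneg _), Real.sqrt_sq (by positivity)]
    ring
  rw [hsq]
  have e1 : √(c - a) ≠ 0 := (Real.sqrt_pos.2 (by linarith)).ne'
  have e2 : √(b - c) ≠ 0 := (Real.sqrt_pos.2 (by linarith)).ne'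
  field_simp

/-- With `e^v = cosh r + sinh r cos β`, the substitution `x = cosh v` turns the average into
`∫ dx / √((x - cosh η) (cosh r - x)) = π`, over `cosh η < x < cosh r`. -/
lemma lintegral_horocycleKernel_log {η r : ℝ} (hη : 0 ≤ η) (hr : 0 ≤ r) :
    ∫⁻ β in Ioo 0 Real.pi, horocycleKernel η
      (Real.log (Real.cosh r + Real.sinh r * Real.cos β)) =
      (Ioi η).indicator (fun _ => ENNReal.ofReal Real.pi) r := by
  set E : ℝ → ℝ := fun β => Real.cosh r + Real.sinh r * Real.cos β with hE
  have hsr : 0 ≤ Real.sinh r := Real.sinh_nonneg_iff.2 hr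
  have hE0 : ∀ β, 0 < E β := fun β => by
    have h1 := mul_le_mul_of_nonneg_left (Real.neg_one_le_cos β) hsr
    have h2 := Real.exp_pos (-r)
    rw [← Real.cosh_sub_sinh] at h2
    simp only [hE]; linarith
  have hEr : ∀ β, Real.log (E β) ≤ r := fun β => by
    rw [Real.log_le_iff_le_exp (hE0 β), ← Real.cosh_add_sinh]
    have h1 := mul_le_mul_of_nonneg_left (Real.cos_le_one β) hsr
    simp only [hE]; linarith
  rcases le_or_gt r η with hrη | hrη
  · rw [indicator_of_notMem (by simpa using hrη)]
    refine (setLIntegral_congr_fun (g := fun _ => 0) measurableSet_Ioo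
      fun β _ => ?_).trans (by simp)
    exact indicator_of_notMem (by simpa using (hEr β).trans hrη) _
  rw [indicator_of_mem (mem_Ioi.2 hrη)]
  have hr0 : 0 < r := hη.trans_lt hrη
  have hs0 : 0 < Real.sinh r := Real.sinh_pos_iff.2 hr0
  -- `η < v` holds exactly for `β < β₀ = arccos k`
  set k := (Real.exp η - Real.cosh r) / Real.sinh r with hk
  have hk1 : k ≤ 1 := by
    rw [hk, div_le_one hs0, sub_le_iff_le_add, add_comm, Real.cosh_add_sinh]
    exact Real.exp_le_exp.2 hrη.le
  have hk2 : -1 ≤ k := by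
    rw [hk, le_div_iff₀ hs0]
    have h1 : Real.exp (-r) ≤ Real.exp η := Real.exp_le_exp.2 (by linarith)
    rw [← Real.cosh_sub_sinh] at h1
    linarith
  set β₀ := Real.arccos k with hβ₀
  have hcosβ₀ : Real.cos β₀ = k := Real.cos_arccos hk2 hk1
  have hlt : ∀ β ∈ Icc 0 Real.pi, (β < β₀ ↔ η < Real.log (E β)) := fun β hβ => by
    rw [Real.lt_log_iff_exp_lt (hE0 β), ← Real.strictAntiOn_cos.lt_iff_gt
      ⟨Real.arccos_nonneg k, Real.arccos_le_pi k⟩ hβ, hcosβ₀, hk, div_lt_iff₀ hs0]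
    simp only [hE]
    constructor <;> intro h <;> linarith
  have hπ : β₀ ≤ Real.pi := Real.arccos_le_pi k
  have h0 : 0 ≤ β₀ := Real.arccos_nonneg k
  set a := Real.cosh η with ha
  set b := Real.cosh r with hb
  set F' : ℝ → ℝ := fun β => √2 * Real.exp (-Real.log (E β) / 2) *
    (Real.sinh (Real.log (E β)) / √(Real.cosh (Real.log (E β)) - a)) with hF'
  have hrestrict : ∫⁻ β in Ioo 0 Real.pi, horocycleKernel η (Real.log (E β)) =
      ∫⁻ β in Ioo 0 β₀, ENNReal.ofReal (F' β) := by
    rw [← lintegral_indicator measurableSet_Ioo, ← lintegral_indicator measurableSet_Ioo]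
    refine lintegral_congr fun β => ?_
    by_cases h1 : β ∈ Ioo 0 Real.pi
    · have h2 := hlt β ⟨h1.1.le, h1.2.le⟩
      rw [indicator_of_mem h1, horocycleKernel]
      by_cases h3 : β < β₀
      · rw [indicator_of_mem (mem_Ioi.2 (h2.1 h3)), indicator_of_mem (mem_Ioo.2 ⟨h1.1, h3⟩)]
      · rw [indicator_of_notMem (s := Ioi η) (fun h => h3 (h2.2 h)),
          indicator_of_notMem fun h => h3 h.2]
    · rw [indicator_of_notMem h1, indicator_of_notMem fun h => h1 ⟨h.1, h.2.trans_le hπ⟩]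
  have hder : ∀ β ∈ Ioo 0 β₀, HasDerivAt
      (fun β => -Real.arcsin ((2 * Real.cosh (Real.log (E β)) - a - b) / (b - a))) (F' β) β := by
    intro β hβ
    have hβπ : β < Real.pi := hβ.2.trans_le hπ
    have hv1 : η < Real.log (E β) := (hlt β ⟨hβ.1.le, hβπ.le⟩).1 hβ.2
    have hv2 : Real.log (E β) < r := by
      rw [Real.log_lt_iff_lt_exp (hE0 β), ← Real.cosh_add_sinh]
      have : Real.cos β < 1 := by
        simpa using Real.strictAntiOn_cos ⟨le_rfl, Real.pi_pos.le⟩ ⟨hβ.1.le, hβπ.le⟩ hβ.1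
      have h1 := mul_lt_mul_of_pos_left this hs0
      simp only [hE]; linarith
    have hV : HasDerivAt (fun β => Real.log (E β)) (-(Real.sinh r * Real.sin β) / E β) β := by
      refine ((((Real.hasDerivAt_cos β).const_mul (Real.sinh r)).const_add _).log
        (hE0 β).ne').congr_deriv ?_
      ring
    have hca : a < Real.cosh (Real.log (E β)) := Real.cosh_lt_cosh.2 (by
      rwa [abs_of_nonneg hη, abs_of_nonneg (hη.trans hv1.le)])
    have hcb : Real.cosh (Real.log (E β)) < b := Real.cosh_lt_cosh.2 (by
      rwa [abs_of_nonneg hr, abs_of_nonneg (hη.trans hv1.le)])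
    refine (hasDerivAt_arcsin_cosh hV rfl hca hcb).congr_deriv ?_
    -- `sinh r sin β = √(2 E) √(cosh r - cosh v)`, where `E = exp v`
    have hsin : Real.sinh r * Real.sin β = √2 * Real.exp (Real.log (E β) / 2) *
        √(b - Real.cosh (Real.log (E β))) := by
      have hpos : 0 ≤ Real.sinh r * Real.sin β :=
        mul_nonneg hs0.le (Real.sin_nonneg_of_nonneg_of_le_pi hβ.1.le hβπ.le)
      rw [← Real.sqrt_sq hpos, Real.exp_half, Real.exp_log (hE0 β),
        ← Real.sqrt_mul (by norm_num), ← Real.sqrt_mul (by have := hE0 β; positivity)]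
      congr 1
      rw [Real.cosh_log (hE0 β), hb]
      have hne := (hE0 β).ne'
      field_simp
      have h1 := Real.cosh_sq r
      have h2 := Real.sin_sq_add_cos_sq β
      simp only [hE]
      linear_combination (Real.sinh r ^ 2) * h2 - h1
    have hexp : Real.exp (-Real.log (E β) / 2) = Real.exp (Real.log (E β) / 2) / E β := by
      rw [eq_div_iff (hE0 β).ne']
      conv_lhs => rw [← Real.exp_log (hE0 β), Real.log_exp]
      rw [← Real.exp_add]
      congr 1; ring
    have e1 : √(Real.cosh (Real.log (E β)) - a) ≠ 0 := (Real.sqrt_pos.2 (by linarith)).ne'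
    have e2 : √(b - Real.cosh (Real.log (E β))) ≠ 0 := (Real.sqrt_pos.2 (by linarith)).ne'
    have e3 := (hE0 β).ne'
    rw [hF', hsin]
    dsimp only
    rw [hexp]
    field_simp
  have hnn : ∀ β ∈ Ioo 0 β₀, 0 ≤ F' β := fun β hβ => by
    have hv1 : η < Real.log (E β) := (hlt β ⟨hβ.1.le, (hβ.2.trans_le hπ).le⟩).1 hβ.2
    have : 0 ≤ Real.sinh (Real.log (E β)) := Real.sinh_nonneg_iff.2 (hη.trans hv1.le)
    simp only [hF']; positivity
  have hcont : Continuous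
      fun β => -Real.arcsin ((2 * Real.cosh (Real.log (E β)) - a - b) / (b - a)) := by
    have : Continuous fun β => Real.log (E β) :=
      (by fun_prop : Continuous E).log fun β => (hE0 β).ne'
    fun_prop
  rw [hrestrict, lintegral_Ioo_of_hasDerivAt_of_nonneg h0 hcont.continuousOn hder hnn]
  have hab : a < b := Real.cosh_lt_cosh.2 (by rwa [abs_of_nonneg hη, abs_of_nonneg hr])
  have hv0 : Real.log (E 0) = r := by
    simp only [hE, Real.cos_zero, mul_one, hb]
    rw [Real.cosh_add_sinh, Real.log_exp]
  have hvβ : Real.log (E β₀) = η := by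
    simp only [hE, hcosβ₀, hk]
    rw [mul_div_cancel₀ _ hs0.ne', add_sub_cancel, Real.log_exp]
  congr 1
  rw [hv0, hvβ, show (2 * a - a - b) / (b - a) = -1 by rw [div_eq_iff (by linarith)]; ring,
    show (2 * b - a - b) / (b - a) = 1 by rw [div_eq_iff (by linarith)]; ring,
    Real.arcsin_neg, Real.arcsin_one]
  ring

/-! ### The radial part of hyperbolic Brownian motion -/

section

lemma lintegral_Ioc_neg_pi_pi_comp_cos {f : ℝ → ℝ≥0∞} (hf : Measurable f) :
    ∫⁻ β in Ioc (-Real.pi) Real.pi, f (Real.cos β) = 2 * ∫⁻ β in Ioo 0 Real.pi, f (Real.cos β) := by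
  have hfc : Measurable fun β => f (Real.cos β) := hf.comp Real.measurable_cos
  have hm : Measurable ((Ioo (-Real.pi) Real.pi).indicator fun β => f (Real.cos β)) :=
    hfc.indicator measurableSet_Ioo
  rw [setLIntegral_congr Ioo_ae_eq_Ioc.symm, ← lintegral_indicator measurableSet_Ioo,
    lintegral_eq_lintegral_Ioi_add_neg hm, ← lintegral_const_mul _ hfc,
    ← lintegral_indicator measurableSet_Ioi, ← lintegral_indicator measurableSet_Ioo]
  refine lintegral_congr fun β => ?_
  by_cases h0 : 0 < β
  · rw [indicator_of_mem (mem_Ioi.2 h0)]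
    by_cases h1 : β < Real.pi
    · rw [indicator_of_mem (mem_Ioo.2 ⟨by linarith, h1⟩),
        indicator_of_mem (mem_Ioo.2 ⟨by linarith, by linarith⟩), Real.cos_neg,
        indicator_of_mem (mem_Ioo.2 ⟨h0, h1⟩), two_mul]
    · rw [indicator_of_notMem fun h => h1 h.2, indicator_of_notMem fun h => h1 (by linarith [h.1]),
        indicator_of_notMem fun h => h1 h.2, add_zero]
  · rw [indicator_of_notMem (s := Ioi 0) h0, indicator_of_notMem fun h => h0 h.1]

lemma lintegral_Ioc_comp_sub_of_periodic {f : ℝ → ℝ≥0∞} (hf : Function.Periodic f (2 * Real.pi))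
    (c : ℝ) : ∫⁻ β in Ioc (-Real.pi) Real.pi, f (β - c) = ∫⁻ β in Ioc (-Real.pi) Real.pi, f β := by
  have h2 : ∀ u : ℝ, Ioc (u - Real.pi) (u + Real.pi) =
      Ioc (u - Real.pi) (u - Real.pi + 2 * Real.pi) :=
    fun u => by congr 1; ring
  have h1 : ∫⁻ β in Ioc (-Real.pi) Real.pi, f (β - c) =
      ∫⁻ β in Ioc (-c - Real.pi) (-c + Real.pi), f β := by
    rw [← lintegral_indicator measurableSet_Ioc, ← lintegral_indicator measurableSet_Ioc,
      ← lintegral_sub_right_eq_self ((Ioc (-c - Real.pi) (-c + Real.pi)).indicator f) c]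
    refine lintegral_congr fun β => ?_
    by_cases h : β ∈ Ioc (-Real.pi) Real.pi
    · rw [indicator_of_mem h, indicator_of_mem (mem_Ioc.2 ⟨by linarith [h.1], by linarith [h.2]⟩)]
    · rw [indicator_of_notMem h, indicator_of_notMem fun h' =>
        h ⟨by linarith [h'.1], by linarith [h'.2]⟩]
  have h3 := h2 0
  rw [zero_sub, zero_add] at h3
  rw [h1, h2, h3]
  refine (isAddFundamentalDomain_Ioc Real.two_pi_pos _).setLIntegral_eq
    (isAddFundamentalDomain_Ioc Real.two_pi_pos _) _ fun g x => ?_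
  obtain ⟨n, hn⟩ := AddSubgroup.mem_zmultiples_iff.1 g.2
  rw [AddSubgroup.vadd_def, ← hn, vadd_eq_add, add_comm]
  exact hf.zsmul n x

lemma cosh_dist_I (z : ℍ) :
    Real.cosh (dist z UpperHalfPlane.I) = (z.re ^ 2 + z.im ^ 2 + 1) / (2 * z.im) := by
  rw [UpperHalfPlane.cosh_dist']
  simp

/-- As the boundary point runs over the circle, the exponential of minus the Busemann coordinate is
the abscissa of a point on the circle with centre `cosh r` and radius `sinh r`, `r = dist z i`. -/
lemma exists_neg_busemann_eq (z : ℍ) : ∃ c, ∀ β,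
    -busemann (Real.cos (β / 2)) (Real.sin (β / 2)) z =
      Real.log (Real.cosh (dist z UpperHalfPlane.I) +
        Real.sinh (dist z UpperHalfPlane.I) * Real.cos (β - c)) := by
  have hy := z.im_pos
  set r := dist z UpperHalfPlane.I with hr
  set w : ℂ := ⟨(1 - z.re ^ 2 - z.im ^ 2) / (2 * z.im), z.re / z.im⟩ with hw
  have hnorm : ‖w‖ = Real.sinh r := by
    rw [← Real.sqrt_sq (norm_nonneg w), ← Real.sqrt_sq (Real.sinh_nonneg_iff.2 dist_nonneg),
      Complex.sq_norm, Complex.normSq_apply, Real.sinh_sq, cosh_dist_I]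
    congr 1
    simp only [hw]
    field_simp
    ring
  refine ⟨w.arg, fun β => ?_⟩
  have hre : Real.sinh r * Real.cos w.arg = (1 - z.re ^ 2 - z.im ^ 2) / (2 * z.im) := by
    rw [← hnorm, Complex.norm_mul_cos_arg]
  have him : Real.sinh r * Real.sin w.arg = z.re / z.im := by
    rw [← hnorm, Complex.norm_mul_sin_arg]
  have hD := busemann_denom_pos (Real.cos_sq_add_sin_sq (β / 2)) z.re hy
  rw [busemann, neg_sub]
  change Real.log ((Real.cos (β / 2) + Real.sin (β / 2) * z.re) ^ 2 +
    (Real.sin (β / 2) * z.im) ^ 2) - Real.log z.im = _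
  rw [← Real.log_div hD.ne' hy.ne', Real.cos_sub, cosh_dist_I]
  congr 1
  have hcos : Real.cos β = Real.cos (β / 2) ^ 2 - Real.sin (β / 2) ^ 2 := by
    rw [← Real.cos_two_mul']; congr 1; ring
  have hsin : Real.sin β = 2 * Real.sin (β / 2) * Real.cos (β / 2) := by
    rw [← Real.sin_two_mul]; congr 1; ring
  have h1 := Real.cos_sq_add_sin_sq (β / 2)
  rw [show Real.sinh r * (Real.cos β * Real.cos w.arg + Real.sin β * Real.sin w.arg) =
    Real.cos β * (Real.sinh r * Real.cos w.arg) + Real.sin β * (Real.sinh r * Real.sin w.arg) by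
    ring, hre, him, hcos, hsin]
  field_simp
  linear_combination (z.re ^ 2 + z.im ^ 2 + 1) * h1

lemma lintegral_horocycleKernel_busemann {η : ℝ} (hη : 0 ≤ η) (z : ℍ) :
    ∫⁻ β in Ioc (-Real.pi) Real.pi,
      horocycleKernel η (-busemann (Real.cos (β / 2)) (Real.sin (β / 2)) z) =
    {z : ℍ | η < dist z UpperHalfPlane.I}.indicator (fun _ => ENNReal.ofReal (2 * Real.pi)) z := by
  obtain ⟨c, hc⟩ := exists_neg_busemann_eq z
  set r := dist z UpperHalfPlane.I with hr
  simp_rw [hc]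
  have hm : Measurable fun x => horocycleKernel η (Real.log (Real.cosh r + Real.sinh r * x)) :=
    (measurable_horocycleKernel η).comp (by fun_prop)
  rw [lintegral_Ioc_comp_sub_of_periodic (f := fun β => horocycleKernel η
    (Real.log (Real.cosh r + Real.sinh r * Real.cos β)))
    (fun β => by simp only [Real.cos_add_two_pi]),
    lintegral_Ioc_neg_pi_pi_comp_cos hm, lintegral_horocycleKernel_log hη dist_nonneg]
  by_cases h : η < r
  · rw [indicator_of_mem (mem_Ioi.2 h), indicator_of_mem
      (mem_ofPred.2 h : z ∈ {z : ℍ | η < dist z UpperHalfPlane.I}),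
      ENNReal.ofReal_mul two_pos.le]
    simp
  · rw [indicator_of_notMem (s := Ioi η) h, indicator_of_notMem
      (s := {z : ℍ | η < dist z UpperHalfPlane.I}) fun h' => h (mem_ofPred.1 h'), mul_zero]

variable {Ω : Type*} [MeasurableSpace Ω] {P : Measure Ω} {X : ℝ≥0 → Ω → ℍ}

/-- The tail of the radial part of hyperbolic Brownian motion, from the Gaussian law of its
Busemann coordinates averaged over the boundary circle. -/
lemma measure_lt_dist_eq_radialTail [IsProbabilityMeasure P] (hX : IsHypBrownian X P) {η : ℝ}
    (hη : 0 ≤ η) {s : ℝ≥0} (hs : 0 < s) :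
    P {ω | η < dist (X s ω) UpperHalfPlane.I} = radialTail η s := by
  have hXm := measurable_of_isHypBrownian hX s
  have hset : MeasurableSet {z : ℍ | η < dist z UpperHalfPlane.I} :=
    (isOpen_lt continuous_const (continuous_id.dist continuous_const)).measurableSet
  have hjoint : Measurable (Function.uncurry fun (ω : Ω) (β : ℝ) => horocycleKernel η
      (-busemann (Real.cos (β / 2)) (Real.sin (β / 2)) (X s ω))) := by
    have hc : Measurable fun x : Ω × ℝ => (X s x.1 : ℂ) :=
      UpperHalfPlane.continuous_coe.measurable.comp (hXm.comp measurable_fst)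
    refine (measurable_horocycleKernel η).comp ?_
    unfold busemann
    fun_prop
  have hmarg : ∀ β : ℝ, ∫⁻ ω, horocycleKernel η
      (-busemann (Real.cos (β / 2)) (Real.sin (β / 2)) (X s ω)) ∂P = radialTail η s := fun β => by
    have hpq := Real.cos_sq_add_sin_sq (β / 2)
    have hbm : Measurable fun ω => busemann (Real.cos (β / 2)) (Real.sin (β / 2)) (X s ω) :=
      (continuous_busemann_coe hpq).measurable.comp hXm
    have hbn : Measurable fun ω => -busemann (Real.cos (β / 2)) (Real.sin (β / 2)) (X s ω) :=
      hbm.neg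
    have hmap : P.map (fun ω => -busemann (Real.cos (β / 2)) (Real.sin (β / 2)) (X s ω)) =
        gaussianReal (s / 2) s := by
      have h := gaussianReal_map_neg (μ := -((s : ℝ) / 2)) (v := s)
      rw [neg_neg, ← map_busemann hX hpq s, Measure.map_map (by fun_prop) hbm] at h
      exact h
    rw [← lintegral_horocycleKernel_gaussianReal η hs, ← hmap,
      lintegral_map (measurable_horocycleKernel η) hbn]
  have h1 : ∫⁻ ω, (∫⁻ β in Ioc (-Real.pi) Real.pi, horocycleKernel η
      (-busemann (Real.cos (β / 2)) (Real.sin (β / 2)) (X s ω))) ∂P =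
      ENNReal.ofReal (2 * Real.pi) * P {ω | η < dist (X s ω) UpperHalfPlane.I} := by
    simp_rw [lintegral_horocycleKernel_busemann hη]
    exact lintegral_indicator_const (hXm hset) _
  have h2 := lintegral_lintegral_swap (μ := P) (ν := volume.restrict (Ioc (-Real.pi) Real.pi))
    hjoint.aemeasurable
  rw [h1] at h2
  simp_rw [hmarg] at h2
  rw [setLIntegral_const, Real.volume_Ioc, sub_neg_eq_add, ← two_mul,
    mul_comm (radialTail η s)] at h2
  exact (ENNReal.mul_right_inj (by simp [Real.pi_pos]) ENNReal.ofReal_ne_top).1 h2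

end

/-! ### The stopped distance -/

section

/-- Integration in the two independent arguments one after the other. The `σ`-algebra of the first
is an explicit argument, so that it can be a sub-`σ`-algebra of the ambient one. -/
lemma lintegral_prodMk_of_indepFun {Ω Ω' S : Type*} [MeasurableSpace Ω] (mΩ' : MeasurableSpace Ω')
    [MeasurableSpace S] {P : Measure Ω} [IsFiniteMeasure P] {f : Ω → Ω'} {T : Ω → S}
    (hf : Measurable f) (hT : AEMeasurable T P) (hind : IndepFun f T P) {G : Ω' × S → ℝ≥0∞}
    (hG : Measurable G) :
    ∫⁻ ω, G (f ω, T ω) ∂P = ∫⁻ ω, ∫⁻ ω', G (f ω', T ω) ∂P ∂P := by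
  have hmap := (indepFun_iff_map_prod_eq_prod_map_map hf.aemeasurable hT).1 hind
  have hinner : ∀ s, ∫⁻ x, G (x, s) ∂P.map f = ∫⁻ ω', G (f ω', s) ∂P := fun s =>
    lintegral_map (hG.comp measurable_prodMk_right) hf
  have hm : Measurable fun s => ∫⁻ x, G (x, s) ∂P.map f := hG.lintegral_prod_left'
  rw [← lintegral_map' (f := G) hG.aemeasurable (hf.aemeasurable.prodMk hT), hmap,
    lintegral_prod_symm _ hG.aemeasurable, lintegral_map' hm.aemeasurable hT]
  simp_rw [hinner]

lemma measure_lt_dist_of_indepFun {Ω Ω' : Type*} [MeasurableSpace Ω] (mΩ' : MeasurableSpace Ω')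
    {P : Measure Ω} [IsFiniteMeasure P] {X : ℝ≥0 → Ω' → ℍ} (hc : ∀ ω, Continuous fun s => X s ω)
    (hX : ∀ s, Measurable (X s)) {f : Ω → Ω'} {T : Ω → ℝ≥0} (hf : Measurable f)
    (hT : AEMeasurable T P) (hind : IndepFun f T P) (a : ℝ) :
    P {ω | a < dist (X (T ω) (f ω)) UpperHalfPlane.I} =
      ∫⁻ ω, P {ω' | a < dist (X (T ω) (f ω')) UpperHalfPlane.I} ∂P := by
  have hunc : Measurable fun x : Ω' × ℝ≥0 => X x.2 x.1 :=
    (measurable_uncurry_of_continuous_of_measurable hc hX).comp measurable_swap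
  have hdist : Measurable fun x : Ω' × ℝ≥0 => dist (X x.2 x.1) UpperHalfPlane.I :=
    hunc.dist measurable_const
  have hD : MeasurableSet {x : Ω' × ℝ≥0 | a < dist (X x.2 x.1) UpperHalfPlane.I} :=
    measurableSet_lt measurable_const hdist
  have key := lintegral_prodMk_of_indepFun mΩ' hf hT hind
    (measurable_one.indicator hD : Measurable
      ({x : Ω' × ℝ≥0 | a < dist (X x.2 x.1) UpperHalfPlane.I}.indicator (1 : Ω' × ℝ≥0 → ℝ≥0∞)))
  have h1 : NullMeasurableSet {ω | a < dist (X (T ω) (f ω)) UpperHalfPlane.I} P :=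
    (hf.aemeasurable.prodMk hT).nullMeasurable hD
  have h2 : ∀ s, MeasurableSet {ω' | a < dist (X s (f ω')) UpperHalfPlane.I} := fun s =>
    (hf.prodMk measurable_const) hD
  rw [← lintegral_indicator_one₀ h1]
  simp_rw [← fun s => lintegral_indicator_one (μ := P) (h2 s)]
  exact key

variable {Ω : Type*} [MeasurableSpace Ω] {P : Measure Ω} {X : ℝ≥0 → Ω → ℍ} {B : ℝ≥0 → Ω → ℝ}

lemma aemeasurable_dist_stopped (hX : IsHypBrownian X P) (hB : IsBrownianReal B P) {t : ℝ}
    (ht : 0 < t) :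
    AEMeasurable (fun ω => dist (X (firstPassage B t ω) ω) UpperHalfPlane.I) P := by
  have hX' : Measurable (Function.uncurry X) :=
    measurable_uncurry_of_continuous_of_measurable hX.continuous_paths
      (measurable_of_isHypBrownian hX)
  exact (continuous_id.dist continuous_const).measurable.comp_aemeasurable
    (hX'.comp_aemeasurable ((aemeasurable_firstPassage hB ht).prodMk aemeasurable_id))

/-- Conditioning on the first-passage time, which is independent of the hyperbolic motion. -/
lemma measure_lt_dist_stopped [IsProbabilityMeasure P] (hX : IsHypBrownian X P)
    (hB : IsBrownianReal B P)
    (hind : IndepFun (fun ω (s : ℝ≥0) => X s ω) (fun ω (s : ℝ≥0) => B s ω) P) {a t : ℝ}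
    (ha : 0 ≤ a) (ht : 0 < t) :
    P {ω | a < dist (X (firstPassage B t ω) ω) UpperHalfPlane.I} =
      ∫⁻ s in Ioi (0 : ℝ), ENNReal.ofReal (firstPassageDensity s t) * radialTail a s := by
  have hXm := measurable_of_isHypBrownian hX
  have hle : MeasurableSpace.comap (fun ω (s : ℝ≥0) => X s ω) inferInstance ≤ ‹MeasurableSpace Ω› :=
    (measurable_pi_lambda _ hXm : Measurable fun ω (s : ℝ≥0) => X s ω).comap_le
  have hT := aemeasurable_firstPassage hB ht
  have hindT : @IndepFun Ω Ω ℝ≥0 _ (MeasurableSpace.comap (fun ω (s : ℝ≥0) => X s ω) inferInstance)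
      _ id (firstPassage B t) P := by
    have h1 : IndepFun (fun ω (s : ℝ≥0) => X s ω)
        (fun ω => ratFirstPassage t fun q => B q ω) P :=
      hind.comp (ψ := fun b : ℝ≥0 → ℝ => ratFirstPassage t fun q : ℚ≥0 => b q) measurable_id
        ((measurable_ratFirstPassage t).comp
          (measurable_pi_lambda _ fun q => measurable_pi_apply _))
    have h2 := h1.congr (ae_eq_refl _) (ae_ratFirstPassage_eq hB ht)
    rw [IndepFun_iff_Indep] at h2
    refine (IndepFun_iff_Indep
      (mβ := MeasurableSpace.comap (fun ω (s : ℝ≥0) => X s ω) inferInstance) _ _ _).2 ?_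
    rwa [MeasurableSpace.comap_id]
  -- `X` is jointly measurable in `ω` and `s` already for the `σ`-algebra it generates
  have key := measure_lt_dist_of_indepFun
    (MeasurableSpace.comap (fun ω (s : ℝ≥0) => X s ω) inferInstance) hX.continuous_paths
    (fun s => (measurable_pi_apply s).comp (comap_measurable fun ω (s : ℝ≥0) => X s ω))
    (measurable_id.mono hle le_rfl) hT hindT a
  refine key.trans ?_
  have hpos : ∀ᵐ ω ∂P, 0 < firstPassage B t ω := by
    filter_upwards [hB.cont, hB.toIsPreBrownianReal.eval_zero_ae_eq_zero, ae_exists_eq hB ht]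
      with ω hc h0 h
    refine pos_iff_ne_zero.2 fun hz => ?_
    have := firstPassage_mem hc h
    rw [hz, h0] at this
    exact ht.ne this
  calc ∫⁻ ω, P {ω' | a < dist (X (firstPassage B t ω) (id ω')) UpperHalfPlane.I} ∂P
      = ∫⁻ ω, radialTail a (firstPassage B t ω) ∂P := by
        refine lintegral_congr_ae ?_
        filter_upwards [hpos] with ω hω
        exact measure_lt_dist_eq_radialTail hX ha hω
    _ = ∫⁻ s, radialTail a s ∂(P.map fun ω => (firstPassage B t ω : ℝ)) :=
        (lintegral_map' (measurable_radialTail a).aemeasurable hT.coe_nnreal_real).symm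
    _ = _ := by
        rw [map_firstPassage hB ht, lintegral_withDensity_eq_lintegral_mul _
          (by have := measurable_firstPassageDensity; fun_prop) (measurable_radialTail a)]
        rfl

lemma hasLaw_dist_stopped [IsProbabilityMeasure P] (hX : IsHypBrownian X P)
    (hB : IsBrownianReal B P)
    (hind : IndepFun (fun ω (s : ℝ≥0) => X s ω) (fun ω (s : ℝ≥0) => B s ω) P) {t : ℝ}
    (ht : 0 < t) :
    HasLaw (fun ω => dist (X (firstPassage B t ω) ω) UpperHalfPlane.I)
      ((volume.restrict (Ioi (0 : ℝ))).withDensity (fun η => ENNReal.ofReal (pJ2 η t))) P := by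
  have hm := aemeasurable_dist_stopped hX hB ht
  set ν := (volume.restrict (Ioi (0 : ℝ))).withDensity (fun η => ENNReal.ofReal (pJ2 η t)) with hν
  have hν1 : IsProbabilityMeasure ν := ⟨by
    rw [hν, withDensity_apply _ MeasurableSet.univ, Measure.restrict_univ,
      lintegral_pJ2_eq_one ht]⟩
  have hμ1 := Measure.isProbabilityMeasure_map (μ := P) hm
  refine ⟨hm, Measure.ext_of_Iic _ _ fun a => ?_⟩
  have hIoi : P.map (fun ω => dist (X (firstPassage B t ω) ω) UpperHalfPlane.I) (Ioi a) =
      ν (Ioi a) := by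
    rw [Measure.map_apply_of_aemeasurable hm measurableSet_Ioi, hν,
      withDensity_apply _ measurableSet_Ioi, Measure.restrict_restrict measurableSet_Ioi,
      Ioi_inter_Ioi]
    rcases le_or_gt 0 a with ha | ha
    · rw [sup_eq_left.2 ha, lintegral_pJ2 ha ht, ← measure_lt_dist_stopped hX hB hind ha ht]
      rfl
    · rw [sup_eq_right.2 ha.le, lintegral_pJ2_eq_one ht, ← measure_univ (μ := P)]
      congr 1
      exact eq_univ_of_forall fun ω => ha.trans_le dist_nonneg
  rw [← compl_Ioi, prob_compl_eq_one_sub measurableSet_Ioi, hIoi,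
    prob_compl_eq_one_sub measurableSet_Ioi]

end

end HypBM

theorem mainTheorem8 :
    -- the hyperbolic distance of the stopped process from the origin has density `p_{J₂}(·, t)`
    (∀ {Ω : Type*} [MeasurableSpace Ω] (P : Measure Ω) [IsProbabilityMeasure P]
        (X : ℝ≥0 → Ω → ℍ) (B : ℝ≥0 → Ω → ℝ),
        IsHypBrownian X P → IsBrownianReal B P →
        IndepFun (fun ω (s : ℝ≥0) => X s ω) (fun ω (s : ℝ≥0) => B s ω) P →
        ∀ t : ℝ, 0 < t →
          HasLaw (fun ω => dist (X (firstPassage B t ω) ω) UpperHalfPlane.I)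
            ((volume.restrict (Ioi (0 : ℝ))).withDensity
              (fun η => ENNReal.ofReal (pJ2 η t))) P) ∧
    -- `p_{J₂}(·, t)` is a probability density on `(0, ∞)`
    (∀ t : ℝ, 0 < t → (∀ η : ℝ, 0 < η → 0 ≤ pJ2 η t) ∧
        IntegrableOn (fun η => pJ2 η t) (Ioi 0) ∧ ∫ η in Ioi (0 : ℝ), pJ2 η t = 1) ∧
    -- the explicit integral converges and equals the subordination integral
    (∀ η t : ℝ, 0 < η → 0 < t →
        IntegrableOn (pJ2Integrand η t) (Ioi η) ∧
        IntegrableOn (fun s => hypRadialDensity η s * firstPassageDensity s t) (Ioi 0) ∧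
        pJ2 η t = ∫ s in Ioi (0 : ℝ), hypRadialDensity η s * firstPassageDensity s t) ∧
    -- the governing equation, the derivatives in it existing in the classical sense
    (∀ η : ℝ, 0 < η → ContDiffOn ℝ 2 (fun t => pJ2 η t) (Ioi 0)) ∧
    (∀ t : ℝ, 0 < t → ContDiffOn ℝ 2 (fun η => pJ2 η t) (Ioi 0)) ∧
    (∀ η t : ℝ, 0 < η → 0 < t →
        -iteratedDeriv 2 (fun τ => pJ2 η τ) t =
          iteratedDeriv 2 (fun ξ => pJ2 ξ t) η -
            deriv (fun ξ => 1 / Real.tanh ξ * pJ2 ξ t) η) ∧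
    -- the initial condition `p_{J₂}(η, 0) = δ(η)`, as weak convergence of measures on `[0, ∞)`
    (∀ f : ℝ →ᵇ ℝ,
        Tendsto (fun t => ∫ η in Ioi (0 : ℝ), f η * pJ2 η t) (𝓝[>] 0) (𝓝 (f 0))) := by
  exact ⟨fun P _ X B hX hB hind t ht => HypBM.hasLaw_dist_stopped hX hB hind ht,
    fun t ht => ⟨fun η hη => HypBM.pJ2_nonneg hη ht, HypBM.integrableOn_pJ2 ht,
      HypBM.integral_pJ2 ht⟩,
    fun η t hη ht => ⟨HypBM.integrableOn_pJ2Integrand hη ht,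
      HypBM.integrableOn_hypRadialDensity_mul hη ht, HypBM.pJ2_eq_integral hη ht⟩,
    fun η hη => HypBM.contDiffOn_pJ2_time hη, fun t ht => HypBM.contDiffOn_pJ2_space ht,
    fun η t hη ht => HypBM.pJ2_pde hη ht, fun f => HypBM.tendsto_integral_mul_pJ2 f⟩
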